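/- \textbf{Setting.} Let $\mathbb G=\bigsqcup_{n\ge 0}S_n$ be a set partitioned into finite shells $S_n$, and let $(H_{xy})_{x,y\in\mathbb G}$ be a Hermitian kernel ($H_{xy}=\langle\delta_x,H\delta_y\rangle$) with $H_{xy}=0$ whenever $x\in S_j$, $y\in S_k$ and $|j-k|\ge 2$. The kernel acts on all functions on $\mathbb G$; let $H$ be the operator in $\ell^2(\mathbb G)$ given by this action on its natural domain $\{\psi\in\ell^2(\mathbb G): H\psi\in\ell^2(\mathbb G)\}$. For $n\ge 1$ let $W_n$ be the block of $H$ from $\ell^2(S_{n-1})$ to $\ell^2(S_n)$ and $r_n=\operatorname{rank}W_n$; put $r_0=1$. Choose factorizations $W_n=-\Upsilon_n\Phi_{n-1}^*$, $n\ge1$, where $\Upsilon_n\in\mathbb C^{S_n\times r_n}$ and $\Phi_{n-1}\in\mathbb C^{S_{n-1}\times r_n}$ have full rank $r_n$, and a nonzero root vector $\Upsilon_0\in\mathbb C^{S_0}=\mathbb C^{S_0\times r_0}$. For $m\le n$ let $H_{m,n}$ be the restriction of $H$ to $\mathbb G_{m,n}=S_m\sqcup\dots\sqcup S_n$, extend $\Upsilon_m,\Phi_n$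 by zero to $\mathbb G_{m,n}$ (written $\hat\Upsilon_m,\hat\Phi_n$), and let $$R^z_{m,n}=\begin{pmatrix}\alpha^z_{m,n}&\beta^z_{m,n}\\ \gamma^z_{m,n}&\delta^z_{m,n}\end{pmatrix}=\begin{pmatrix}\hat\Upsilon_m^*\\ \hat\Phi_n^*\end{pmatrix}(H_{m,n}-z)^{-1}\begin{pmatrix}\hat\Upsilon_m&\hat\Phi_n\end{pmatrix},$$ extended analytically to points of the spectrum of $H_{m,n}$ where possible; $A^1_{m,n}\subset\mathbb R$ is the finite set of real points where no analytic extension exists. Write $\alpha^z_n=\alpha^z_{n,n}$, etc. Put $$\mathbb T^z_n=\Big\{\begin{pmatrix}B&-\mathfrak b\\ \delta^z_nB&\gamma^z_n-\delta^z_n\mathfrak b\end{pmatrix}:\ \beta^z_nB=\mathbf 1,\ \beta^z_n\mathfrak b=\alpha^z_n\Big\},\qquad \mathbf T^z_n=\Big\{\begin{pmatrix}B&-B\alpha^z_n\\ \delta^z_nB&\gamma^z_n-\delta^z_nB\alpha^z_n\end{pmatrix}:\ \beta^z_nB=\mathbf 1\Big\},$$ $$\mathbf D^z_n=\Big\{\begin{pmatrix}B\\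 \delta^z_{0,n}B\end{pmatrix}:\ \beta^z_{0,n}B=1\Big\}\subset\mathbb C^{2r_{n+1}}.$$ \textbf{Theorem.} Assume that $H$ is self-adjoint on its natural domain and that (A1) $r_{n+1}\ge r_n$ for all $n\ge 0$; (A2) for every $n\ge0$ and Lebesgue-almost every $\lambda\in\mathbb R$ the matrix $\beta^\lambda_n\in\mathbb C^{r_n\times r_{n+1}}$ has rank $r_n$. Let $\mu$ be the spectral measure of $H$ at the root vector $v\in\ell^2(\mathbb G)$ ($\Upsilon_0$ extended by zero), i.e. the unique finite Borel measure on $\mathbb R$ with $\int f\,d\mu=\langle v,f(H)v\rangle$ for all continuous $f$ vanishing at infinity. Let $\nu=\sum_{\lambda\in\mathbb R}\|P_\lambda v\|^2\,\delta_{\{\lambda\}}$, where $P_\lambda$ is the orthogonal projection onto the closed span of the finitely supported eigenfunctions of $H$ with eigenvalue $\lambda$. Then $\nu$ is a point measure supported on $\bigcup_{m\ge 0}\bigcap_{n\ge m}A^1_{0,n}$, and \begin{align*} d\mu(\lambda)&=d\nu(\lambda)+\lim_{n\to\infty}\frac1\pi\Big\|\big(\mathbf 1+(\delta^\lambda_{0,n})^2\big)^{-1/2}\gamma^\lambda_{0,n}\Big\|^2d\lambda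 =d\nu(\lambda)+\lim_{n\to\infty}\frac1\pi\Big(\min_{u\in\mathbf D^\lambda_n}\|u\|^2\Big)^{-1}d\lambda\\ &=d\nu(\lambda)+\lim_{n\to\infty}\frac1\pi\max_{T_i\in\mathbb T^\lambda_i,\,0\le i\le n}\Big\|T_nT_{n-1}\cdots T_0\begin{pmatrix}1\\0\end{pmatrix}\Big\|^{-2}d\lambda\\ &=d\nu(\lambda)+\lim_{n\to\infty}\frac1\pi\max_{T_i\in\mathbf T^\lambda_i,\,0\le i\le n}\Big\|T_nT_{n-1}\cdots T_0\begin{pmatrix}1\\0\end{pmatrix}\Big\|^{-2}d\lambda . \end{align*} All norms are Euclidean, and the limits are weak limits of finite measures (tested against bounded continuous functions). For each $n$ and all but finitely many $\lambda\in\mathbb R$ the minimum (which is positive) and the maxima are attained and the four densities coincide. -/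

import Mathlib

open MeasureTheory Filter Topology Matrix
open scoped BoundedContinuousFunction ZeroAtInfty lp

noncomputable section

/-! ### Functional calculus and spectral measures of a self-adjoint operator -/

/-- `R` is the (everywhere defined, bounded) inverse of `H - z`. -/
def IsResolventAt {E : Type*} [NormedAddCommGroup E] [InnerProductSpace ℂ E]
    (H : E →ₗ.[ℂ] E) (z : ℂ) (R : E →L[ℂ] E) : Prop :=
  (∀ φ : E, ∃ h : R φ ∈ H.domain, H ⟨R φ, h⟩ - z • R φ = φ) ∧
    ∀ ψ : H.domain, R (H ψ - z • (ψ : E)) = ψ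

open Classical in
/-- The resolvent `(H - z)⁻¹` of a possibly unbounded operator (it is unique; the junk value `0` is
taken only where it does not exist). -/
def resolventAt {E : Type*} [NormedAddCommGroup E] [InnerProductSpace ℂ E]
    (H : E →ₗ.[ℂ] E) (z : ℂ) : E →L[ℂ] E :=
  if h : ∃ R : E →L[ℂ] E, IsResolventAt H z R then h.choose else 0

open Classical in
/-- `f(H)` for a self-adjoint `H` and `f` continuous and vanishing at infinity. The bounded normal
operator `(H - i)⁻¹` has its spectrum in `{(t - i)⁻¹ : t ∈ ℝ} ∪ {0}`, and `f(H)` is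
the continuous function `(t - i)⁻¹ ↦ f t`, `0 ↦ 0` of that operator. -/
def funcOf {E : Type*} [NormedAddCommGroup E] [InnerProductSpace ℂ E] [CompleteSpace E]
    (H : E →ₗ.[ℂ] E) (f : C₀(ℝ, ℂ)) : E →L[ℂ] E :=
  cfc (fun w : ℂ => if w = 0 then 0 else f (w⁻¹ + Complex.I).re) (resolventAt H Complex.I)

/-- `μ` is the spectral measure of `H` at the vector `v`: `∫ f dμ = ⟨v, f(H) v⟩`. -/
def IsSpectralMeasure {E : Type*} [NormedAddCommGroup E] [InnerProductSpace ℂ E] [CompleteSpace E]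
    (H : E →ₗ.[ℂ] E) (v : E) (μ : Measure ℝ) : Prop :=
  IsFiniteMeasure μ ∧ ∀ f : C₀(ℝ, ℂ), ∫ t, f t ∂μ = inner ℂ v (funcOf H f v)

/-- Weak convergence of finite measures on the line. -/
def WeakLim (μs : ℕ → Measure ℝ) (ρ : Measure ℝ) : Prop :=
  (∀ n, IsFiniteMeasure (μs n)) ∧ IsFiniteMeasure ρ ∧
    ∀ f : ℝ →ᵇ ℝ, Tendsto (fun n => ∫ t, f t ∂(μs n)) atTop (𝓝 (∫ t, f t ∂ρ))

/-- The Euclidean norm of a complex vector. -/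
def eNorm {ι : Type*} [Fintype ι] (u : ι → ℂ) : ℝ := ‖WithLp.toLp 2 u‖

/-! ### Locally finite hopping operators with a quasi-spherical partition -/

/-- A Hermitian kernel on `G` (`ker x y = ⟨δ_x, H δ_y⟩`) with a partition of `G` into the finite
shells `{x | shell x = n}` such that `H` connects a shell only to itself and its neighbours. -/
structure ShellOperator (G : Type*) where
  shell : G → ℕ
  finite_shell : ∀ n, {x | shell x = n}.Finite
  ker : Matrix G G ℂ
  isHermitian : ker.IsHermitian
  hopping : ∀ x y, shell x + 2 ≤ shell y ∨ shell y + 2 ≤ shell x → ker x y = 0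

namespace ShellOperator

variable {G : Type*} (H : ShellOperator G)

/-- The shell `S_n`. -/
abbrev Shell (n : ℕ) : Type _ := {x : G // H.shell x = n}

/-- The union `G_{m,n}` of the shells `S_m, …, S_n`. -/
abbrev Part (m n : ℕ) : Type _ := {x : G // m ≤ H.shell x ∧ H.shell x ≤ n}

instance (n : ℕ) : Finite (H.Shell n) := (H.finite_shell n).to_subtype

instance (m n : ℕ) : Finite (H.Part m n) := by
  have h : {x : G | m ≤ H.shell x ∧ H.shell x ≤ n}.Finite := by
    refine ((Set.finite_Iic n).biUnion fun k _ => H.finite_shell k).subset ?_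
    intro x hx
    simpa using hx.2
  exact h.to_subtype

instance (n : ℕ) : Fintype (H.Shell n) := Fintype.ofFinite _

instance (m n : ℕ) : Fintype (H.Part m n) := Fintype.ofFinite _

theorem finite_row (x : G) (ψ : G → ℂ) :
    Function.HasFiniteSupport fun y => H.ker x y * ψ y := by
  have h : {y : G | 0 ≤ H.shell y ∧ H.shell y ≤ H.shell x + 1}.Finite :=
    Set.finite_coe_iff.mp (inferInstanceAs (Finite (H.Part 0 (H.shell x + 1))))
  refine Set.Finite.subset h ?_
  intro y hy
  refine ⟨Nat.zero_le _, ?_⟩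
  by_contra hlt
  exact hy (by simp [H.hopping x y (Or.inl (by omega))])

/-- The action of `H` on arbitrary functions on `G` (all sums are finite). -/
def formal : (G → ℂ) →ₗ[ℂ] (G → ℂ) where
  toFun ψ x := ∑ᶠ y, H.ker x y * ψ y
  map_add' ψ φ := by
    funext x
    simp only [Pi.add_apply, mul_add]
    exact finsum_add_distrib (H.finite_row x ψ) (H.finite_row x φ)
  map_smul' c ψ := by
    funext x
    simp only [Pi.smul_apply, smul_eq_mul, RingHom.id_apply, mul_finsum]
    exact finsum_congr fun y => by ring

/-- `H` as an operator in `ℓ²(G)` with its natural (maximal) domain: all `ψ ∈ ℓ²(G)` with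
`Hψ ∈ ℓ²(G)`. -/
def natural : ℓ²(G, ℂ) →ₗ.[ℂ] ℓ²(G, ℂ) where
  domain :=
    { carrier := {ψ | Memℓp (H.formal ψ) 2}
      add_mem' := by
        intro ψ φ hψ hφ
        simp only [Set.mem_ofPred_eq, lp.coeFn_add, map_add] at *
        exact hψ.add hφ
      zero_mem' := by
        simp only [Set.mem_ofPred_eq, lp.coeFn_zero, map_zero]
        exact zero_memℓp
      smul_mem' := by
        intro c ψ hψ
        simp only [Set.mem_ofPred_eq, lp.coeFn_smul, map_smul] at *
        exact hψ.const_smul c }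
  toFun :=
    { toFun := fun ψ => ⟨H.formal (ψ : ℓ²(G, ℂ)), ψ.2⟩
      map_add' := by
        intro ψ φ
        ext1
        exact map_add H.formal _ _
      map_smul' := by
        intro c ψ
        ext1
        exact map_smul H.formal _ _ }

/-- The connection matrix `W_{n+1}` from `S_n` to `S_{n+1}`. -/
def conn (n : ℕ) : Matrix (H.Shell (n + 1)) (H.Shell n) ℂ := fun x y => H.ker x y

/-- `r_0 = 1` and `r_n = rank W_n` for `n ≥ 1`. -/
def rk : ℕ → ℕ
  | 0 => 1
  | n + 1 => (H.conn n).rank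

/-- The Hermitian matrix `H_{m,n}`, the restriction of `H` to `G_{m,n}`. -/
def part (m n : ℕ) : Matrix (H.Part m n) (H.Part m n) ℂ := fun x y => H.ker x y

/-- The span of the eigenfunctions of `H` with finite support for the eigenvalue `t`. -/
def compactEigenspace (t : ℝ) : Submodule ℂ ℓ²(G, ℂ) :=
  Submodule.span ℂ {ψ | (Function.support (ψ : G → ℂ)).Finite ∧
    ∃ h : ψ ∈ H.natural.domain, H.natural ⟨ψ, h⟩ = (t : ℂ) • ψ}

/-- The point measure generated at the vector `v` by the eigenfunctions of `H` with finite support: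
its mass at `t` is `‖P_t v‖²`, with `P_t` the orthogonal projection onto the closed span of these
eigenfunctions for the eigenvalue `t`. -/
def compactEigenMeasure (v : ℓ²(G, ℂ)) : Measure ℝ :=
  Measure.sum fun t : ℝ =>
    ENNReal.ofReal (‖(H.compactEigenspace t).topologicalClosure.starProjection v‖ ^ 2) •
      Measure.dirac t

/-- A choice of full rank factorizations `W_n = -Υ_n Φ_{n-1}^*`, `n ≥ 1`, and of a nonzero root
vector `Υ_0` on `S_0`. -/
structure Channels where
  Υ : ∀ n, Matrix (H.Shell n) (Fin (H.rk n)) ℂ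
  Φ : ∀ n, Matrix (H.Shell n) (Fin (H.rk (n + 1))) ℂ
  rank_Υ : ∀ n, (Υ n).rank = H.rk n
  rank_Φ : ∀ n, (Φ n).rank = H.rk (n + 1)
  factor : ∀ n, H.conn n = -(Υ (n + 1) * (Φ n)ᴴ)

namespace Channels

variable {H} (C : H.Channels)

open Classical in
/-- The root vector `P_0 Υ_0` in `ℓ²(G)` (`Υ_0` has a single column). -/
def root : ℓ²(G, ℂ) := ∑ x : H.Shell 0, lp.single 2 (x : G) ((C.Υ 0 *ᵥ 1) x)

open Classical in
/-- The matrix with block columns `Υ_m` and `Φ_n`, each extended by zero to `G_{m,n}`. -/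
def bdry (m n : ℕ) : Matrix (H.Part m n) (Fin (H.rk m) ⊕ Fin (H.rk (n + 1))) ℂ :=
  fromCols (fun x j => if h : H.shell x = m then C.Υ m ⟨x, h⟩ j else 0)
    (fun x j => if h : H.shell x = n then C.Φ n ⟨x, h⟩ j else 0)

open Classical in
/-- The boundary resolvent data at `z` outside the spectrum of `H_{m,n}`. -/
def rawData (m n : ℕ) (z : ℂ) :
    Matrix (Fin (H.rk m) ⊕ Fin (H.rk (n + 1))) (Fin (H.rk m) ⊕ Fin (H.rk (n + 1))) ℂ :=
  (C.bdry m n)ᴴ * (H.part m n - z • 1)⁻¹ * C.bdry m n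

open Classical in
/-- The boundary resolvent data `R^z_{m,n}`; at a point of the spectrum of `H_{m,n}` it is the value
of the analytic extension, if there is one. -/
def data (m n : ℕ) (z : ℂ) :
    Matrix (Fin (H.rk m) ⊕ Fin (H.rk (n + 1))) (Fin (H.rk m) ⊕ Fin (H.rk (n + 1))) ℂ :=
  if IsUnit (H.part m n - z • 1) then C.rawData m n z else limUnder (𝓝[≠] z) (C.rawData m n)

/-- The set `A^1_{m,n}` of the real points at which `z ↦ R^z_{m,n}` has no analytic extension. -/
def singSet (m n : ℕ) : Set ℝ :=
  {t | ¬ ∃ F : ℂ → Matrix (Fin (H.rk m) ⊕ Fin (H.rk (n + 1)))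
        (Fin (H.rk m) ⊕ Fin (H.rk (n + 1))) ℂ,
      (∀ i j, AnalyticAt ℂ (fun z => F z i j) t) ∧ ∀ᶠ z in 𝓝[≠] (t : ℂ), F z = C.rawData m n z}

/-- The block `α^z_{m,n}`. -/
def α (m n : ℕ) (z : ℂ) : Matrix (Fin (H.rk m)) (Fin (H.rk m)) ℂ := (C.data m n z).toBlocks₁₁

/-- The block `β^z_{m,n}`. -/
def β (m n : ℕ) (z : ℂ) : Matrix (Fin (H.rk m)) (Fin (H.rk (n + 1))) ℂ :=
  (C.data m n z).toBlocks₁₂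

/-- The block `γ^z_{m,n}`. -/
def γ (m n : ℕ) (z : ℂ) : Matrix (Fin (H.rk (n + 1))) (Fin (H.rk m)) ℂ :=
  (C.data m n z).toBlocks₂₁

/-- The block `δ^z_{m,n}`. -/
def δ (m n : ℕ) (z : ℂ) : Matrix (Fin (H.rk (n + 1))) (Fin (H.rk (n + 1))) ℂ :=
  (C.data m n z).toBlocks₂₂

/-- The larger set `𝕋^z_n` of transfer matrices at the shell `n`. -/
def transfer (n : ℕ) (z : ℂ) : Set (Matrix (Fin (H.rk (n + 1)) ⊕ Fin (H.rk (n + 1)))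
    (Fin (H.rk n) ⊕ Fin (H.rk n)) ℂ) :=
  {T | ∃ B b : Matrix (Fin (H.rk (n + 1))) (Fin (H.rk n)) ℂ,
    C.β n n z * B = 1 ∧ C.β n n z * b = C.α n n z ∧
    T = fromBlocks B (-b) (C.δ n n z * B) (C.γ n n z - C.δ n n z * b)}

/-- The smaller set `𝐓^z_n` of transfer matrices at the shell `n`. -/
def transferS (n : ℕ) (z : ℂ) : Set (Matrix (Fin (H.rk (n + 1)) ⊕ Fin (H.rk (n + 1)))
    (Fin (H.rk n) ⊕ Fin (H.rk n)) ℂ) :=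
  {T | ∃ B : Matrix (Fin (H.rk (n + 1))) (Fin (H.rk n)) ℂ, C.β n n z * B = 1 ∧
    T = fromBlocks B (-(B * C.α n n z)) (C.δ n n z * B)
      (C.γ n n z - C.δ n n z * B * C.α n n z)}

/-- The set `𝐃^z_n` of boundary vectors with initial Dirichlet condition. -/
def dirichlet (n : ℕ) (z : ℂ) : Set (Fin (H.rk (n + 1)) ⊕ Fin (H.rk (n + 1)) → ℂ) :=
  {u | ∃ B : Matrix (Fin (H.rk (n + 1))) (Fin (H.rk 0)) ℂ, C.β 0 n z * B = 1 ∧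
    u = fromRows B (C.δ 0 n z * B) *ᵥ 1}

end Channels

/-- The vector `T_{n-1} ⋯ T_0 (1, 0)ᵀ`. -/
def chain (T : ∀ i, Matrix (Fin (H.rk (i + 1)) ⊕ Fin (H.rk (i + 1)))
    (Fin (H.rk i) ⊕ Fin (H.rk i)) ℂ) : ∀ n, Fin (H.rk n) ⊕ Fin (H.rk n) → ℂ
  | 0 => Sum.elim 1 0
  | n + 1 => T n *ᵥ chain T n

namespace Channels

variable {H} (C : H.Channels)

/-- The values `‖u‖²`, `u ∈ 𝐃^t_n`. -/
def dirichletValues (n : ℕ) (t : ℝ) : Set ℝ := (fun u => eNorm u ^ 2) '' C.dirichlet n t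

/-- The values `‖T_n ⋯ T_0 (1, 0)ᵀ‖⁻²` over all choices `T_i ∈ 𝕋^t_i`. -/
def transferValues (n : ℕ) (t : ℝ) : Set ℝ :=
  {a | ∃ T, (∀ i ≤ n, T i ∈ C.transfer i t) ∧ a = (eNorm (H.chain T (n + 1)) ^ 2)⁻¹}

/-- The values `‖T_n ⋯ T_0 (1, 0)ᵀ‖⁻²` over all choices `T_i ∈ 𝐓^t_i`. -/
def transferSValues (n : ℕ) (t : ℝ) : Set ℝ :=
  {a | ∃ T, (∀ i ≤ n, T i ∈ C.transferS i t) ∧ a = (eNorm (H.chain T (n + 1)) ^ 2)⁻¹}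

/-- `(1/π) ‖(1 + (δ^t_{0,n})²)^{-1/2} γ^t_{0,n}‖²`. -/
def density (n : ℕ) (t : ℝ) : ℝ :=
  1 / Real.pi * eNorm ((cfc (fun s : ℝ => s ^ (-(1 / 2) : ℝ)) (1 + C.δ 0 n t ^ 2) *
    C.γ 0 n t) *ᵥ 1) ^ 2

/-- `(1/π) (min ‖u‖²)⁻¹` over `u ∈ 𝐃^t_n`. -/
def densityD (n : ℕ) (t : ℝ) : ℝ := 1 / Real.pi * (sInf (C.dirichletValues n t))⁻¹

/-- `(1/π) max ‖T_n ⋯ T_0 (1, 0)ᵀ‖⁻²` over `T_i ∈ 𝕋^t_i`. -/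
def densityT (n : ℕ) (t : ℝ) : ℝ := 1 / Real.pi * sSup (C.transferValues n t)

/-- `(1/π) max ‖T_n ⋯ T_0 (1, 0)ᵀ‖⁻²` over `T_i ∈ 𝐓^t_i`. -/
def densityS (n : ℕ) (t : ℝ) : ℝ := 1 / Real.pi * sSup (C.transferSValues n t)

end Channels

end ShellOperator

/-- The measure `g(t) dt` on the line. -/
def lineMeasure (g : ℝ → ℝ) : Measure ℝ := volume.withDensity fun t => ENNReal.ofReal (g t)

end

noncomputable section

/-! ### Integrals over the real line of functions holomorphic in the upper half-plane -/

namespace HalfPlane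

variable {E : Type*} [NormedAddCommGroup E] [NormedSpace ℂ E]

/-! Replace `H` by the dissipative cut-offs `B_n = H_{0,n} - i Φ̂_n Φ̂_n*` on the finite pieces
`G_{0,n}`. They only lose norm, so `(B_n - i)⁻¹` is a contraction. On the dense set `(H -
i)`(finitely supported functions) it eventually agrees with `(H - i)⁻¹`; density is where
self-adjointness on the natural domain enters. Hence `⟨v, (B_n - i)⁻ʲ v⟩ → ⟨v, (H - i)⁻ʲ v⟩` for all
`j` (`dense_core`, `tendsto_cutRes`, `tendsto_inner_dissRes`).

In finite dimension these numbers are the moments `∫ (t - i)⁻ʲ dμ_n` of a positive measure. The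
spectrum of `B_n` lies in the closed lower half-plane, and its real eigenvectors are the hidden
ones: eigenvectors of `H_{0,n}` annihilated by `Φ̂_n*`. Cauchy's theorem in the upper half-plane
gives `μ_n = (1/π) ‖Φ̂_n* (B_n - t)⁻¹ v‖² dt` plus a point mass `‖P v‖²` for each hidden eigenspace
(`moment_diss`). The values `(t - i)⁻¹` fill a circle without its point `0`, and Stone–Weierstrass
on the circle turns convergence of moments into weak convergence `μ_n → μ`
(`tendsto_integral_of_moments`).

Since `Υ_{n+1}` is injective, the hidden eigenvectors are exactly the eigenfunctions of `H`
supported in `G_{0,n}` (`emb_mem_eigenIn`). Their projections increase to those defining `ν`, so the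
point parts converge on their own and can be subtracted (`weakLim_sub_point`). A hidden component of
`v` makes `α_{0,n}` blow up, which locates the support of `ν`.

It remains to identify the density. Solving `(B_n - t) x = v` leaves the equation `(1 - iδ) y = γ`
for the boundary amplitude `y`, so the density is `(1/π) ⟨γ, (1 + δ²)⁻¹ γ⟩` (`cutDensity_eq`). By
Cauchy–Schwarz this is the reciprocal of the least `‖(b, δ b)‖²` under `β b = 1`
(`BoundaryVector.isLeast`). Gluing one shell at a time shows that, for all but finitely many `t`,
the products of transfer matrices applied to `(1, 0)` sweep out exactly these boundary vectors
(`chain_mem_dirichlet`, `exists_chain_of_mem_dirichlet`). -/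

theorem integrable_inv_one_add_abs_sq : Integrable fun t : ℝ => ((1 + |t|) ^ 2)⁻¹ := by
  refine integrable_inv_one_add_sq.mono' (by fun_prop) (.of_forall fun t => ?_)
  rw [Real.norm_of_nonneg (by positivity)]
  refine inv_anti₀ (by positivity) ?_
  nlinarith [sq_abs t, abs_nonneg t]

/-- `f` is holomorphic near the closed upper half-plane and decays quadratically there. -/
structure DecaySq (f : ℂ → E) : Prop where
  diff : ∀ z : ℂ, 0 ≤ z.im → DifferentiableAt ℂ f z
  bound : ∃ C : ℝ, ∀ z : ℂ, 0 ≤ z.im → ‖f z‖ ≤ C / (1 + ‖z‖) ^ 2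

theorem DecaySq.continuous {f : ℂ → E} (hf : DecaySq f) : Continuous fun t : ℝ => f t := by
  rw [continuous_iff_continuousAt]
  intro t
  have h := (hf.diff t (by simp)).continuousAt
  exact h.comp Complex.continuous_ofReal.continuousAt

theorem DecaySq.integrable {f : ℂ → E} (hf : DecaySq f) : Integrable fun t : ℝ => f t := by
  obtain ⟨C, hC⟩ := hf.bound
  refine (integrable_inv_one_add_abs_sq.const_mul C).mono' hf.continuous.aestronglyMeasurable
    (.of_forall fun t => ?_)
  simpa [div_eq_mul_inv] using hC t (by simp)

/-- Cauchy's theorem on the rectangle with base `[-T, T]` and height `T`: the other three sides have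
total length `4T`, and `f` is at most `C / T²` on them. -/
theorem DecaySq.integral_eq_zero {f : ℂ → E} (hf : DecaySq f) : ∫ t : ℝ, f t = 0 := by
  obtain ⟨C, hC⟩ := hf.bound
  have hC0 : 0 ≤ C := by
    have := (norm_nonneg _).trans (hC 0 (by simp))
    simpa using this
  have key : ∀ T : ℝ, 0 < T → ‖∫ t in (-T)..T, f t‖ ≤ 4 * C / T := by
    intro T hT
    have h := Complex.integral_boundary_rect_eq_zero_of_differentiableOn f (-T : ℂ) (T + T * Complex.I)
      (fun z hz => by
        refine (hf.diff z ?_).differentiableWithinAt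
        have := hz.2
        simp only [Complex.neg_im, Complex.ofReal_im, neg_zero, Complex.add_im, Complex.mul_im,
          Complex.ofReal_re, Complex.I_im, mul_one, Complex.I_re, mul_zero, add_zero, zero_add,
          Set.mem_preimage, Set.uIcc_of_le hT.le] at this
        exact this.1)
    simp only [Complex.neg_re, Complex.ofReal_re, Complex.add_re, Complex.mul_re, Complex.I_re,
      mul_zero, Complex.ofReal_im, Complex.I_im, mul_one, sub_self, add_zero, Complex.neg_im,
      neg_zero, Complex.ofReal_zero, zero_mul, Complex.add_im, Complex.mul_im, zero_add] at h
    have bd : ∀ z : ℂ, 0 ≤ z.im → T ≤ ‖z‖ → ‖f z‖ ≤ C / T ^ 2 := fun z hz hTz =>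
      (hC z hz).trans (by gcongr; linarith)
    have h1 : ‖∫ x in (-T)..T, f (x + T * Complex.I)‖ ≤ C / T ^ 2 * |T - -T| := by
      refine intervalIntegral.norm_integral_le_of_norm_le_const fun x _ => bd _ (by simp [hT.le]) ?_
      refine le_trans ?_ (Complex.abs_im_le_norm _)
      simp [abs_of_pos hT]
    have hv : ∀ s : ℝ, T ≤ |s| → ‖∫ y in (0 : ℝ)..T, f (s + y * Complex.I)‖ ≤ C / T ^ 2 * |T - 0| := by
      intro s hs
      refine intervalIntegral.norm_integral_le_of_norm_le_const fun y hy => bd _ ?_ ?_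
      · rw [Set.uIoc_of_le hT.le] at hy
        simpa using hy.1.le
      · refine le_trans ?_ (Complex.abs_re_le_norm _)
        simpa using hs
    have h2 := hv T (by rw [abs_of_pos hT])
    have h3 := hv (-T) (by rw [abs_neg, abs_of_pos hT])
    push_cast at h3
    have e : ∫ t in (-T)..T, f t = (∫ x in (-T)..T, f (x + T * Complex.I))
        - Complex.I • (∫ y in (0 : ℝ)..T, f (T + y * Complex.I))
        + Complex.I • ∫ y in (0 : ℝ)..T, f (-T + y * Complex.I) := by
      push_cast at h
      rw [← sub_eq_zero]
      refine Eq.trans ?_ h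
      module
    rw [e]
    refine (norm_add_le _ _).trans ((add_le_add_left (norm_sub_le _ _) _).trans ?_)
    rw [norm_smul, norm_smul, Complex.norm_I, one_mul, one_mul]
    refine (add_le_add (add_le_add h1 h2) h3).trans (le_of_eq ?_)
    rw [sub_neg_eq_add, sub_zero, abs_of_pos (by linarith : 0 < T + T), abs_of_pos hT]
    field_simp
    ring
  have l1 := intervalIntegral_tendsto_integral hf.integrable tendsto_neg_atTop_atBot tendsto_id
  have l2 : Tendsto (fun T : ℝ => ∫ t in (-T)..T, f t) atTop (𝓝 0) := by
    refine squeeze_zero_norm' ?_ (tendsto_const_nhds.div_atTop tendsto_id : Tendsto (fun T : ℝ => 4 * C / T) atTop (𝓝 0))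
    filter_upwards [eventually_gt_atTop 0] with T hT using key T hT
  exact tendsto_nhds_unique l1 l2

/-- `f` is holomorphic near the closed upper half-plane and decays there. -/
structure Decay (f : ℂ → E) : Prop where
  diff : ∀ z : ℂ, 0 ≤ z.im → DifferentiableAt ℂ f z
  bound : ∃ C : ℝ, 0 ≤ C ∧ ∀ z : ℂ, 0 ≤ z.im → ‖f z‖ ≤ C / (1 + ‖z‖)

theorem Decay.smul {f : ℂ → ℂ} {g : ℂ → E} (hf : Decay f) (hg : Decay g) :
    DecaySq fun z => f z • g z := by
  obtain ⟨C, hC0, hC⟩ := hf.bound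
  obtain ⟨D, hD0, hD⟩ := hg.bound
  refine ⟨fun z hz => (hf.diff z hz).smul (hg.diff z hz), C * D, fun z hz => ?_⟩
  rw [norm_smul]
  refine (mul_le_mul (hC z hz) (hD z hz) (norm_nonneg _) (by positivity)).trans (le_of_eq ?_)
  field_simp

theorem add_I_ne_zero {z : ℂ} (hz : 0 ≤ z.im) : z + Complex.I ≠ 0 := by
  intro h
  have := congrArg Complex.im h
  simp at this
  linarith

theorem decay_inv : Decay fun z : ℂ => (z + Complex.I)⁻¹ := by
  refine ⟨fun z hz => ?_, 2, by norm_num, fun z hz => ?_⟩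
  · exact (differentiableAt_id.add_const _).inv (add_I_ne_zero hz)
  · rw [norm_inv, ← one_div, div_le_div_iff₀ (norm_pos_iff.mpr (add_I_ne_zero hz)) (by positivity)]
    have h1 : 1 ≤ ‖z + Complex.I‖ := by
      refine le_trans ?_ (Complex.abs_im_le_norm _)
      rw [Complex.add_im, Complex.I_im, abs_of_nonneg (by linarith)]
      linarith
    have h2 : ‖z‖ ≤ ‖z + Complex.I‖ := by
      rw [← sq_le_sq₀ (norm_nonneg _) (norm_nonneg _), Complex.sq_norm, Complex.sq_norm,
        Complex.normSq_apply, Complex.normSq_apply]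
      simp
      nlinarith
    linarith

theorem decay_inv_pow (m : ℕ) : Decay fun z : ℂ => ((z + Complex.I)⁻¹) ^ (m + 1) := by
  obtain ⟨C, hC0, hC⟩ := decay_inv.bound
  refine ⟨fun z hz => (decay_inv.diff z hz).pow _, C ^ (m + 1), by positivity, fun z hz => ?_⟩
  rw [norm_pow]
  refine (pow_le_pow_left₀ (norm_nonneg _) (hC z hz) _).trans ?_
  rw [div_pow]
  gcongr
  exact le_self_pow₀ (by linarith [norm_nonneg z]) (by omega)

theorem decaySq_inv_pow (m : ℕ) : DecaySq fun z : ℂ => ((z + Complex.I)⁻¹) ^ (m + 2) := by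
  have := decay_inv.smul (decay_inv_pow m)
  simpa only [smul_eq_mul, ← pow_succ', add_assoc] using this

theorem conj_inv (t : ℝ) : (starRingEnd ℂ) ((t + Complex.I : ℂ)⁻¹) = (t - Complex.I)⁻¹ := by
  simp [sub_eq_add_neg]

theorem integrable_inv_sub_pow (m : ℕ) :
    Integrable fun t : ℝ => ((t - Complex.I : ℂ)⁻¹) ^ (m + 2) := by
  have h := (Complex.conjCLE.toContinuousLinearMap).integrable_comp (decaySq_inv_pow m).integrable
  refine h.congr (.of_forall fun t => ?_)
  simp [sub_eq_add_neg]

/-- The pole `i` lies in the upper half-plane, but conjugation moves it to `-i`, where the vanishing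
theorem applies. -/
theorem integral_inv_sub_pow (m : ℕ) :
    ∫ t : ℝ, ((t - Complex.I : ℂ)⁻¹) ^ (m + 2) = 0 := by
  have h := (decaySq_inv_pow m).integral_eq_zero
  have h2 := integral_conj (μ := (volume : Measure ℝ)) (f := fun t : ℝ => ((t + Complex.I : ℂ)⁻¹) ^ (m + 2))
  rw [h, map_zero] at h2
  rw [← h2]
  congr 1 with t
  simp [sub_eq_add_neg]

theorem sub_I_ne_zero (t : ℝ) : (t : ℂ) - Complex.I ≠ 0 := by
  intro h
  have := congrArg Complex.im h
  simp at this

theorem inv_sub_inv_eq (t : ℝ) : (t - Complex.I : ℂ)⁻¹ - (t + Complex.I)⁻¹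
    = 2 * Complex.I * (((1 + t ^ 2)⁻¹ : ℝ) : ℂ) := by
  have h1 := sub_I_ne_zero t
  have h2 := add_I_ne_zero (z := t) (by simp)
  have h3 : (1 + (t : ℂ) ^ 2) ≠ 0 := by
    have : (1 + (t : ℂ) ^ 2) = ((t : ℂ) - Complex.I) * (t + Complex.I) := by
      ring_nf; simp [add_comm]
    rw [this]; exact mul_ne_zero h1 h2
  push_cast
  field_simp
  ring_nf
  simp

/-- The first power of `(t - i)⁻¹` is not integrable. Subtracting `(t + i)⁻¹`, which has no pole
above the line, repairs this; the resulting integral is the only source of the factor `2πi` in what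
follows. -/
theorem integrable_inv_sub_inv :
    Integrable fun t : ℝ => (t - Complex.I : ℂ)⁻¹ - (t + Complex.I)⁻¹ := by
  simp_rw [inv_sub_inv_eq]
  exact integrable_inv_one_add_sq.ofReal.const_mul _

theorem integral_inv_sub_inv :
    ∫ t : ℝ, ((t - Complex.I : ℂ)⁻¹ - (t + Complex.I)⁻¹) = 2 * Complex.I * Real.pi := by
  simp_rw [inv_sub_inv_eq]
  rw [integral_const_mul, integral_complex_ofReal, integral_univ_inv_one_add_sq]

/-! ### Resolvents without spectrum in the closed upper half-plane -/

variable {𝔸 : Type*} [NormedRing 𝔸] [NormedAlgebra ℂ 𝔸]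

/-- `(B - z)⁻¹` in a Banach algebra. -/
def shiftInv (B : 𝔸) (z : ℂ) : 𝔸 := Ring.inverse (B - algebraMap ℂ 𝔸 z)

/-- `B - z` is invertible for all `z` in the closed upper half-plane. -/
def LowerSpectrum (B : 𝔸) : Prop := ∀ z : ℂ, 0 ≤ z.im → IsUnit (B - algebraMap ℂ 𝔸 z)

variable {B : 𝔸}

theorem LowerSpectrum.mul_shiftInv (hB : LowerSpectrum B) {z : ℂ} (hz : 0 ≤ z.im) :
    (B - algebraMap ℂ 𝔸 z) * shiftInv B z = 1 := Ring.mul_inverse_cancel _ (hB z hz)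

theorem LowerSpectrum.shiftInv_mul (hB : LowerSpectrum B) {z : ℂ} (hz : 0 ≤ z.im) :
    shiftInv B z * (B - algebraMap ℂ 𝔸 z) = 1 := Ring.inverse_mul_cancel _ (hB z hz)

/-- Near the origin the bound comes from compactness of a half-disc, far away from `z (B - z)⁻¹ = B
(B - z)⁻¹ - 1`. -/
theorem LowerSpectrum.decay [CompleteSpace 𝔸] (hB : LowerSpectrum B) : Decay (shiftInv B) := by
  have hd : ∀ z : ℂ, 0 ≤ z.im → DifferentiableAt ℂ (shiftInv B) z := by
    intro z hz
    obtain ⟨x, hx⟩ := hB z hz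
    have h1 : DifferentiableAt ℂ (fun z : ℂ => B - algebraMap ℂ 𝔸 z) z :=
      (differentiableAt_const B).sub (algebraMapCLM ℂ 𝔸).differentiableAt
    have h2 : DifferentiableAt ℂ (Ring.inverse (M₀ := 𝔸)) (B - algebraMap ℂ 𝔸 z) := by
      rw [← hx]; exact differentiableAt_inverse x.isUnit
    exact h2.comp z h1
  refine ⟨hd, ?_⟩
  -- With this radius `2 (‖z‖ - ‖B‖) ≥ 1 + ‖z‖` outside the disc, which gives the constant `2 ‖1‖`
  -- there.
  set ρ := 2 * ‖B‖ + 1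
  have hρ : 0 ≤ ρ := by positivity
  have hK : IsCompact (Metric.closedBall (0 : ℂ) ρ ∩ {z : ℂ | 0 ≤ z.im}) :=
    (isCompact_closedBall _ _).inter_right (isClosed_le continuous_const Complex.continuous_im)
  obtain ⟨C, hC⟩ := hK.exists_bound_of_continuousOn (f := shiftInv B)
    (fun z hz => (hd z hz.2).continuousAt.continuousWithinAt)
  refine ⟨max (2 * ‖(1 : 𝔸)‖) (|C| * (1 + ρ)), by positivity, fun z hz => ?_⟩
  rw [le_div_iff₀ (by positivity)]
  rcases le_total ‖z‖ ρ with h | h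
  · refine le_trans ?_ (le_max_right _ _)
    have := hC z ⟨by simpa using h, hz⟩
    exact mul_le_mul (this.trans (le_abs_self C)) (by linarith) (by positivity) (abs_nonneg _)
  · refine le_trans ?_ (le_max_left _ _)
    have e : z • shiftInv B z = B * shiftInv B z - 1 := by
      rw [← hB.mul_shiftInv hz, sub_mul, ← Algebra.smul_def]
      abel
    have h1 : ‖z‖ * ‖shiftInv B z‖ ≤ ‖B‖ * ‖shiftInv B z‖ + ‖(1 : 𝔸)‖ := by
      rw [← norm_smul, e]
      exact (norm_sub_le _ _).trans (by gcongr; exact norm_mul_le _ _)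
    have := norm_nonneg (shiftInv B z)
    simp only [ρ] at h
    nlinarith

theorem LowerSpectrum.shiftInv_eq (hB : LowerSpectrum B) {z : ℂ} (hz : 0 ≤ z.im) :
    shiftInv B z = shiftInv B Complex.I +
      (z - Complex.I) • (shiftInv B Complex.I * shiftInv B z) := by
  have hI : (0 : ℝ) ≤ Complex.I.im := by simp
  have e : algebraMap ℂ 𝔸 (z - Complex.I)
      = (B - algebraMap ℂ 𝔸 Complex.I) - (B - algebraMap ℂ 𝔸 z) := by
    rw [map_sub]; abel
  have h : (z - Complex.I) • (shiftInv B Complex.I * shiftInv B z)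
      = shiftInv B Complex.I * algebraMap ℂ 𝔸 (z - Complex.I) * shiftInv B z := by
    rw [← Algebra.commutes, mul_assoc, ← Algebra.smul_def]
  rw [h, e, mul_sub, sub_mul, mul_assoc _ (B - algebraMap ℂ 𝔸 z), hB.mul_shiftInv hz,
    hB.shiftInv_mul hI]
  simp

/-- The powers of the resolvent at `i`, times the resolvent at `z`. -/
def powRes (B : 𝔸) (k : ℕ) (z : ℂ) : 𝔸 := shiftInv B Complex.I ^ k * shiftInv B z

theorem LowerSpectrum.decay_powRes [CompleteSpace 𝔸] (hB : LowerSpectrum B) (k : ℕ) : Decay (powRes B k) := by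
  obtain ⟨hd, C, hC0, hC⟩ := hB.decay
  refine ⟨fun z hz => (hd z hz).const_mul _, ‖shiftInv B Complex.I ^ k‖ * C, by positivity,
    fun z hz => (norm_mul_le _ _).trans ?_⟩
  rw [mul_div_assoc]
  gcongr
  exact hC z hz

/-- Partial fractions by the resolvent identity: a factor `(t - i)⁻¹` is traded for one more power
of the resolvent at `i`. This is the induction step of `integral_inv_pow_powRes`. -/
theorem LowerSpectrum.inv_smul_powRes (hB : LowerSpectrum B) (k : ℕ) (t : ℝ) :
    (t - Complex.I : ℂ)⁻¹ • powRes B k t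
      = (t - Complex.I : ℂ)⁻¹ • shiftInv B Complex.I ^ (k + 1) + powRes B (k + 1) t := by
  have h := hB.shiftInv_eq (z := t) (by simp)
  unfold powRes
  conv_lhs => rw [h]
  rw [mul_add, smul_add, ← pow_succ, mul_smul_comm, smul_smul, inv_mul_cancel₀ (sub_I_ne_zero t),
    one_smul, ← mul_assoc, ← pow_succ]

theorem LowerSpectrum.decaySq_inv_pow_smul [CompleteSpace 𝔸] (hB : LowerSpectrum B) (k j : ℕ) :
    DecaySq fun z : ℂ => ((z + Complex.I)⁻¹) ^ (j + 1) • powRes B k z :=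
  (decay_inv_pow j).smul (hB.decay_powRes k)

/-- The leading term of `(B - z)⁻¹` at infinity is `-1/z`; adding `(z + i)⁻¹` cancels it without
creating a pole in the closed upper half-plane. -/
theorem LowerSpectrum.decaySq_powRes_add [CompleteSpace 𝔸] (hB : LowerSpectrum B) (k : ℕ) :
    DecaySq fun z : ℂ => powRes B k z + (z + Complex.I)⁻¹ • shiftInv B Complex.I ^ k := by
  have e : ∀ z : ℂ, 0 ≤ z.im → powRes B k z + (z + Complex.I)⁻¹ • shiftInv B Complex.I ^ k
      = ((z + Complex.I)⁻¹ • powRes B k z) * (B + algebraMap ℂ 𝔸 Complex.I) := by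
    intro z hz
    have h1 : B + algebraMap ℂ 𝔸 Complex.I
        = (B - algebraMap ℂ 𝔸 z) + algebraMap ℂ 𝔸 (z + Complex.I) := by
      rw [map_add]; abel
    rw [h1, smul_mul_assoc, mul_add]
    unfold powRes
    rw [mul_assoc, hB.shiftInv_mul hz, mul_one, smul_add, ← Algebra.commutes, ← Algebra.smul_def,
      smul_smul, inv_mul_cancel₀ (add_I_ne_zero hz), one_smul, add_comm]
  obtain ⟨C, hC⟩ := (decay_inv.smul (hB.decay_powRes k)).bound
  refine ⟨fun z hz => ((hB.decay_powRes k).diff z hz).add ((decay_inv.diff z hz).smul_const _),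
    C * ‖B + algebraMap ℂ 𝔸 Complex.I‖, fun z hz => ?_⟩
  rw [e z hz]
  refine (norm_mul_le _ _).trans ?_
  rw [mul_div_right_comm]
  gcongr
  exact hC z hz

/-- The value is the residue at `z = i`, obtained without residue calculus: each partial fraction
step splits off a scalar integral, and only that of the base case is nonzero. -/
theorem LowerSpectrum.integral_inv_pow_powRes [CompleteSpace 𝔸] (hB : LowerSpectrum B) (j k : ℕ) :
    Integrable (fun t : ℝ => ((t - Complex.I : ℂ)⁻¹) ^ (j + 1) • powRes B k t) ∧
    ∫ t : ℝ, ((t - Complex.I : ℂ)⁻¹) ^ (j + 1) • powRes B k t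
      = (2 * Complex.I * Real.pi) • shiftInv B Complex.I ^ (k + j + 1) := by
  induction j generalizing k with
  | zero =>
    have e : (fun t : ℝ => ((t - Complex.I : ℂ)⁻¹) ^ (0 + 1) • powRes B k t) = fun t : ℝ =>
        ((t - Complex.I : ℂ)⁻¹ - (t + Complex.I)⁻¹) • shiftInv B Complex.I ^ (k + 1)
        + (powRes B (k + 1) t + ((t : ℂ) + Complex.I)⁻¹ • shiftInv B Complex.I ^ (k + 1)) := by
      funext t
      rw [zero_add, pow_one, hB.inv_smul_powRes, sub_smul]
      abel
    have i1 := integrable_inv_sub_inv.smul_const (shiftInv B Complex.I ^ (k + 1))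
    have i2 := (hB.decaySq_powRes_add (k + 1)).integrable
    rw [e]
    refine ⟨i1.add i2, ?_⟩
    rw [integral_add i1 i2, (hB.decaySq_powRes_add (k + 1)).integral_eq_zero, add_zero,
      integral_smul_const, integral_inv_sub_inv]
  | succ j ih =>
    have e : (fun t : ℝ => ((t - Complex.I : ℂ)⁻¹) ^ (j + 1 + 1) • powRes B k t) = fun t : ℝ =>
        ((t - Complex.I : ℂ)⁻¹) ^ (j + 2) • shiftInv B Complex.I ^ (k + 1)
        + ((t - Complex.I : ℂ)⁻¹) ^ (j + 1) • powRes B (k + 1) t := by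
      funext t
      rw [pow_succ _ (j + 1), mul_smul, hB.inv_smul_powRes, smul_add, smul_smul, ← pow_succ]
    have i1 := (integrable_inv_sub_pow j).smul_const (shiftInv B Complex.I ^ (k + 1))
    obtain ⟨i2, h2⟩ := ih (k + 1)
    rw [e]
    refine ⟨i1.add i2, ?_⟩
    rw [integral_add i1 i2, integral_smul_const, integral_inv_sub_pow, zero_smul, zero_add, h2]
    congr 2
    ring

theorem powRes_zero : powRes B 0 = shiftInv B := by
  funext z; simp [powRes]

end HalfPlane

namespace HalfPlane

/-! ### The spectral density of a dissipative operator in finite dimension -/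

set_option linter.unusedSectionVars false

variable {E : Type*} [NormedAddCommGroup E] [InnerProductSpace ℂ E] [CompleteSpace E]

/-- The functional `X ↦ ⟨u, X u⟩`. -/
def vecFunctional (u : E) : (E →L[ℂ] E) →L[ℂ] ℂ :=
  (innerSL ℂ u).comp (ContinuousLinearMap.apply ℂ E u)

theorem vecFunctional_apply (u : E) (X : E →L[ℂ] E) : vecFunctional u X = inner ℂ u (X u) := rfl

/-- The conjugated term contributes nothing: it is the conjugate of `(t + i)⁻ʲ ⟨u, (B - t)⁻¹ u⟩`,
which is holomorphic above the line. Thus the imaginary part on the line has the same moments as the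
full boundary value. For `j = 0` neither term is integrable alone, and both are regularised by `(t +
i)⁻¹`. -/
theorem LowerSpectrum.moment {B : E →L[ℂ] E} (hB : LowerSpectrum B) (u : E) (j : ℕ) :
    Integrable (fun t : ℝ => ((t - Complex.I : ℂ)⁻¹) ^ j * (inner ℂ u (shiftInv B t u)
      - (starRingEnd ℂ) (inner ℂ u (shiftInv B t u)))) ∧
    ∫ t : ℝ, ((t - Complex.I : ℂ)⁻¹) ^ j * (inner ℂ u (shiftInv B t u)
      - (starRingEnd ℂ) (inner ℂ u (shiftInv B t u)))
      = 2 * Complex.I * Real.pi * inner ℂ u ((shiftInv B Complex.I ^ j) u) := by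
  simp_rw [← vecFunctional_apply]
  set ℓ := vecFunctional u
  cases j with
  | zero =>
    have hd := hB.decaySq_powRes_add 0
    simp only [powRes_zero, pow_zero] at hd
    have i1 := ℓ.integrable_comp hd.integrable
    have z1 := ℓ.integral_comp_comm hd.integrable
    rw [hd.integral_eq_zero, map_zero] at z1
    have i2 := Complex.conjCLE.toContinuousLinearMap.integrable_comp i1
    have z2 := integral_conj (μ := (volume : Measure ℝ)) (f := fun t : ℝ =>
      ℓ (shiftInv B t + ((t : ℂ) + Complex.I)⁻¹ • 1))
    rw [z1, map_zero] at z2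
    have hone : (starRingEnd ℂ) (ℓ 1) = ℓ 1 := by
      simp [ℓ, vecFunctional_apply]
    have e : (fun t : ℝ => ((t - Complex.I : ℂ)⁻¹) ^ 0 * (ℓ (shiftInv B t)
        - (starRingEnd ℂ) (ℓ (shiftInv B t)))) = fun t : ℝ =>
        ℓ (shiftInv B t + ((t : ℂ) + Complex.I)⁻¹ • 1)
        - (starRingEnd ℂ) (ℓ (shiftInv B t + ((t : ℂ) + Complex.I)⁻¹ • 1))
        + ((t - Complex.I : ℂ)⁻¹ - (t + Complex.I)⁻¹) * ℓ 1 := by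
      funext t
      rw [map_add, map_smul, map_add, smul_eq_mul, map_mul, conj_inv, hone]
      ring
    have i3 := integrable_inv_sub_inv.mul_const (ℓ 1)
    have i4 : Integrable fun t : ℝ =>
      (starRingEnd ℂ) (ℓ (shiftInv B t + ((t : ℂ) + Complex.I)⁻¹ • 1)) := i2
    rw [e]
    refine ⟨(i1.sub i4).add i3, ?_⟩
    have i5 : Integrable fun t : ℝ => ℓ (shiftInv B t + ((t : ℂ) + Complex.I)⁻¹ • 1)
        - (starRingEnd ℂ) (ℓ (shiftInv B t + ((t : ℂ) + Complex.I)⁻¹ • 1)) := i1.sub i4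
    rw [integral_add i5 i3, integral_sub i1 i4, z1, z2, integral_mul_const,
      integral_inv_sub_inv, pow_zero]
    ring
  | succ j =>
    have hd := hB.decaySq_inv_pow_smul 0 j
    have hm := hB.integral_inv_pow_powRes j 0
    simp only [powRes_zero] at hd hm
    have i1 := ℓ.integrable_comp hd.integrable
    have z1 := ℓ.integral_comp_comm hd.integrable
    rw [hd.integral_eq_zero, map_zero] at z1
    have i2 := Complex.conjCLE.toContinuousLinearMap.integrable_comp i1
    have z2 := integral_conj (μ := (volume : Measure ℝ)) (f := fun t : ℝ =>
      ℓ (((t + Complex.I : ℂ)⁻¹) ^ (j + 1) • shiftInv B t))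
    rw [z1, map_zero] at z2
    have i3 := ℓ.integrable_comp hm.1
    have z3 := ℓ.integral_comp_comm hm.1
    have i4 : Integrable fun t : ℝ =>
      (starRingEnd ℂ) (ℓ (((t + Complex.I : ℂ)⁻¹) ^ (j + 1) • shiftInv B t)) := i2
    have e : (fun t : ℝ => ((t - Complex.I : ℂ)⁻¹) ^ (j + 1) * (ℓ (shiftInv B t)
        - (starRingEnd ℂ) (ℓ (shiftInv B t)))) = fun t : ℝ =>
        ℓ (((t - Complex.I : ℂ)⁻¹) ^ (j + 1) • shiftInv B t)
        - (starRingEnd ℂ) (ℓ (((t + Complex.I : ℂ)⁻¹) ^ (j + 1) • shiftInv B t)) := by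
      funext t
      rw [map_smul, map_smul, smul_eq_mul, smul_eq_mul, map_mul, map_pow, conj_inv]
      ring
    rw [e]
    refine ⟨i3.sub i4, ?_⟩
    rw [integral_sub i3 i4, z2, z3, hm.2, map_smul, smul_eq_mul]
    simp

/-! ### Dissipative operators `S - i F* F` -/

variable {E' : Type*} [NormedAddCommGroup E'] [InnerProductSpace ℂ E'] [CompleteSpace E']

/-- The dissipative operator `S - i F* F`. -/
def diss (S : E →L[ℂ] E) (F : E →L[ℂ] E') : E →L[ℂ] E :=
  S - Complex.I • (F.adjoint.comp F)

/-- The eigenvectors of `S` for the eigenvalue `s` that `F` annihilates. -/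
def hidden (S : E →L[ℂ] E) (F : E →L[ℂ] E') (s : ℝ) : Submodule ℂ E where
  carrier := {x | S x = (s : ℂ) • x ∧ F x = 0}
  add_mem' := by
    rintro x y ⟨h1, h2⟩ ⟨h3, h4⟩
    simp [h1, h2, h3, h4]
  zero_mem' := by simp
  smul_mem' := by
    rintro c x ⟨h1, h2⟩
    exact ⟨by rw [map_smul, h1, smul_comm], by rw [map_smul, h2, smul_zero]⟩

theorem mem_hidden {S : E →L[ℂ] E} {F : E →L[ℂ] E'} {s : ℝ} {x : E} :
    x ∈ hidden S F s ↔ S x = (s : ℂ) • x ∧ F x = 0 := Iff.rfl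

theorem diss_apply (S : E →L[ℂ] E) (F : E →L[ℂ] E') (x : E) :
    diss S F x = S x - Complex.I • F.adjoint (F x) := rfl

theorem diss_apply_hidden {S : E →L[ℂ] E} {F : E →L[ℂ] E'} {s : ℝ} {x : E}
    (hx : x ∈ hidden S F s) : diss S F x = (s : ℂ) • x := by
  rw [diss_apply, hx.1, hx.2]
  simp

/-- Hidden eigenvectors are also left eigenvectors, since `F e = 0` removes the dissipative term;
hence the orthogonal complement of the hidden spaces is invariant. -/
theorem inner_hidden_diss {S : E →L[ℂ] E} {F : E →L[ℂ] E'}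
    (hS : (S : E →ₗ[ℂ] E).IsSymmetric) {s : ℝ} {e : E} (he : e ∈ hidden S F s) (x : E) :
    inner ℂ e (diss S F x) = s * inner ℂ e x := by
  rw [diss_apply, inner_sub_right, inner_smul_right, ContinuousLinearMap.adjoint_inner_right, he.2,
    inner_zero_left, mul_zero, sub_zero]
  have := hS e x
  simp only [ContinuousLinearMap.coe_coe] at this
  rw [← this, he.1, inner_smul_left]
  simp

theorem inner_hidden_eq_zero {S : E →L[ℂ] E} {F : E →L[ℂ] E'}
    (hS : (S : E →ₗ[ℂ] E).IsSymmetric) {s t : ℝ} (hst : s ≠ t) {e f : E}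
    (he : e ∈ hidden S F s) (hf : f ∈ hidden S F t) : inner ℂ e f = 0 := by
  have h := inner_hidden_diss hS he f
  rw [diss_apply_hidden hf, inner_smul_right] at h
  have h3 : ((t : ℂ) - s) * inner ℂ e f = 0 := by rw [sub_mul, h, sub_self]
  rcases mul_eq_zero.mp h3 with h4 | h4
  · exact absurd (by exact_mod_cast (sub_eq_zero.mp h4).symm) hst
  · exact h4

/-- The energy balance: the symmetric part cancels and the loss is what `F` carries away. It forces
`F x = 0` for real eigenvalues, and it later produces the density. -/
theorem inner_diss_sub {S : E →L[ℂ] E} {F : E →L[ℂ] E'}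
    (hS : (S : E →ₗ[ℂ] E).IsSymmetric) (x : E) :
    inner ℂ (diss S F x) x - inner ℂ x (diss S F x) = 2 * Complex.I * ‖F x‖ ^ 2 := by
  have := hS x x
  simp only [ContinuousLinearMap.coe_coe] at this
  rw [diss_apply, inner_sub_right, inner_sub_left, inner_smul_right, inner_smul_left,
    ContinuousLinearMap.adjoint_inner_right, ContinuousLinearMap.adjoint_inner_left, this,
    inner_self_eq_norm_sq_to_K]
  simp
  ring

variable [FiniteDimensional ℂ E]

theorem isUnit_of_injective {B : E →L[ℂ] E} (h : ∀ x, B x = 0 → x = 0) : IsUnit B := by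
  have hinj : Function.Injective (B : E →ₗ[ℂ] E) := by
    rw [← LinearMap.ker_eq_bot, LinearMap.ker_eq_bot']
    exact h
  rw [ContinuousLinearMap.isUnit_iff_bijective]
  exact ⟨hinj, LinearMap.injective_iff_surjective.mp hinj⟩

variable (S : E →L[ℂ] E) (F : E →L[ℂ] E') (Z : Finset ℝ)

/-- The sum of the projections onto the hidden eigenspaces. -/
def hiddenProj : E →L[ℂ] E := ∑ s ∈ Z, (hidden S F s).starProjection

/-- The part of `v` orthogonal to the hidden eigenspaces. -/
def visible (v : E) : E := v - hiddenProj S F Z v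

/-- The dissipative operator moved down on the hidden eigenspaces. -/
def reg : E →L[ℂ] E := diss S F - Complex.I • hiddenProj S F Z

/-- The absolutely continuous density of the dissipative operator at `v`. -/
def acDensity (v : E) (t : ℝ) : ℝ :=
  1 / Real.pi * ‖F (shiftInv (reg S F Z) t (visible S F Z v))‖ ^ 2

variable {S F Z}

theorem inner_starProjection_self (U : Submodule ℂ E) (x : E) :
    inner ℂ x (U.starProjection x) = ((‖U.starProjection x‖ ^ 2 : ℝ) : ℂ) := by
  have h : inner ℂ x (U.starProjection x) = inner ℂ (U.starProjection x) (U.starProjection x) := by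
    have := Submodule.starProjection_inner_eq_zero (K := U) x (U.starProjection x)
      (Submodule.starProjection_apply_mem _ _)
    rw [inner_sub_left, sub_eq_zero] at this
    exact this
  rw [h, inner_self_eq_norm_sq_to_K]
  simp

theorem inner_hiddenProj (x : E) :
    inner ℂ x (hiddenProj S F Z x)
      = ((∑ s ∈ Z, ‖(hidden S F s).starProjection x‖ ^ 2 : ℝ) : ℂ) := by
  simp only [hiddenProj, _root_.sum_apply, inner_sum, Complex.ofReal_sum]
  exact Finset.sum_congr rfl fun s _ => inner_starProjection_self _ _

theorem starProjection_hidden (hS : (S : E →ₗ[ℂ] E).IsSymmetric) {s t : ℝ} (hst : s ≠ t) (x : E) :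
    (hidden S F s).starProjection ((hidden S F t).starProjection x) = 0 := by
  rw [Submodule.starProjection_apply_eq_zero_iff, Submodule.mem_orthogonal]
  intro e he
  exact inner_hidden_eq_zero hS hst he (Submodule.starProjection_apply_mem _ _)

theorem starProjection_visible (hS : (S : E →ₗ[ℂ] E).IsSymmetric) {s : ℝ} (hs : s ∈ Z) (v : E) :
    (hidden S F s).starProjection (visible S F Z v) = 0 := by
  simp only [visible, hiddenProj, _root_.sum_apply, map_sub, map_sum]
  rw [Finset.sum_eq_single s (fun t _ ht => starProjection_hidden hS ht.symm v)
    (fun h => absurd hs h), sub_eq_zero]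
  exact (Submodule.starProjection_eq_self_iff.mpr (Submodule.starProjection_apply_mem _ _)).symm

theorem inner_hidden_visible (hS : (S : E →ₗ[ℂ] E).IsSymmetric)
    (hZ : ∀ s : ℝ, hidden S F s ≠ ⊥ → s ∈ Z) {s : ℝ} {e : E} (he : e ∈ hidden S F s) (v : E) :
    inner ℂ e (visible S F Z v) = 0 := by
  by_cases h : hidden S F s = ⊥
  · rw [h, Submodule.mem_bot] at he
    simp [he]
  · have := starProjection_visible (F := F) hS (hZ s h) v
    rw [Submodule.starProjection_apply_eq_zero_iff, Submodule.mem_orthogonal] at this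
    exact this e he

/-- In the imaginary part of the energy balance for a null vector `x`, the terms `∑ ‖P_s x‖²`, `Im z
‖x‖²` and `‖F x‖²` are nonnegative with sum zero. If `z` is real this makes `x` hidden with zero
hidden projection. -/
theorem lowerSpectrum_reg (hS : (S : E →ₗ[ℂ] E).IsSymmetric)
    (hZ : ∀ s : ℝ, hidden S F s ≠ ⊥ → s ∈ Z) : LowerSpectrum (reg S F Z) := by
  intro z hz
  refine isUnit_of_injective fun x hx => ?_
  have hx' : diss S F x = Complex.I • hiddenProj S F Z x + z • x := by
    rw [← sub_eq_zero, ← hx]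
    simp only [reg, _root_.sub_apply, _root_.smul_apply,
      Algebra.algebraMap_eq_smul_one, one_apply_eq_self]
    abel
  have h := inner_diss_sub (F := F) hS x
  rw [hx', inner_add_left, inner_add_right, inner_smul_left, inner_smul_right, inner_smul_left,
    inner_smul_right, ← inner_conj_symm (hiddenProj S F Z x), inner_hiddenProj,
    inner_self_eq_norm_sq_to_K, Complex.conj_ofReal] at h
  have h2 := congrArg Complex.im h
  simp [← Complex.ofReal_pow] at h2
  have hsum : 0 ≤ ∑ s ∈ Z, ‖(hidden S F s).starProjection x‖ ^ 2 :=
    Finset.sum_nonneg fun s _ => by positivity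
  have h3 : ∑ s ∈ Z, ‖(hidden S F s).starProjection x‖ ^ 2 + z.im * ‖x‖ ^ 2 + ‖F x‖ ^ 2 = 0 := by
    linarith
  have hz2 : 0 ≤ z.im * ‖x‖ ^ 2 := by positivity
  have hF : F x = 0 := by
    have : ‖F x‖ ^ 2 = 0 := by nlinarith [sq_nonneg ‖F x‖]
    simpa using this
  have hs0 : ∑ s ∈ Z, ‖(hidden S F s).starProjection x‖ ^ 2 = 0 := by
    nlinarith [sq_nonneg ‖F x‖]
  rcases hz.lt_or_eq with hpos | h0
  · have : z.im * ‖x‖ ^ 2 = 0 := by nlinarith [sq_nonneg ‖F x‖]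
    rcases mul_eq_zero.mp this with h4 | h4
    · exact absurd h4 hpos.ne'
    · simpa using h4
  · have hP : ∀ s ∈ Z, (hidden S F s).starProjection x = 0 := by
      intro s hs
      have := (Finset.sum_eq_zero_iff_of_nonneg (fun s _ => by positivity)).mp hs0 s hs
      simpa using this
    have hP0 : hiddenProj S F Z x = 0 := by
      simp only [hiddenProj, _root_.sum_apply]
      exact Finset.sum_eq_zero hP
    have hmem : x ∈ hidden S F z.re := by
      refine ⟨?_, hF⟩
      rw [diss_apply, hF, hP0] at hx'
      have hzr : ((z.re : ℝ) : ℂ) = z := Complex.ext rfl (by simpa using h0)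
      rw [hzr]
      simpa using hx'
    by_contra hne
    have hb : hidden S F z.re ≠ ⊥ := fun hb => hne (by
      rw [hb] at hmem; exact hmem)
    have := hP _ (hZ _ hb)
    rw [Submodule.starProjection_eq_self_iff.mpr hmem] at this
    exact hne this

/-- The complement of the hidden spaces is invariant, and there the downward shift by `hiddenProj`
is invisible. -/
theorem orth_of_reg (hS : (S : E →ₗ[ℂ] E).IsSymmetric)
    (hZ : ∀ s : ℝ, hidden S F s ≠ ⊥ → s ∈ Z) {z : ℂ} (hz : 0 ≤ z.im) {x y : E} 
    (hx : ∀ s, ∀ e ∈ hidden S F s, inner ℂ e x = 0) (hy : reg S F Z y - z • y = x) :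
    (∀ s, ∀ e ∈ hidden S F s, inner ℂ e y = 0) ∧ diss S F y - z • y = x := by
  have hP : ∀ s, ∀ e ∈ hidden S F s, inner ℂ e y = 0 := by
    intro s e he
    by_cases hb : hidden S F s = ⊥
    · rw [hb, Submodule.mem_bot] at he
      simp [he]
    have h1 := hx s e he
    have hPe : inner ℂ e (hiddenProj S F Z y) = inner ℂ e y := by
      simp only [hiddenProj, _root_.sum_apply, inner_sum]
      rw [Finset.sum_eq_single s]
      · have := Submodule.starProjection_inner_eq_zero (K := hidden S F s) y e he
        rw [inner_sub_left, sub_eq_zero] at this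
        rw [← inner_conj_symm, ← this, inner_conj_symm]
      · intro t _ ht
        exact inner_hidden_eq_zero hS ht.symm he (Submodule.starProjection_apply_mem _ _)
      · exact fun h => absurd (hZ s hb) h
    rw [← hy, reg, _root_.sub_apply, _root_.smul_apply, inner_sub_right,
      inner_sub_right, inner_hidden_diss hS he, inner_smul_right, inner_smul_right, hPe] at h1
    -- The first factor has imaginary part `-1 - Im z < 0`.
    have h2 : ((s : ℂ) - Complex.I - z) * inner ℂ e y = 0 := by rw [← h1]; ring
    rcases mul_eq_zero.mp h2 with h3 | h3
    · have := congrArg Complex.im h3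
      simp at this
      linarith
    · exact h3
  refine ⟨hP, ?_⟩
  have h0 : hiddenProj S F Z y = 0 := by
    simp only [hiddenProj, _root_.sum_apply]
    refine Finset.sum_eq_zero fun s _ => ?_
    rw [Submodule.starProjection_apply_eq_zero_iff, Submodule.mem_orthogonal]
    exact fun e he => hP s e he
  rw [← hy, reg, _root_.sub_apply, _root_.smul_apply, h0, smul_zero,
    sub_zero]

theorem reg_shiftInv (hS : (S : E →ₗ[ℂ] E).IsSymmetric)
    (hZ : ∀ s : ℝ, hidden S F s ≠ ⊥ → s ∈ Z) {z : ℂ} (hz : 0 ≤ z.im) (x : E) :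
    reg S F Z (shiftInv (reg S F Z) z x) - z • shiftInv (reg S F Z) z x = x := by
  have := congrArg (fun X : E →L[ℂ] E => X x) ((lowerSpectrum_reg hS hZ).mul_shiftInv hz)
  simpa [Algebra.algebraMap_eq_smul_one] using this

/-- The given solution `x` differs from the regularised one `y` by an explicit hidden combination
`w` and an eigenvector for the real value `t`. `F` annihilates both, so no uniqueness of `x` is
needed. -/
theorem acDensity_eq (hS : (S : E →ₗ[ℂ] E).IsSymmetric)
    (hZ : ∀ s : ℝ, hidden S F s ≠ ⊥ → s ∈ Z) {t : ℝ} (ht : t ∉ Z) {v x : E} (hx : diss S F x - (t : ℂ) • x = v) :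
    acDensity S F Z v t = 1 / Real.pi * ‖F x‖ ^ 2 := by
  set y := shiftInv (reg S F Z) t (visible S F Z v) with hy
  obtain ⟨-, h2⟩ := orth_of_reg hS hZ (z := t) (by simp)
    (fun s e he => inner_hidden_visible hS hZ he v) (reg_shiftInv hS hZ (by simp) (visible S F Z v))
  rw [← hy] at h2
  have hne : ∀ s ∈ Z, (s : ℂ) - t ≠ 0 := by
    intro s hs h
    rw [sub_eq_zero, Complex.ofReal_inj] at h
    exact ht (h ▸ hs)
  set w := ∑ s ∈ Z, ((s : ℂ) - t)⁻¹ • (hidden S F s).starProjection v with hw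
  have hw1 : diss S F w - (t : ℂ) • w = hiddenProj S F Z v := by
    simp only [hw, map_sum, map_smul, Finset.smul_sum, hiddenProj, _root_.sum_apply]
    rw [← Finset.sum_sub_distrib]
    refine Finset.sum_congr rfl fun s hs => ?_
    rw [diss_apply_hidden (Submodule.starProjection_apply_mem _ _), smul_smul, smul_smul,
      ← sub_smul, mul_comm, ← sub_mul, mul_inv_cancel₀ (hne s hs), one_smul]
  have hFw : F w = 0 := by
    simp only [hw, map_sum, map_smul]
    refine Finset.sum_eq_zero fun s _ => ?_
    rw [(mem_hidden.mp (Submodule.starProjection_apply_mem (hidden S F s) v)).2, smul_zero]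
  have hd : diss S F (x - y - w) = (t : ℂ) • (x - y - w) := by
    rw [← sub_eq_zero]
    have : diss S F x - (t : ℂ) • x - (diss S F y - (t : ℂ) • y) - (diss S F w - (t : ℂ) • w) = 0 := by
      rw [hx, h2, hw1, visible]
      abel
    rw [← this]
    simp only [map_sub, smul_sub]
    abel
  have hF : F (x - y - w) = 0 := by
    have h := inner_diss_sub (F := F) hS (x - y - w)
    rw [hd, inner_smul_left, inner_smul_right] at h
    simp only [Complex.conj_ofReal, sub_self, zero_eq_mul, mul_eq_zero, OfNat.ofNat_ne_zero,
      Complex.I_ne_zero, or_self, false_or, ne_eq, not_false_eq_true, pow_eq_zero_iff,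
      Complex.ofReal_eq_zero, norm_eq_zero] at h
    exact h
  have : F x = F y := by
    rw [map_sub, map_sub, hFw, sub_zero, sub_eq_zero] at hF
    exact hF
  rw [acDensity, this]

/-- Writing the visible vector as `(B - t) y`, the real number `t` drops out and the energy balance
gives `2i ‖F y‖²`: Stieltjes inversion for a dissipative operator. -/
theorem inner_visible_sub (hS : (S : E →ₗ[ℂ] E).IsSymmetric)
    (hZ : ∀ s : ℝ, hidden S F s ≠ ⊥ → s ∈ Z) (v : E) (t : ℝ) :
    inner ℂ (visible S F Z v) (shiftInv (reg S F Z) t (visible S F Z v))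
      - (starRingEnd ℂ) (inner ℂ (visible S F Z v) (shiftInv (reg S F Z) t (visible S F Z v)))
      = 2 * Complex.I * Real.pi * acDensity S F Z v t := by
  set y := shiftInv (reg S F Z) t (visible S F Z v) with hy
  obtain ⟨-, h2⟩ := orth_of_reg hS hZ (z := t) (by simp)
    (fun s e he => inner_hidden_visible hS hZ he v) (reg_shiftInv hS hZ (by simp) (visible S F Z v))
  rw [← hy] at h2
  rw [inner_conj_symm, ← h2, inner_sub_left, inner_sub_right, inner_smul_left, inner_smul_right,
    Complex.conj_ofReal, sub_sub_sub_cancel_right, inner_diss_sub hS, acDensity, ← hy]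
  have : (Real.pi : ℂ) ≠ 0 := by exact_mod_cast Real.pi_ne_zero
  push_cast
  field_simp

theorem acDensity_moment (hS : (S : E →ₗ[ℂ] E).IsSymmetric)
    (hZ : ∀ s : ℝ, hidden S F s ≠ ⊥ → s ∈ Z) (v : E) (j : ℕ) :
    Integrable (fun t : ℝ => ((t - Complex.I : ℂ)⁻¹) ^ j * acDensity S F Z v t) ∧
    ∫ t : ℝ, ((t - Complex.I : ℂ)⁻¹) ^ j * acDensity S F Z v t
      = inner ℂ (visible S F Z v) ((shiftInv (reg S F Z) Complex.I ^ j) (visible S F Z v)) := by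
  obtain ⟨h1, h2⟩ := (lowerSpectrum_reg hS hZ).moment (visible S F Z v) j
  have hc : 2 * Complex.I * (Real.pi : ℂ) ≠ 0 := by
    simp [Real.pi_ne_zero]
  have e : ∀ t : ℝ, ((t - Complex.I : ℂ)⁻¹) ^ j * (inner ℂ (visible S F Z v)
      (shiftInv (reg S F Z) t (visible S F Z v)) - (starRingEnd ℂ)
      (inner ℂ (visible S F Z v) (shiftInv (reg S F Z) t (visible S F Z v))))
      = (2 * Complex.I * Real.pi) * (((t - Complex.I : ℂ)⁻¹) ^ j * acDensity S F Z v t) := by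
    intro t
    rw [inner_visible_sub hS hZ]
    ring
  simp_rw [e] at h1 h2
  rw [integral_const_mul] at h2
  refine ⟨?_, mul_left_cancel₀ hc h2⟩
  have := h1.const_mul (2 * Complex.I * (Real.pi : ℂ))⁻¹
  refine this.congr (.of_forall fun t => ?_)
  simp only
  rw [← mul_assoc, inv_mul_cancel₀ hc, one_mul]

theorem continuous_acDensity (hS : (S : E →ₗ[ℂ] E).IsSymmetric)
    (hZ : ∀ s : ℝ, hidden S F s ≠ ⊥ → s ∈ Z) (v : E) : Continuous (acDensity S F Z v) := by
  have h : Continuous fun t : ℝ => shiftInv (reg S F Z) t := by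
    rw [continuous_iff_continuousAt]
    intro t
    exact ((lowerSpectrum_reg hS hZ).decay.diff t (by simp)).continuousAt.comp
      Complex.continuous_ofReal.continuousAt
  unfold acDensity
  fun_prop

theorem acDensity_nonneg (v : E) (t : ℝ) : 0 ≤ acDensity S F Z v t := by
  unfold acDensity
  positivity

/-- Moments of the spectral measure of a dissipative operator: an absolutely continuous part and
point masses at the hidden eigenvalues. -/
theorem moment_diss (hS : (S : E →ₗ[ℂ] E).IsSymmetric) (hZ : ∀ s : ℝ, hidden S F s ≠ ⊥ → s ∈ Z)
    {A : E →L[ℂ] E} (hA : ∀ x, A (diss S F x - Complex.I • x) = x) (v : E) (j : ℕ) :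
    (∫ t : ℝ, ((t - Complex.I : ℂ)⁻¹) ^ j * acDensity S F Z v t)
      + ∑ s ∈ Z, ((s - Complex.I : ℂ)⁻¹) ^ j * ‖(hidden S F s).starProjection v‖ ^ 2
      = inner ℂ v ((A ^ j) v) := by
  rw [(acDensity_moment hS hZ v j).2]
  -- On the visible complement `A` acts as the resolvent of `reg` at `i` and preserves the
  -- complement.
  have hA2 : ∀ x, (∀ s, ∀ e ∈ hidden S F s, inner ℂ e x = 0) →
      ((∀ s, ∀ e ∈ hidden S F s, inner ℂ e ((A ^ j) x) = 0) ∧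
      (A ^ j) x = (shiftInv (reg S F Z) Complex.I ^ j) x) := by
    intro x hx
    induction j with
    | zero => simpa using hx
    | succ j ih =>
      obtain ⟨h1, h2⟩ := ih
      rw [pow_succ', pow_succ', mul_apply_eq_comp, mul_apply_eq_comp, ← h2]
      obtain ⟨h3, h4⟩ := orth_of_reg hS hZ (z := Complex.I) (by simp) h1
        (reg_shiftInv hS hZ (by simp) _)
      have h5 : A ((A ^ j) x) = shiftInv (reg S F Z) Complex.I ((A ^ j) x) := by
        conv_lhs => rw [← h4]
        exact hA _
      rw [h5]
      exact ⟨h3, rfl⟩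
  -- On a hidden eigenspace `A` is the scalar `(s - i)⁻¹`, so the cross terms between both parts
  -- vanish.
  have hA1 : ∀ s, ∀ e ∈ hidden S F s, (A ^ j) e = ((s - Complex.I : ℂ)⁻¹) ^ j • e := by
    intro s e he
    have h1 : A e = (s - Complex.I : ℂ)⁻¹ • e := by
      have := hA ((s - Complex.I : ℂ)⁻¹ • e)
      rw [map_smul, diss_apply_hidden he, smul_comm Complex.I, ← smul_sub, ← sub_smul, smul_smul,
        inv_mul_cancel₀ (sub_I_ne_zero s), one_smul] at this
      exact this
    clear hA2
    induction j with
    | zero => simp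
    | succ j ih => rw [pow_succ', mul_apply_eq_comp, ih, map_smul, h1, smul_smul, pow_succ]
  obtain ⟨h1, h2⟩ := hA2 (visible S F Z v) fun s e he => inner_hidden_visible hS hZ he v
  have hv : v = visible S F Z v + hiddenProj S F Z v := by simp [visible]
  have e1 : inner ℂ v ((A ^ j) (visible S F Z v))
      = inner ℂ (visible S F Z v) ((A ^ j) (visible S F Z v)) := by
    conv_lhs => rw [hv]
    have : visible S F Z (visible S F Z v + hiddenProj S F Z v) = visible S F Z v := by rw [← hv]
    rw [this, inner_add_left]
    simp only [hiddenProj, _root_.sum_apply, sum_inner]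
    rw [Finset.sum_eq_zero, add_zero]
    exact fun s _ => h1 s _ (Submodule.starProjection_apply_mem _ _)
  have e2 : inner ℂ v ((A ^ j) (hiddenProj S F Z v))
      = ∑ s ∈ Z, ((s - Complex.I : ℂ)⁻¹) ^ j * ‖(hidden S F s).starProjection v‖ ^ 2 := by
    simp only [hiddenProj, _root_.sum_apply, map_sum, inner_sum]
    refine Finset.sum_congr rfl fun s _ => ?_
    rw [hA1 s _ (Submodule.starProjection_apply_mem _ _), inner_smul_right,
      inner_starProjection_self]
    push_cast
    rfl
  rw [← h2, ← e1, ← e2, ← inner_add_right, ← map_add, ← hv]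

end HalfPlane

/-! ### Weak convergence from the moments of `(t - i)⁻¹` -/

namespace ResolventMoments

/-- The circle `{(t - i)⁻¹ : t ∈ ℝ} ∪ {0}`. -/
def circ : Set ℂ := {w | w - (starRingEnd ℂ) w = 2 * Complex.I * (w * (starRingEnd ℂ) w)}

theorem isClosed_circ : IsClosed circ :=
  isClosed_eq (by fun_prop) (by fun_prop)

theorem circ_im {w : ℂ} (hw : w ∈ circ) : w.im = ‖w‖ ^ 2 := by
  have := congrArg Complex.im (show w - (starRingEnd ℂ) w = 2 * Complex.I * (w * (starRingEnd ℂ) w) from hw)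
  rw [Complex.mul_conj, Complex.normSq_eq_norm_sq] at this
  simp [-Complex.ofReal_pow] at this
  linarith

theorem circ_norm_le {w : ℂ} (hw : w ∈ circ) : ‖w‖ ≤ 1 := by
  have h1 := circ_im hw
  have h2 := Complex.abs_im_le_norm w
  have h3 := le_abs_self w.im
  by_contra h
  push Not at h
  nlinarith [norm_nonneg w]

theorem isCompact_circ : IsCompact circ := by
  refine (isCompact_closedBall (0 : ℂ) 1).of_isClosed_subset isClosed_circ fun w hw => ?_
  simpa using circ_norm_le hw

instance : CompactSpace circ := isCompact_iff_compactSpace.mp isCompact_circ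

theorem circ_inv {w : ℂ} (hw : w ∈ circ) (h0 : w ≠ 0) :
    (((w⁻¹ + Complex.I).re : ℝ) : ℂ) = w⁻¹ + Complex.I := by
  have hn : ‖w‖ ^ 2 ≠ 0 := by simpa using h0
  refine Complex.ext (by rw [Complex.ofReal_re]) ?_
  rw [Complex.ofReal_im, Complex.add_im, Complex.inv_im, Complex.normSq_eq_norm_sq, circ_im hw,
    neg_div, div_self hn, Complex.I_im, neg_add_cancel]

/-- The function `t ↦ (t - i)⁻¹`. -/
def cay (t : ℝ) : ℂ := ((t : ℂ) - Complex.I)⁻¹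

theorem cay_ne_zero (t : ℝ) : cay t ≠ 0 := inv_ne_zero (HalfPlane.sub_I_ne_zero t)

theorem cay_inv (t : ℝ) : ((cay t)⁻¹ + Complex.I).re = t := by
  simp [cay]

theorem cay_mem (t : ℝ) : cay t ∈ circ := by
  have h1 := HalfPlane.sub_I_ne_zero t
  have h2 := HalfPlane.add_I_ne_zero (z := t) (by simp)
  have hc : (starRingEnd ℂ) (cay t) = ((t : ℂ) + Complex.I)⁻¹ := by
    simp [cay]
  change cay t - (starRingEnd ℂ) (cay t) = 2 * Complex.I * (cay t * (starRingEnd ℂ) (cay t))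
  rw [hc, cay]
  field_simp
  ring

theorem continuous_cay : Continuous cay := by
  unfold cay
  exact (Complex.continuous_ofReal.sub continuous_const).inv₀ HalfPlane.sub_I_ne_zero

theorem cay_of_circ {w : ℂ} (hw : w ∈ circ) (h0 : w ≠ 0) : cay (w⁻¹ + Complex.I).re = w := by
  rw [cay, circ_inv hw h0]
  simp

open Classical in
/-- The function `(t - i)⁻¹ ↦ f t`, `0 ↦ 0`. -/
def pull (f : C₀(ℝ, ℂ)) (w : ℂ) : ℂ := if w = 0 then 0 else f (w⁻¹ + Complex.I).re

theorem pull_cay (f : C₀(ℝ, ℂ)) (t : ℝ) : pull f (cay t) = f t := by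
  rw [pull, if_neg (cay_ne_zero t), cay_inv]

/-- Only `w = 0` is critical. On the circle `w⁻¹ + i` is real, and it tends to infinity as `w → 0`,
where `f` vanishes. -/
theorem continuousOn_pull (f : C₀(ℝ, ℂ)) : ContinuousOn (pull f) circ := by
  intro w hw
  by_cases h0 : w = 0
  · subst h0
    rw [← continuousWithinAt_sdiff_self]
    have h1 : Tendsto (fun w : ℂ => w⁻¹ + Complex.I) (𝓝[circ \ {0}] 0) (Bornology.cobounded ℂ) := by
      have h0 : Tendsto (fun w : ℂ => w⁻¹) (𝓝[circ \ {0}] 0) (Bornology.cobounded ℂ) :=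
        tendsto_inv₀_nhdsNE_zero.mono_left (nhdsWithin_mono _ fun w hw => hw.2)
      rw [← tendsto_norm_atTop_iff_cobounded] at h0 ⊢
      refine tendsto_atTop_mono (fun w => ?_) (tendsto_atTop_add_const_right _ (-1) h0)
      have := norm_sub_le (w⁻¹ + Complex.I) Complex.I
      rw [add_sub_cancel_right, Complex.norm_I] at this
      linarith
    have h2 : Tendsto (fun w : ℂ => (w⁻¹ + Complex.I).re) (𝓝[circ \ {0}] 0) (cocompact ℝ) := by
      rw [← Metric.cobounded_eq_cocompact, ← tendsto_norm_atTop_iff_cobounded]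
      refine (tendsto_norm_atTop_iff_cobounded.mpr h1).congr' ?_
      filter_upwards [self_mem_nhdsWithin] with w hw
      rw [← circ_inv hw.1 hw.2, Complex.norm_real, Complex.ofReal_re]
    have h3 := f.zero_at_infty'.comp h2
    rw [ContinuousWithinAt, show pull f 0 = 0 by simp [pull]]
    refine h3.congr' ?_
    filter_upwards [self_mem_nhdsWithin] with w hw
    exact (if_neg hw.2).symm
  · have h1 : ContinuousAt (fun w : ℂ => f (w⁻¹ + Complex.I).re) w := by
      have : ContinuousAt (fun w : ℂ => (w⁻¹ + Complex.I).re) w :=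
        Complex.continuous_re.continuousAt.comp ((continuousAt_inv₀ h0).add continuousAt_const)
      exact ContinuousAt.comp (f := fun w : ℂ => (w⁻¹ + Complex.I).re) f.continuous.continuousAt this
    refine (h1.congr ?_).continuousWithinAt
    filter_upwards [isOpen_ne.mem_nhds h0] with x hx
    rw [pull, if_neg hx]

/-- `t ↦ (t - i)⁻¹` as a map to the circle. -/
def cayC (t : ℝ) : circ := ⟨cay t, cay_mem t⟩

theorem continuous_cayC : Continuous cayC := continuous_cay.subtype_mk _

theorem integrable_comp_cayC (μ : Measure ℝ) [IsFiniteMeasure μ] (g : C(circ, ℂ)) :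
    Integrable (fun t => g (cayC t)) μ := by
  refine Integrable.of_bound (g.continuous.comp continuous_cayC).aestronglyMeasurable ‖g‖
    (.of_forall fun t => g.norm_coe_le_norm _)

theorem norm_integral_comp_le (μ : Measure ℝ) [IsFiniteMeasure μ] (g : C(circ, ℂ)) :
    ‖∫ t, g (cayC t) ∂μ‖ ≤ ‖g‖ * μ.real Set.univ :=
  norm_integral_le_of_norm_le_const (.of_forall fun _ => g.norm_coe_le_norm _)

variable {μs : ℕ → Measure ℝ} {μ : Measure ℝ} [∀ n, IsFiniteMeasure (μs n)] [IsFiniteMeasure μ]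

/-- The circle relation `w - w̄ = 2i w w̄` expresses a product containing both `w` and `w̄` through
products of lower total degree; pure powers of `w̄` are conjugates of the given moments. -/
theorem tendsto_mixed
    (h : ∀ j : ℕ, Tendsto (fun n => ∫ t, cay t ^ j ∂(μs n)) atTop (𝓝 (∫ t, cay t ^ j ∂μ)))
    (j k : ℕ) : Tendsto (fun n => ∫ t, cay t ^ j * (starRingEnd ℂ) (cay t) ^ k ∂(μs n)) atTop
      (𝓝 (∫ t, cay t ^ j * (starRingEnd ℂ) (cay t) ^ k ∂μ)) := by
  have hint : ∀ (ν : Measure ℝ) [IsFiniteMeasure ν] (j k : ℕ),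
      Integrable (fun t => cay t ^ j * (starRingEnd ℂ) (cay t) ^ k) ν := by
    intro ν _ j k
    refine Integrable.of_bound (C := 1) ?_ (.of_forall fun t => ?_)
    · have := continuous_cay
      exact (by fun_prop : Continuous fun t => cay t ^ j * (starRingEnd ℂ) (cay t) ^ k).aestronglyMeasurable
    · have h1 := circ_norm_le (cay_mem t)
      rw [norm_mul, norm_pow, norm_pow, RCLike.norm_conj, ← pow_add]
      exact pow_le_one₀ (norm_nonneg _) h1
  induction j generalizing k with
  | zero =>
    have h1 := (Complex.continuous_conj.tendsto _).comp (h k)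
    have e : ∀ ν : Measure ℝ, ∫ t, cay t ^ 0 * (starRingEnd ℂ) (cay t) ^ k ∂ν
        = (starRingEnd ℂ) (∫ t, cay t ^ k ∂ν) := by
      intro ν
      rw [← integral_conj]
      simp
    simp_rw [e]
    exact h1
  | succ j ih =>
    induction k with
    | zero => simpa using h (j + 1)
    | succ k ihk =>
      have e : ∀ t, cay t ^ (j + 1) * (starRingEnd ℂ) (cay t) ^ (k + 1)
          = (2 * Complex.I)⁻¹ * (cay t ^ (j + 1) * (starRingEnd ℂ) (cay t) ^ k
            - cay t ^ j * (starRingEnd ℂ) (cay t) ^ (k + 1)) := by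
        intro t
        have h1 : cay t - (starRingEnd ℂ) (cay t) = 2 * Complex.I * (cay t * (starRingEnd ℂ) (cay t)) :=
          cay_mem t
        have h2 : (2 * Complex.I) ≠ 0 := by simp
        rw [eq_inv_mul_iff_mul_eq₀ h2]
        linear_combination (-(cay t ^ j * (starRingEnd ℂ) (cay t) ^ k)) * h1
      simp_rw [e]
      simp_rw [integral_const_mul]
      refine Tendsto.const_mul _ ?_
      rw [integral_sub (hint _ _ _) (hint _ _ _)]
      refine (ihk.sub (ih (k + 1))).congr fun n => ?_
      rw [integral_sub (hint _ _ _) (hint _ _ _)]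

/-- The functions `g` for which convergence holds form a subspace, which is closed because the total
masses (the moment `j = 0`) stay bounded. It contains all polynomials in `w` and `w̄`, so
Stone–Weierstrass applies. -/
theorem tendsto_comp_cayC
    (h : ∀ j : ℕ, Tendsto (fun n => ∫ t, cay t ^ j ∂(μs n)) atTop (𝓝 (∫ t, cay t ^ j ∂μ)))
    (g : C(circ, ℂ)) : Tendsto (fun n => ∫ t, g (cayC t) ∂(μs n)) atTop
      (𝓝 (∫ t, g (cayC t) ∂μ)) := by
  let V : Submodule ℂ C(circ, ℂ) :=
    { carrier := {g | Tendsto (fun n => ∫ t, g (cayC t) ∂(μs n)) atTop (𝓝 (∫ t, g (cayC t) ∂μ))}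
      add_mem' := by
        intro a b ha hb
        simp only [Set.mem_ofPred_eq, ContinuousMap.add_apply] at *
        rw [integral_add (integrable_comp_cayC _ _) (integrable_comp_cayC _ _)]
        refine (ha.add hb).congr fun n => ?_
        rw [integral_add (integrable_comp_cayC _ _) (integrable_comp_cayC _ _)]
      zero_mem' := by simp
      smul_mem' := by
        intro c a ha
        simp only [Set.mem_ofPred_eq, ContinuousMap.smul_apply, integral_smul] at *
        exact ha.const_smul c }
  have hmass : Tendsto (fun n => (μs n).real Set.univ) atTop (𝓝 (μ.real Set.univ)) := by
    have h0 := h 0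
    simp only [pow_zero, integral_const] at h0
    have := (Complex.continuous_re.tendsto _).comp h0
    simpa [Function.comp_def] using this
  have hclosed : IsClosed (V : Set C(circ, ℂ)) := by
    rw [← isSeqClosed_iff_isClosed]
    intro a b ha hab
    change Tendsto _ _ _
    rw [Metric.tendsto_atTop]
    intro ε hε
    set m := μ.real Set.univ
    have hm : 0 ≤ m := measureReal_nonneg
    -- The masses are eventually below `m + 1`, so both replacements of `b` by `a k` cost at most a
    -- fraction `(2m + 1) / (2m + 2)` of `ε / 2`.
    have hpos : 0 < ε / (2 * (2 * m + 2)) := by positivity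
    obtain ⟨k, hk⟩ := ((Metric.tendsto_atTop.mp hab) _ hpos)
    have hk := hk k le_rfl
    have hak : Tendsto (fun n => ∫ t, a k (cayC t) ∂(μs n)) atTop (𝓝 (∫ t, a k (cayC t) ∂μ)) := ha k
    have e1 := hmass.eventually (gt_mem_nhds (show m < m + 1 by linarith))
    have e2 := (Metric.tendsto_nhds.mp hak) (ε / 2) (by linarith)
    obtain ⟨N, hN⟩ := eventually_atTop.mp (e1.and e2)
    refine ⟨N, fun n hn => ?_⟩
    obtain ⟨h1, h2⟩ := hN n hn
    have key : ∀ (ν : Measure ℝ) [IsFiniteMeasure ν], 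
        ‖∫ t, b (cayC t) ∂ν - ∫ t, a k (cayC t) ∂ν‖ ≤ ε / (2 * (2 * m + 2)) * ν.real Set.univ := by
      intro ν _
      rw [← integral_sub (integrable_comp_cayC _ _) (integrable_comp_cayC _ _)]
      refine (norm_integral_comp_le ν (b - a k)).trans ?_
      gcongr
      rw [← dist_eq_norm, dist_comm]
      exact hk.le
    have k1 := key (μs n)
    have k2 := key μ
    rw [dist_eq_norm] at h2 ⊢
    have e : ∫ t, b (cayC t) ∂(μs n) - ∫ t, b (cayC t) ∂μ
        = (∫ t, b (cayC t) ∂(μs n) - ∫ t, a k (cayC t) ∂(μs n))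
          + (∫ t, a k (cayC t) ∂(μs n) - ∫ t, a k (cayC t) ∂μ)
          - (∫ t, b (cayC t) ∂μ - ∫ t, a k (cayC t) ∂μ) := by ring
    rw [e]
    refine ((norm_sub_le _ _).trans (add_le_add_left (norm_add_le _ _) _)).trans_lt ?_
    have h3 : ε / (2 * (2 * m + 2)) * (μs n).real Set.univ ≤ ε / (2 * (2 * m + 2)) * (m + 1) := by
      gcongr
    have h4 : ε / (2 * (2 * m + 2)) * (m + 1) + ε / (2 * (2 * m + 2)) * m < ε / 2 := by
      rw [← mul_add, div_mul_eq_mul_div, div_lt_div_iff₀ (by positivity) (by norm_num)]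
      nlinarith
    linarith
  have hsub : ∀ a ∈ (polynomialFunctions circ).starClosure, a ∈ V := by
    intro a ha
    rw [polynomialFunctions.starClosure_eq_adjoin_X, ← StarSubalgebra.mem_toSubalgebra,
      StarAlgebra.adjoin_toSubalgebra, ← Subalgebra.mem_toSubmodule, Algebra.adjoin_eq_span] at ha
    refine (Submodule.span_le.mpr ?_) ha
    intro b hb
    rw [SetLike.mem_coe, Set.star_singleton, Set.singleton_union, Submonoid.mem_closure_pair] at hb
    obtain ⟨j, k, rfl⟩ := hb
    have := tendsto_mixed h j k
    change Tendsto _ _ _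
    simpa [cayC] using this
  have htop := polynomialFunctions.starClosure_topologicalClosure circ
  have hg : g ∈ (polynomialFunctions circ).starClosure.topologicalClosure := by
    rw [htop]; trivial
  exact (closure_minimal hsub hclosed) hg

theorem tendsto_integral_zeroAtInfty
    (h : ∀ j : ℕ, Tendsto (fun n => ∫ t, cay t ^ j ∂(μs n)) atTop (𝓝 (∫ t, cay t ^ j ∂μ)))
    (f : C₀(ℝ, ℂ)) : Tendsto (fun n => ∫ t, f t ∂(μs n)) atTop (𝓝 (∫ t, f t ∂μ)) := by
  have := tendsto_comp_cayC h ⟨circ.domRestrict (pull f), (continuousOn_pull f).domRestrict⟩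
  have e : ∀ t, (⟨circ.domRestrict (pull f), (continuousOn_pull f).domRestrict⟩ : C(circ, ℂ)) (cayC t)
      = f t := pull_cay f
  simpa only [e] using this

/-- The cutoff functions `(1 + (t / (k + 1))²)⁻¹`. -/
def cutoff (k : ℕ) (t : ℝ) : ℝ := (1 + (t / (k + 1)) ^ 2)⁻¹

theorem continuous_cutoff (k : ℕ) : Continuous (cutoff k) := by
  unfold cutoff
  exact Continuous.inv₀ (by fun_prop) fun t => by positivity

theorem cutoff_nonneg (k : ℕ) (t : ℝ) : 0 ≤ cutoff k t := by
  unfold cutoff; positivity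

theorem cutoff_le_one (k : ℕ) (t : ℝ) : cutoff k t ≤ 1 := by
  unfold cutoff
  exact inv_le_one_of_one_le₀ (by nlinarith [sq_nonneg (t / (k + 1))])

theorem tendsto_cutoff (t : ℝ) : Tendsto (fun k => cutoff k t) atTop (𝓝 1) := by
  have h1 : Tendsto (fun k : ℕ => t / ((k : ℝ) + 1)) atTop (𝓝 0) :=
    tendsto_const_nhds.div_atTop (tendsto_atTop_add_const_right _ _ tendsto_natCast_atTop_atTop)
  have h2 := ((h1.pow 2).const_add 1).inv₀ (by norm_num)
  simpa [cutoff] using h2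

theorem cutoff_zero_at_infty (k : ℕ) : Tendsto (cutoff k) (cocompact ℝ) (𝓝 0) := by
  unfold cutoff
  refine tendsto_inv_atTop_zero.comp (tendsto_atTop_add_const_left _ _ ?_)
  have h1 : Tendsto (fun t : ℝ => |t|) (cocompact ℝ) atTop := tendsto_norm_cocompact_atTop
  have h2 : Tendsto (fun t : ℝ => (|t| / ((k : ℝ) + 1)) ^ 2) (cocompact ℝ) atTop :=
    (tendsto_pow_atTop two_ne_zero).comp (h1.atTop_div_const (by positivity))
  refine h2.congr fun t => ?_
  rw [div_pow, div_pow, sq_abs]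

/-- The product of a bounded continuous function and a cutoff. -/
def cutMul (k : ℕ) (f : ℝ →ᵇ ℝ) : C₀(ℝ, ℂ) where
  toFun t := ((f t * cutoff k t : ℝ) : ℂ)
  continuous_toFun := by
    have := continuous_cutoff k
    have := f.continuous
    fun_prop
  zero_at_infty' := by
    have h1 : Tendsto (fun t => f t * cutoff k t) (cocompact ℝ) (𝓝 0) := by
      refine squeeze_zero_norm (a := fun t => ‖f‖ * cutoff k t) (fun t => ?_) ?_
      · rw [norm_mul, Real.norm_of_nonneg (cutoff_nonneg k t)]
        exact mul_le_mul_of_nonneg_right (f.norm_coe_le_norm t) (cutoff_nonneg k t)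
      · simpa using (cutoff_zero_at_infty k).const_mul ‖f‖
    have h2 := (Complex.continuous_ofReal.tendsto _).comp h1
    rwa [Complex.ofReal_zero] at h2

theorem integrable_mul_cutoff (ν : Measure ℝ) [IsFiniteMeasure ν] (k : ℕ) (f : ℝ →ᵇ ℝ) :
    Integrable (fun t => f t * cutoff k t) ν := by
  refine Integrable.of_bound (f.continuous.mul (continuous_cutoff k)).aestronglyMeasurable ‖f‖
    (.of_forall fun t => ?_)
  rw [norm_mul, Real.norm_of_nonneg (cutoff_nonneg k t)]
  exact (mul_le_mul (f.norm_coe_le_norm t) (cutoff_le_one k t) (cutoff_nonneg k t)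
    (norm_nonneg _)).trans (by simp)

theorem tendsto_integral_mul_cutoff
    (h : ∀ j : ℕ, Tendsto (fun n => ∫ t, cay t ^ j ∂(μs n)) atTop (𝓝 (∫ t, cay t ^ j ∂μ)))
    (k : ℕ) (f : ℝ →ᵇ ℝ) : Tendsto (fun n => ∫ t, f t * cutoff k t ∂(μs n)) atTop
      (𝓝 (∫ t, f t * cutoff k t ∂μ)) := by
  have h1 := tendsto_integral_zeroAtInfty h (cutMul k f)
  have e : ∀ ν : Measure ℝ, ∫ t, cutMul k f t ∂ν = ((∫ t, f t * cutoff k t ∂ν : ℝ) : ℂ) := by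
    intro ν
    rw [← integral_complex_ofReal]
    rfl
  simp_rw [e] at h1
  simpa [Function.comp_def] using (Complex.continuous_re.tendsto _).comp h1

/-- Convergence of all moments of `(t - i)⁻¹` implies weak convergence. -/
theorem tendsto_integral_of_moments
    (h : ∀ j : ℕ, Tendsto (fun n => ∫ t, cay t ^ j ∂(μs n)) atTop (𝓝 (∫ t, cay t ^ j ∂μ)))
    (f : ℝ →ᵇ ℝ) : Tendsto (fun n => ∫ t, f t ∂(μs n)) atTop (𝓝 (∫ t, f t ∂μ)) := by
  have hmass : Tendsto (fun n => (μs n).real Set.univ) atTop (𝓝 (μ.real Set.univ)) := by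
    have h0 := h 0
    simp only [pow_zero, integral_const] at h0
    have := (Complex.continuous_re.tendsto _).comp h0
    simpa [Function.comp_def] using this
  have hone : ∀ (ν : Measure ℝ) [IsFiniteMeasure ν] (k : ℕ), Integrable (cutoff k) ν := by
    intro ν _ k
    simpa using integrable_mul_cutoff ν k 1
  -- Tightness: since the total masses converge, the mass cut off from `μs n` converges to the mass
  -- cut off from `μ`, and nothing escapes to infinity.
  have hcut : ∀ k, Tendsto (fun n => (μs n).real Set.univ - ∫ t, cutoff k t ∂(μs n)) atTop
      (𝓝 (μ.real Set.univ - ∫ t, cutoff k t ∂μ)) := by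
    intro k
    have := tendsto_integral_mul_cutoff h k 1
    simp only [BoundedContinuousFunction.coe_one, Pi.one_apply, one_mul] at this
    exact hmass.sub this
  have hlim : Tendsto (fun k => μ.real Set.univ - ∫ t, cutoff k t ∂μ) atTop (𝓝 0) := by
    have : Tendsto (fun k => ∫ t, cutoff k t ∂μ) atTop (𝓝 (∫ _, (1 : ℝ) ∂μ)) := by
      refine tendsto_integral_of_dominated_convergence (fun _ => 1)
        (fun k => (continuous_cutoff k).aestronglyMeasurable) (integrable_const _)
        (fun k => .of_forall fun t => ?_) (.of_forall tendsto_cutoff)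
      rw [Real.norm_of_nonneg (cutoff_nonneg k t)]
      exact cutoff_le_one k t
    simpa using this.const_sub (μ.real Set.univ)
  have key : ∀ (ν : Measure ℝ) [IsFiniteMeasure ν] (k : ℕ),
      |∫ t, f t ∂ν - ∫ t, f t * cutoff k t ∂ν| ≤ ‖f‖ * (ν.real Set.univ - ∫ t, cutoff k t ∂ν) := by
    intro ν _ k
    rw [← integral_sub (f.integrable ν) (integrable_mul_cutoff ν k f)]
    have e : ‖f‖ * (ν.real Set.univ - ∫ t, cutoff k t ∂ν) = ∫ t, ‖f‖ * (1 - cutoff k t) ∂ν := by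
      rw [integral_const_mul, integral_sub (integrable_const _) (hone ν k)]
      simp
    rw [e, ← Real.norm_eq_abs]
    refine norm_integral_le_of_norm_le (((integrable_const _).sub (hone ν k)).const_mul _)
      (.of_forall fun t => ?_)
    rw [← mul_one_sub, norm_mul, Real.norm_of_nonneg (by linarith [cutoff_le_one k t] : 0 ≤ 1 - cutoff k t)]
    exact mul_le_mul_of_nonneg_right (f.norm_coe_le_norm t) (by linarith [cutoff_le_one k t])
  rw [Metric.tendsto_atTop]
  intro ε hε
  -- Each of the two cutoff errors becomes at most `ε / 4`; the summand `1` covers `f = 0`.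
  have hpos : 0 < ε / (4 * (‖f‖ + 1)) := by positivity
  obtain ⟨k, hk⟩ := (hlim.eventually (gt_mem_nhds hpos)).exists
  have e1 := (hcut k).eventually (gt_mem_nhds hk)
  have e2 := (Metric.tendsto_nhds.mp (tendsto_integral_mul_cutoff h k f)) (ε / 4) (by linarith)
  obtain ⟨N, hN⟩ := eventually_atTop.mp (e1.and e2)
  refine ⟨N, fun n hn => ?_⟩
  obtain ⟨h1, h2⟩ := hN n hn
  rw [Real.dist_eq] at h2 ⊢
  have b : ∀ x : ℝ, x < ε / (4 * (‖f‖ + 1)) → ‖f‖ * x ≤ ε / 4 := by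
    intro x hx
    rw [lt_div_iff₀ (by positivity)] at hx
    rcases le_total x 0 with h0 | h0
    · have := mul_nonpos_of_nonneg_of_nonpos (norm_nonneg f) h0
      linarith
    · nlinarith [norm_nonneg f]
  have k1 := (key (μs n) k).trans (b _ h1)
  have k2 := (key μ k).trans (b _ hk)
  rw [abs_lt] at h2 ⊢
  rw [abs_le] at k1 k2
  constructor <;> linarith [k1.1, k1.2, k2.1, k2.2, h2.1, h2.2]

end ResolventMoments

/-! ### Spectral measures of normal operators whose spectrum lies on the circle -/

namespace ResolventMoments

open scoped CompactlySupported

/-- Finite measures on the line are determined by the continuous functions vanishing at infinity. -/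
theorem ext_of_integral_zeroAtInfty {μ ν : Measure ℝ} [IsFiniteMeasure μ] [IsFiniteMeasure ν]
    (h : ∀ f : C₀(ℝ, ℂ), ∫ t, f t ∂μ = ∫ t, f t ∂ν) : μ = ν := by
  refine Measure.ext_of_integral_eq_on_compactlySupported fun f => ?_
  let g : C₀(ℝ, ℂ) :=
    { toFun := fun t => ((f t : ℝ) : ℂ)
      continuous_toFun := Complex.continuous_ofReal.comp f.continuous
      zero_at_infty' := by
        have h2 := (Complex.continuous_ofReal.tendsto _).comp f.hasCompactSupport.is_zero_at_infty
        rwa [Complex.ofReal_zero] at h2 }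
  have := h g
  simp only [g, ZeroAtInftyContinuousMap.coe_mk, integral_complex_ofReal] at this
  exact_mod_cast this

variable {E : Type*} [NormedAddCommGroup E] [InnerProductSpace ℂ E] [CompleteSpace E]
variable {R : E →L[ℂ] E}

/-- The function `w - w̄ - 2i w w̄` of `R` is the zero operator, so by spectral mapping it vanishes
on the spectrum. -/
theorem spectrum_subset_circ (hR : IsStarNormal R)
    (hrel : R - star R = (2 * Complex.I) • (R * star R)) : spectrum ℂ R ⊆ circ := by
  intro w hw
  by_contra hne
  set f : ℂ → ℂ := fun w => w - star w - (2 * Complex.I) * (w * star w)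
  have hc : cfc f R = 0 := by
    rw [cfc_sub (fun w => w - star w) (fun w => (2 * Complex.I) * (w * star w)) R,
      cfc_sub (fun w => w) (fun w => star w) R,
      cfc_const_mul (2 * Complex.I) (fun w => w * star w) R, cfc_mul (fun w => w) (fun w => star w) R,
      cfc_star_id R, cfc_id' ℂ R,
      hrel, sub_self]
  have hs := cfc_map_spectrum f R (hf := by fun_prop)
  have hmem : f w ∈ spectrum ℂ (0 : E →L[ℂ] E) := by
    rw [← hc, hs]
    exact ⟨w, hw, rfl⟩
  have hf0 : f w ≠ 0 := fun h0 => hne (sub_eq_zero.mp h0)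
  rw [spectrum.mem_iff, sub_zero] at hmem
  exact hmem ((IsUnit.mk0 _ hf0).map _)

/-- A real continuous function as a complex one. -/
def toC {X : Type*} [TopologicalSpace X] (g : C(X, ℝ)) : C(X, ℂ) :=
  ⟨fun x => (g x : ℂ), Complex.continuous_ofReal.comp g.continuous⟩

theorem inner_cfcHom_toC (hR : IsStarNormal R) (g : C(spectrum ℂ R, ℝ)) (v : E) :
    inner ℂ v (cfcHom hR (toC g) v) = ((inner ℂ v (cfcHom hR (toC g) v)).re : ℂ) := by
  have hs : star (cfcHom hR (toC g)) = cfcHom hR (toC g) := by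
    rw [← map_star]
    congr 1
    ext x
    simp [toC]
  have h : (starRingEnd ℂ) (inner ℂ v (cfcHom hR (toC g) v)) = inner ℂ v (cfcHom hR (toC g) v) := by
    rw [inner_conj_symm]
    conv_lhs => rw [← hs, ContinuousLinearMap.star_eq_adjoint, ContinuousLinearMap.adjoint_inner_left]
  exact (Complex.conj_eq_iff_re.mp h).symm

/-- The positive functional `g ↦ ⟨v, g(R) v⟩`. -/
def spectralFunctional (hR : IsStarNormal R) (v : E) : C_c(spectrum ℂ R, ℝ) →ₚ[ℝ] ℝ :=
  PositiveLinearMap.mk₀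
    { toFun := fun g => (inner ℂ v (cfcHom hR (toC g.toContinuousMap) v)).re
      map_add' := by
        intro a b
        have : toC (a + b).toContinuousMap = toC a.toContinuousMap + toC b.toContinuousMap := by
          ext x; simp [toC]
        simp [this]
      map_smul' := by
        intro c a
        have : toC (c • a).toContinuousMap = (c : ℂ) • toC a.toContinuousMap := by
          ext x; simp [toC]
        simp [this] }
    (by
      intro g hg
      -- With `h = √g` the functional equals `‖h(R) v‖²`, hence is nonnegative.
      let h : C(spectrum ℂ R, ℝ) := ⟨fun x => √(g x), g.continuous.sqrt⟩
      have e : toC g.toContinuousMap = star (toC h) * toC h := by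
        ext x
        have : 0 ≤ g x := hg x
        simp only [toC, ContinuousMap.mul_apply, ContinuousMap.star_apply, ContinuousMap.coe_mk, h]
        rw [RCLike.star_def, Complex.conj_ofReal, ← Complex.ofReal_mul, Real.mul_self_sqrt this]
        rfl
      simp only [LinearMap.coe_mk, AddHom.coe_mk]
      rw [e, map_mul, map_star, mul_apply_eq_comp, ContinuousLinearMap.star_eq_adjoint,
        ContinuousLinearMap.adjoint_inner_right, inner_self_eq_norm_sq_to_K]
      simp only [Complex.coe_algebraMap, ← Complex.ofReal_pow, Complex.ofReal_re]
      positivity)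

theorem exists_measure_spectrum (hR : IsStarNormal R) (v : E) :
    ∃ m : Measure (spectrum ℂ R), IsFiniteMeasure m ∧
      ∀ g : C(spectrum ℂ R, ℂ), ∫ x, g x ∂m = inner ℂ v (cfcHom hR g v) := by
  let m := RealRMK.rieszMeasure (spectralFunctional hR v)
  have hm : IsFiniteMeasure m := inferInstance
  refine ⟨m, hm, fun g => ?_⟩
  have hreal : ∀ g : C(spectrum ℂ R, ℝ), ∫ x, (g x : ℂ) ∂m = inner ℂ v (cfcHom hR (toC g) v) := by
    intro g
    have h := RealRMK.integral_rieszMeasure (spectralFunctional hR v)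
      (CompactlySupportedContinuousMap.continuousMapEquiv g)
    rw [integral_complex_ofReal, inner_cfcHom_toC]
    congr 1
  let g1 : C(spectrum ℂ R, ℝ) := ⟨fun x => (g x).re, Complex.continuous_re.comp g.continuous⟩
  let g2 : C(spectrum ℂ R, ℝ) := ⟨fun x => (g x).im, Complex.continuous_im.comp g.continuous⟩
  have e : g = toC g1 + Complex.I • toC g2 := by
    ext x
    simp only [toC, g1, g2, ContinuousMap.add_apply, ContinuousMap.smul_apply, ContinuousMap.coe_mk,
      smul_eq_mul, mul_comm Complex.I]
    exact (Complex.re_add_im _).symm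
  have hint : ∀ g : C(spectrum ℂ R, ℂ), Integrable g m := fun g =>
    Integrable.of_bound g.continuous.aestronglyMeasurable ‖g‖ (.of_forall fun x => g.norm_coe_le_norm x)
  have h1 := hreal g1
  have h2 := hreal g2
  conv_rhs => rw [e, map_add, map_smul, _root_.add_apply, _root_.smul_apply, inner_add_right, inner_smul_right, ← h1, ← h2, ← integral_const_mul]
  refine Eq.trans ?_ (integral_add (hint (toC g1)) ((hint (toC g2)).const_mul Complex.I))
  congr 1 with x
  conv_lhs => rw [e]
  rfl

/-- The point `0` of the circle corresponds to infinity on the line and must carry no mass. This is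
why the vector is taken in the range of `R`: the measure of `R φ` is `|w|²` times that of `φ`, so
the push-forward to the line loses nothing. -/
theorem exists_spectral_measure (hR : IsStarNormal R)
    (hrel : R - star R = (2 * Complex.I) • (R * star R)) (φ : E) :
    ∃ μ : Measure ℝ, IsFiniteMeasure μ ∧
      (∀ f : C₀(ℝ, ℂ), ∫ t, f t ∂μ = inner ℂ (R φ) (cfc (pull f) R (R φ))) ∧
      ∀ j : ℕ, ∫ t, cay t ^ j ∂μ = inner ℂ (R φ) ((R ^ j) (R φ)) := by
  obtain ⟨m, hm, hint⟩ := exists_measure_spectrum hR φ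
  have hsub := spectrum_subset_circ hR hrel
  let d : spectrum ℂ R → NNReal := fun x => ‖(x : ℂ)‖₊ ^ 2
  have hd : Measurable d := by fun_prop
  let m' := m.withDensity fun x => (d x : ENNReal)
  have hd1 : ∀ x, d x ≤ 1 := by
    intro x
    have : ‖(x : ℂ)‖₊ ≤ 1 := circ_norm_le (hsub x.2)
    exact pow_le_one₀ (zero_le) this
  have hm' : IsFiniteMeasure m' := by
    refine isFiniteMeasure_withDensity ?_
    refine ne_top_of_le_ne_top (measure_ne_top m Set.univ) ?_
    refine (lintegral_mono (g := fun _ => 1) fun x => ?_).trans (by simp)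
    simp only
    exact_mod_cast hd1 x
  have hae : ∀ᵐ x : spectrum ℂ R ∂m', (x : ℂ) ≠ 0 := by
    rw [ae_withDensity_iff (by fun_prop)]
    refine .of_forall fun x hx h0 => hx ?_
    simp [d, h0]
  let i : C(spectrum ℂ R, ℂ) := (ContinuousMap.id ℂ).restrict (spectrum ℂ R)
  have hi : cfcHom hR i = R := cfcHom_id hR
  have hint' : ∀ g : C(spectrum ℂ R, ℂ), ∫ x, g x ∂m' = inner ℂ (R φ) (cfcHom hR g (R φ)) := by
    intro g
    rw [integral_withDensity_eq_integral_smul hd]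
    have e : ∀ x, d x • g x = (star i * g * i) x := by
      intro x
      simp only [ContinuousMap.mul_apply, ContinuousMap.star_apply, d, i]
      change ((‖(x : ℂ)‖₊ ^ 2 : NNReal) : ℝ) • g x = star (x : ℂ) * g x * x
      have : star (x : ℂ) * x = ((‖(x : ℂ)‖ ^ 2 : ℝ) : ℂ) := by
        rw [RCLike.star_def, Complex.conj_mul']; simp
      rw [mul_right_comm, this, Complex.real_smul]
      rfl
    simp_rw [e]
    rw [hint, map_mul, map_mul, map_star, hi, mul_apply_eq_comp, mul_apply_eq_comp,
      ContinuousLinearMap.star_eq_adjoint, ContinuousLinearMap.adjoint_inner_right]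
  let T : spectrum ℂ R → ℝ := fun x => ((x : ℂ)⁻¹ + Complex.I).re
  have hT : Measurable T := by fun_prop
  refine ⟨m'.map T, inferInstance, fun f => ?_, fun j => ?_⟩
  · rw [integral_map hT.aemeasurable (map_continuous f).aestronglyMeasurable]
    have hc : ContinuousOn (pull f) (spectrum ℂ R) := (continuousOn_pull f).mono hsub
    rw [cfc_apply (pull f) R hR hc, ← hint']
    refine integral_congr_ae ?_
    filter_upwards [hae] with x hx
    exact (if_neg hx).symm
  · rw [integral_map hT.aemeasurable (f := fun t => cay t ^ j)
      (continuous_cay.pow j).aestronglyMeasurable]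
    have := hint' (i ^ j)
    rw [map_pow, hi] at this
    rw [← this]
    refine integral_congr_ae ?_
    filter_upwards [hae] with x hx
    simp only [T]
    rw [cay_of_circ (hsub x.2) hx]
    rfl

end ResolventMoments

/-! ### Resolvents of self-adjoint operators at `±i` -/

namespace SelfAdjoint

set_option linter.unusedSectionVars false

variable {E : Type*} [NormedAddCommGroup E] [InnerProductSpace ℂ E] [CompleteSpace E]
variable {A : E →ₗ.[ℂ] E}

theorem inner_symm (hA : IsSelfAdjoint A) (x y : A.domain) :
    inner ℂ (A x) (y : E) = inner ℂ (x : E) (A y) := by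
  have h1 := LinearPMap.adjoint_isFormalAdjoint hA.dense_domain
  rw [LinearPMap.isSelfAdjoint_def.mp hA] at h1
  exact h1 x y

theorem im_inner (hA : IsSelfAdjoint A) (x : A.domain) : (inner ℂ (x : E) (A x)).im = 0 := by
  have h := inner_symm hA x x
  rw [← inner_conj_symm] at h
  exact Complex.conj_eq_iff_im.mp h

theorem norm_le (hA : IsSelfAdjoint A) {z : ℂ} (hz : |z.im| = 1) (x : A.domain) :
    ‖(x : E)‖ ≤ ‖A x - z • (x : E)‖ := by
  have h1 : ‖(x : E)‖ ^ 2 = |(inner ℂ (x : E) (A x - z • (x : E))).im| := by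
    rw [inner_sub_right, inner_smul_right, inner_self_eq_norm_sq_to_K, Complex.sub_im,
      im_inner hA x, zero_sub, abs_neg]
    change _ = |(z * (‖(x : E)‖ : ℂ) ^ 2).im|
    rw [← Complex.ofReal_pow, Complex.im_mul_ofReal, abs_mul, hz, one_mul, abs_of_nonneg (by positivity)]
  have h2 := (Complex.abs_im_le_norm _).trans (norm_inner_le_norm (𝕜 := ℂ) (x : E) (A x - z • (x : E)))
  rw [← h1] at h2
  by_contra h
  push Not at h
  nlinarith [norm_nonneg (A x - z • (x : E))]

theorem eq_zero_of_eigen (hA : IsSelfAdjoint A) {z : ℂ} (hz : |z.im| = 1) (x : A.domain)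
    (hx : A x = z • (x : E)) : (x : E) = 0 := by
  have := norm_le hA hz x
  rw [hx, sub_self, norm_zero] at this
  exact norm_le_zero_iff.mp this

/-- `A - z` as a linear map on the domain. -/
def shift (A : E →ₗ.[ℂ] E) (z : ℂ) : A.domain →ₗ[ℂ] E := A.toFun - z • A.domain.subtype

theorem shift_apply (z : ℂ) (x : A.domain) : shift A z x = A x - z • (x : E) := rfl

theorem shift_injective (hA : IsSelfAdjoint A) {z : ℂ} (hz : |z.im| = 1) :
    Function.Injective (shift A z) := by
  rw [← LinearMap.ker_eq_bot, LinearMap.ker_eq_bot']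
  intro x hx
  exact Subtype.ext (eq_zero_of_eigen hA hz x (sub_eq_zero.mp hx))

/-- The range is closed by the lower bound `norm_le` and the closed graph. A vector orthogonal to it
is an eigenvector of the adjoint, that is of `A`, for the non-real number `z̄`, hence zero. -/
theorem shift_surjective (hA : IsSelfAdjoint A) {z : ℂ} (hz : |z.im| = 1) :
    Function.Surjective (shift A z) := by
  have hz' : |((starRingEnd ℂ) z).im| = 1 := by simpa using hz
  have hclosed : IsClosed (LinearMap.range (shift A z) : Set E) := by
    rw [← isSeqClosed_iff_isClosed]
    intro u φ hu hφ
    choose x hx using hu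
    have hc : CauchySeq fun k => (x k : E) := by
      rw [Metric.cauchySeq_iff']
      intro ε hε
      obtain ⟨N, hN⟩ := Metric.cauchySeq_iff'.mp hφ.cauchySeq ε hε
      refine ⟨N, fun n hn => ?_⟩
      have h1 := norm_le hA hz (x n - x N)
      rw [← shift_apply, map_sub, hx, hx] at h1
      rw [dist_eq_norm]
      have h2 := hN n hn
      rw [dist_eq_norm] at h2
      exact lt_of_le_of_lt h1 h2
    obtain ⟨y, hy⟩ := cauchySeq_tendsto_of_complete hc
    have hAx : Tendsto (fun k => A (x k)) atTop (𝓝 (φ + z • y)) := by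
      refine (hφ.add (hy.const_smul z)).congr fun k => ?_
      rw [← hx k, shift_apply, sub_add_cancel]
    have hg : (y, φ + z • y) ∈ A.graph := by
      refine (hA.isClosed : IsClosed (A.graph : Set (E × E))).mem_of_tendsto (hy.prodMk_nhds hAx)
        (.of_forall fun k => ?_)
      exact A.mem_graph (x k)
    obtain ⟨w, hw1, hw2⟩ := A.mem_graph_iff.mp hg
    refine ⟨w, ?_⟩
    rw [shift_apply, hw2, hw1]
    simp
  have horth : (LinearMap.range (shift A z))ᗮ = ⊥ := by
    rw [Submodule.eq_bot_iff]
    intro χ hχ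
    rw [Submodule.mem_orthogonal'] at hχ
    have h1 : ∀ x : A.domain, inner ℂ ((starRingEnd ℂ) z • χ) (x : E) = inner ℂ χ (A x) := by
      intro x
      have := hχ _ ⟨x, rfl⟩
      rw [shift_apply, inner_sub_right, inner_smul_right, sub_eq_zero] at this
      rw [inner_smul_left, this, Complex.conj_conj]
    have h2 := A.mem_adjoint_domain_of_exists χ ⟨_, h1⟩
    have h3 := LinearPMap.adjoint_apply_eq hA.dense_domain ⟨χ, h2⟩ h1
    -- A variable `B` stands for the adjoint, so that its equality with `A` can be substituted
    -- although the domain proof depends on it.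
    have key : ∀ (B : E →ₗ.[ℂ] E) (hB : B = A) (h : χ ∈ B.domain),
        B ⟨χ, h⟩ = (starRingEnd ℂ) z • χ → χ = 0 := by
      rintro B rfl h h4
      exact eq_zero_of_eigen hA hz' ⟨χ, h⟩ h4
    exact key _ (LinearPMap.isSelfAdjoint_def.mp hA) h2 h3
  have hcs : CompleteSpace (LinearMap.range (shift A z)) := hclosed.completeSpace_coe
  rw [← LinearMap.range_eq_top]
  exact (Submodule.orthogonal_eq_bot_iff).mp horth

theorem exists_resolvent (hA : IsSelfAdjoint A) {z : ℂ} (hz : |z.im| = 1) :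
    ∃ R : E →L[ℂ] E, IsResolventAt A z R := by
  let e := LinearEquiv.ofBijective (shift A z) ⟨shift_injective hA hz, shift_surjective hA hz⟩
  have he : ∀ x, e x = A x - z • (x : E) := fun x => rfl
  have hb : ∀ φ : E, ‖(A.domain.subtype ∘ₗ e.symm.toLinearMap) φ‖ ≤ 1 * ‖φ‖ := by
    intro φ
    have := norm_le hA hz (e.symm φ)
    rw [← he, e.apply_symm_apply] at this
    simpa using this
  refine ⟨LinearMap.mkContinuous (A.domain.subtype ∘ₗ e.symm.toLinearMap) 1 hb, ?_, ?_⟩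
  · intro φ
    refine ⟨(e.symm φ).2, ?_⟩
    have := e.apply_symm_apply φ
    rw [he] at this
    exact this
  · intro ψ
    change ((e.symm (A ψ - z • (ψ : E)) : A.domain) : E) = ψ
    rw [← he, e.symm_apply_apply]

theorem resolventAt_spec (hA : IsSelfAdjoint A) {z : ℂ} (hz : |z.im| = 1) :
    IsResolventAt A z (resolventAt A z) := by
  have h := exists_resolvent hA hz
  rw [resolventAt, dif_pos h]
  exact h.choose_spec

theorem adjoint_resolvent (hA : IsSelfAdjoint A) {R R' : E →L[ℂ] E}
    (hR : IsResolventAt A Complex.I R) (hR' : IsResolventAt A (-Complex.I) R') : star R = R' := by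
  rw [ContinuousLinearMap.star_eq_adjoint]
  symm
  rw [ContinuousLinearMap.eq_adjoint_iff]
  intro φ₁ φ₂
  obtain ⟨h1, e1⟩ := hR'.1 φ₁
  obtain ⟨h2, e2⟩ := hR.1 φ₂
  have hs := inner_symm hA ⟨R' φ₁, h1⟩ ⟨R φ₂, h2⟩
  simp only at hs
  conv_lhs => rw [← e2]
  conv_rhs => rw [← e1]
  rw [inner_sub_right, inner_sub_left, inner_smul_right, inner_smul_left, hs]
  simp

/-- The resolvent identity between `i` and `-i`, in both orders: one order is the circle relation,
the two together give normality. -/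
theorem resolvent_sub_star (hA : IsSelfAdjoint A) {R : E →L[ℂ] E}
    (hR : IsResolventAt A Complex.I R) :
    R - star R = (2 * Complex.I) • (R * star R) ∧ R - star R = (2 * Complex.I) • (star R * R) := by
  have hR' := resolventAt_spec hA (z := -Complex.I) (by simp)
  set R' := resolventAt A (-Complex.I)
  rw [adjoint_resolvent hA hR hR']
  constructor
  · ext φ
    obtain ⟨h1, e1⟩ := hR'.1 φ
    have h2 := hR.2 ⟨R' φ, h1⟩
    have e3 : A ⟨R' φ, h1⟩ - Complex.I • R' φ = φ - (2 * Complex.I) • R' φ := by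
      have : A ⟨R' φ, h1⟩ = φ + (-Complex.I) • R' φ := sub_eq_iff_eq_add.mp e1
      rw [this]
      module
    simp only at h2
    rw [e3, map_sub, map_smul] at h2
    simp only [_root_.sub_apply, _root_.smul_apply, mul_apply_eq_comp]
    rw [sub_eq_iff_eq_add, ← sub_eq_iff_eq_add', h2]
  · ext φ
    obtain ⟨h1, e1⟩ := hR.1 φ
    have h2 := hR'.2 ⟨R φ, h1⟩
    have e3 : A ⟨R φ, h1⟩ - (-Complex.I) • R φ = φ + (2 * Complex.I) • R φ := by
      have : A ⟨R φ, h1⟩ = φ + Complex.I • R φ := sub_eq_iff_eq_add.mp e1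
      rw [this]
      module
    simp only at h2
    rw [e3, map_add, map_smul] at h2
    simp only [_root_.sub_apply, _root_.smul_apply, mul_apply_eq_comp]
    rw [sub_eq_iff_eq_add', h2]

theorem isStarNormal_resolvent (hA : IsSelfAdjoint A) {R : E →L[ℂ] E}
    (hR : IsResolventAt A Complex.I R) : IsStarNormal R := by
  obtain ⟨h1, h2⟩ := resolvent_sub_star hA hR
  refine ⟨?_⟩
  rw [h1] at h2
  exact (smul_right_injective _ (by simp : (2 * Complex.I) ≠ 0) h2).symm

end SelfAdjoint

/-- The continuous linear map between Euclidean spaces with a given matrix. -/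
def eucl {m n : Type*} [Fintype m] [Fintype n] [DecidableEq n] (A : Matrix m n ℂ) :
    EuclideanSpace ℂ n →L[ℂ] EuclideanSpace ℂ m :=
  (Matrix.toEuclideanLin A).toContinuousLinearMap

theorem eucl_apply {m n : Type*} [Fintype m] [Fintype n] [DecidableEq n] (A : Matrix m n ℂ)
    (x : EuclideanSpace ℂ n) : eucl A x = WithLp.toLp 2 (A *ᵥ x.ofLp) :=
  Matrix.toLpLin_apply 2 2 A x

theorem eucl_adjoint {m n : Type*} [Fintype m] [Fintype n] [DecidableEq n] [DecidableEq m]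
    (A : Matrix m n ℂ) : (eucl A).adjoint = eucl Aᴴ := by
  symm
  rw [ContinuousLinearMap.eq_adjoint_iff]
  intro x y
  have h := LinearMap.adjoint_inner_left (Matrix.toEuclideanLin A) y x
  rw [← Matrix.toEuclideanLin_conjTranspose_eq_adjoint] at h
  exact h

theorem eucl_isSymmetric {n : Type*} [Fintype n] [DecidableEq n] {A : Matrix n n ℂ}
    (hA : A.IsHermitian) : ((eucl A : EuclideanSpace ℂ n →L[ℂ] EuclideanSpace ℂ n) :
      EuclideanSpace ℂ n →ₗ[ℂ] EuclideanSpace ℂ n).IsSymmetric :=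
  Matrix.isSymmetric_toEuclideanLin_iff.mpr hA

/-! ### Truncation to `G_{0,n}` and eigenfunctions of finite support -/

namespace ShellOperator

open scoped Classical

set_option linter.unusedSectionVars false

variable {G : Type*} (H : ShellOperator G)

theorem formal_eq_sum {n : ℕ} {ψ : G → ℂ} {x : G}
    (h : ∀ y, n < H.shell y → H.ker x y * ψ y = 0) :
    H.formal ψ x = ∑ y : H.Part 0 n, H.ker x y * ψ y := by
  change ∑ᶠ y, H.ker x y * ψ y = _
  rw [← finsum_eq_sum_of_fintype,
    finsum_subtype_eq_finsum_cond (f := fun y => H.ker x y * ψ y)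
      (fun y => 0 ≤ H.shell y ∧ H.shell y ≤ n)]
  refine finsum_congr fun y => ?_
  by_cases hy : H.shell y ≤ n
  · simp [hy]
  · simp [hy, h y (by omega)]

theorem memℓp_of_bounded_shell {n : ℕ} {ψ : G → ℂ} (h : ∀ x, n < H.shell x → ψ x = 0) :
    Memℓp ψ 2 := by
  refine Memℓp.of_exponent_ge (q := 0) ?_ (by simp)
  rw [memℓp_zero_iff]
  have hf : {y : G | 0 ≤ H.shell y ∧ H.shell y ≤ n}.Finite :=
    Set.finite_coe_iff.mp (inferInstanceAs (Finite (H.Part 0 n)))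
  refine hf.subset fun x hx => ⟨Nat.zero_le _, ?_⟩
  by_contra hlt
  exact hx (h x (by omega))

theorem formal_eq_zero_of_shell {n : ℕ} {ψ : G → ℂ} (h : ∀ x, n < H.shell x → ψ x = 0) (x : G)
    (hx : n + 1 < H.shell x) : H.formal ψ x = 0 := by
  rw [H.formal_eq_sum (n := n) (fun y hy => by rw [h y hy, mul_zero])]
  refine Finset.sum_eq_zero fun y _ => ?_
  rw [H.hopping x y (Or.inr (by have := y.2.2; omega)), zero_mul]

theorem mem_domain_of_shell {n : ℕ} {ψ : ℓ²(G, ℂ)} (h : ∀ x, n < H.shell x → ψ x = 0) :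
    ψ ∈ H.natural.domain :=
  H.memℓp_of_bounded_shell (n := n + 1) (H.formal_eq_zero_of_shell h)

theorem natural_apply (ψ : H.natural.domain) (x : G) :
    H.natural ψ x = H.formal (ψ : ℓ²(G, ℂ)) x := rfl

/-- Extension by zero from `G_{0,n}`. -/
def emb (n : ℕ) : EuclideanSpace ℂ (H.Part 0 n) →L[ℂ] ℓ²(G, ℂ) :=
  LinearMap.toContinuousLinearMap
    { toFun := fun f => ⟨fun x => if h : 0 ≤ H.shell x ∧ H.shell x ≤ n then f ⟨x, h⟩ else 0,
        H.memℓp_of_bounded_shell (n := n) fun x hx => by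
          rw [dif_neg (by omega)]⟩
      map_add' := by
        intro f g
        ext x
        rw [lp.coeFn_add, Pi.add_apply]
        by_cases h : H.shell x ≤ n <;> simp [h]
      map_smul' := by
        intro c f
        ext x
        by_cases h : H.shell x ≤ n <;> simp [h] }

theorem emb_apply (n : ℕ) (f : EuclideanSpace ℂ (H.Part 0 n)) (x : G) :
    H.emb n f x = if h : 0 ≤ H.shell x ∧ H.shell x ≤ n then f ⟨x, h⟩ else 0 := rfl

theorem emb_apply_coe (n : ℕ) (f : EuclideanSpace ℂ (H.Part 0 n)) (x : H.Part 0 n) :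
    H.emb n f x = f x := by
  rw [emb_apply, dif_pos x.2]

theorem emb_apply_of_lt (n : ℕ) (f : EuclideanSpace ℂ (H.Part 0 n)) {x : G} (hx : n < H.shell x) :
    H.emb n f x = 0 := by
  rw [emb_apply, dif_neg (by omega)]

/-- Restriction to `G_{0,n}`. -/
def res (n : ℕ) : ℓ²(G, ℂ) →L[ℂ] EuclideanSpace ℂ (H.Part 0 n) := (H.emb n).adjoint

theorem emb_single (n : ℕ) (x : H.Part 0 n) :
    H.emb n (EuclideanSpace.single x 1) = lp.single 2 (x : G) (1 : ℂ) := by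
  ext y
  rw [emb_apply, lp.single_apply]
  by_cases h : (y : G) = x
  · subst h
    rw [dif_pos x.2]
    simp
  · rw [Pi.single_eq_of_ne h]
    split_ifs with h2
    · rw [PiLp.single_apply, if_neg]
      exact fun h3 => h (congrArg Subtype.val h3)
    · rfl

theorem res_apply (n : ℕ) (ψ : ℓ²(G, ℂ)) (x : H.Part 0 n) : H.res n ψ x = ψ x := by
  have h := ContinuousLinearMap.adjoint_inner_right (H.emb n) (EuclideanSpace.single x 1) ψ
  rw [H.emb_single, EuclideanSpace.inner_single_left, lp.inner_single_left] at h
  simpa [res] using h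

theorem res_emb (n : ℕ) (f : EuclideanSpace ℂ (H.Part 0 n)) : H.res n (H.emb n f) = f := by
  ext x
  rw [res_apply, emb_apply_coe]

theorem emb_res {n : ℕ} {ψ : ℓ²(G, ℂ)} (h : ∀ x, n < H.shell x → ψ x = 0) :
    H.emb n (H.res n ψ) = ψ := by
  ext x
  rw [emb_apply]
  split_ifs with hx
  · rw [res_apply]
  · exact (h x (by omega)).symm

theorem inner_emb_left (n : ℕ) (f : EuclideanSpace ℂ (H.Part 0 n)) (ψ : ℓ²(G, ℂ)) :
    inner ℂ (H.emb n f) ψ = inner ℂ f (H.res n ψ) :=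
  (ContinuousLinearMap.adjoint_inner_right (H.emb n) f ψ).symm

theorem norm_emb (n : ℕ) (f : EuclideanSpace ℂ (H.Part 0 n)) : ‖H.emb n f‖ = ‖f‖ := by
  have h := H.inner_emb_left n f (H.emb n f)
  rw [res_emb, inner_self_eq_norm_sq_to_K, inner_self_eq_norm_sq_to_K] at h
  have h2 : ‖H.emb n f‖ ^ 2 = ‖f‖ ^ 2 := by exact_mod_cast h
  exact (sq_eq_sq₀ (norm_nonneg _) (norm_nonneg _)).mp h2

theorem norm_res_le (n : ℕ) (ψ : ℓ²(G, ℂ)) : ‖H.res n ψ‖ ≤ ‖ψ‖ := by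
  have h : ‖H.emb n‖ ≤ 1 := ContinuousLinearMap.opNorm_le_bound _ zero_le_one fun f => by
    rw [norm_emb, one_mul]
  have h2 : ‖H.res n‖ ≤ 1 := by
    rw [res, LinearIsometryEquiv.norm_map]
    exact h
  exact ((H.res n).le_of_opNorm_le h2 ψ).trans (by rw [one_mul])

theorem part_isHermitian (m n : ℕ) : (H.part m n).IsHermitian := by
  ext x y
  have := H.isHermitian.apply x y
  simpa [part] using this

/-- The restriction `H_{0,n}` as an operator on the Euclidean space. -/
def cutOp (n : ℕ) : EuclideanSpace ℂ (H.Part 0 n) →L[ℂ] EuclideanSpace ℂ (H.Part 0 n) :=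
  eucl (H.part 0 n)

theorem cutOp_isSymmetric (n : ℕ) :
    (H.cutOp n : EuclideanSpace ℂ (H.Part 0 n) →ₗ[ℂ] EuclideanSpace ℂ (H.Part 0 n)).IsSymmetric :=
  eucl_isSymmetric (H.part_isHermitian 0 n)

theorem formal_emb (n : ℕ) (f : EuclideanSpace ℂ (H.Part 0 n)) (x : G) :
    H.formal (H.emb n f) x = ∑ y : H.Part 0 n, H.ker x y * f y := by
  rw [H.formal_eq_sum (n := n) fun y hy => by rw [H.emb_apply_of_lt n f hy, mul_zero]]
  exact Finset.sum_congr rfl fun y _ => by rw [emb_apply_coe]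

theorem formal_emb_coe (n : ℕ) (f : EuclideanSpace ℂ (H.Part 0 n)) (x : H.Part 0 n) :
    H.formal (H.emb n f) x = H.cutOp n f x := by
  rw [formal_emb, cutOp, eucl_apply]
  rfl

/-- The eigenfunctions of `H` for the eigenvalue `s` supported in `G_{0,n}`. -/
def eigenIn (n : ℕ) (s : ℝ) : Submodule ℂ ℓ²(G, ℂ) where
  carrier := {ψ | (∀ x, n < H.shell x → ψ x = 0) ∧ H.formal ψ = (s : ℂ) • (ψ : G → ℂ)}
  add_mem' := by
    rintro a b ⟨h1, h2⟩ ⟨h3, h4⟩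
    refine ⟨fun x hx => ?_, ?_⟩
    · rw [lp.coeFn_add, Pi.add_apply, h1 x hx, h3 x hx, add_zero]
    · rw [lp.coeFn_add, map_add, h2, h4, smul_add]
  zero_mem' := by
    refine ⟨fun x _ => rfl, ?_⟩
    rw [lp.coeFn_zero, map_zero, smul_zero]
  smul_mem' := by
    rintro c a ⟨h1, h2⟩
    refine ⟨fun x hx => ?_, ?_⟩
    · rw [lp.coeFn_smul, Pi.smul_apply, h1 x hx, smul_zero]
    · rw [lp.coeFn_smul, map_smul, h2, smul_comm]

theorem mem_eigenIn {n : ℕ} {s : ℝ} {ψ : ℓ²(G, ℂ)} : ψ ∈ H.eigenIn n s ↔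
    (∀ x, n < H.shell x → ψ x = 0) ∧ H.formal ψ = (s : ℂ) • (ψ : G → ℂ) := Iff.rfl

theorem eigenIn_mono (s : ℝ) : Monotone fun n => H.eigenIn n s := by
  intro m n hmn ψ hψ
  exact ⟨fun x hx => hψ.1 x (by omega), hψ.2⟩

theorem iSup_eigenIn (s : ℝ) : ⨆ n, H.eigenIn n s = H.compactEigenspace s := by
  refine le_antisymm (iSup_le fun n ψ hψ => ?_) (Submodule.span_le.mpr ?_)
  · refine Submodule.subset_span ⟨?_, H.mem_domain_of_shell hψ.1, ?_⟩
    · have hf : {y : G | 0 ≤ H.shell y ∧ H.shell y ≤ n}.Finite :=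
        Set.finite_coe_iff.mp (inferInstanceAs (Finite (H.Part 0 n)))
      refine hf.subset fun x hx => ⟨Nat.zero_le _, ?_⟩
      by_contra hlt
      exact hx (hψ.1 x (by omega))
    · ext x
      exact congrFun hψ.2 x
  · rintro ψ ⟨hfin, hdom, heig⟩
    obtain ⟨n, hn⟩ := (hfin.image H.shell).bddAbove
    refine Submodule.mem_iSup_of_mem n ⟨fun x hx => ?_, ?_⟩
    · by_contra h0
      have : H.shell x ≤ n := hn ⟨x, h0, rfl⟩
      omega
    · funext x
      exact congrArg (fun φ : ℓ²(G, ℂ) => φ x) heig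

variable {H} (C : H.Channels)

namespace Channels

/-- `Υ_m` extended by zero to `G_{m,n}`. -/
def colIn (m n : ℕ) : Matrix (H.Part m n) (Fin (H.rk m)) ℂ :=
  fun x j => if h : H.shell x = m then C.Υ m ⟨x, h⟩ j else 0

/-- `Φ_n` extended by zero to `G_{m,n}`. -/
def colOut (m n : ℕ) : Matrix (H.Part m n) (Fin (H.rk (n + 1))) ℂ :=
  fun x j => if h : H.shell x = n then C.Φ n ⟨x, h⟩ j else 0

theorem bdry_eq (m n : ℕ) : C.bdry m n = fromCols (C.colIn m n) (C.colOut m n) := rfl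

/-- The boundary map `Φ̂_n*`. -/
def exitOp (n : ℕ) : EuclideanSpace ℂ (H.Part 0 n) →L[ℂ] EuclideanSpace ℂ (Fin (H.rk (n + 1))) :=
  eucl (C.colOut 0 n)ᴴ

theorem exitOp_apply (n : ℕ) (f : EuclideanSpace ℂ (H.Part 0 n)) (j : Fin (H.rk (n + 1))) :
    C.exitOp n f j = ∑ y : H.Part 0 n, star (C.colOut 0 n y j) * f y := by
  rw [exitOp, eucl_apply]
  rfl

theorem sum_colOut (m n : ℕ) (hmn : m ≤ n) (j : Fin (H.rk (n + 1))) (f : G → ℂ) :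
    ∑ y : H.Part m n, star (C.colOut m n y j) * f y
      = ∑ y : H.Shell n, star (C.Φ n y j) * f y := by
  symm
  refine Fintype.sum_of_injective (fun y : H.Shell n => (⟨y, by have := y.2; omega⟩ : H.Part m n))
    (fun a b hab => Subtype.ext (congrArg (fun z : H.Part m n => (z : G)) hab)) _ _ ?_ ?_
  · intro y hy
    have : H.shell y ≠ n := fun h => hy ⟨⟨y, h⟩, rfl⟩
    simp [colOut, this]
  · intro y
    simp only [colOut]
    rw [dif_pos y.2]

/-- The kernel between a shell and the next one, applied to functions on `G_{m,n}`. -/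
theorem sum_ker_succ {m n : ℕ} (hmn : m ≤ n) {x : G} (hx : H.shell x = n + 1) (f : G → ℂ) :
    ∑ y : H.Part m n, H.ker x y * f y
      = -(C.Υ (n + 1) *ᵥ fun j => ∑ y : H.Part m n, star (C.colOut m n y j) * f y) ⟨x, hx⟩ := by
  have h1 : ∑ y : H.Part m n, H.ker x y * f y = ∑ y : H.Shell n, H.ker x y * f y := by
    symm
    refine Fintype.sum_of_injective (fun y : H.Shell n => (⟨y, by have := y.2; omega⟩ : H.Part m n))
      (fun a b hab => Subtype.ext (congrArg (fun z : H.Part m n => (z : G)) hab)) _ _ ?_ ?_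
    · intro y hy
      have : H.shell y ≠ n := fun h => hy ⟨⟨y, h⟩, rfl⟩
      rw [H.hopping x y (Or.inr (by have := y.2.2; omega)), zero_mul]
    · intro y
      rfl
  have h2 : (H.conn n *ᵥ fun y => f y) ⟨x, hx⟩ = ∑ y : H.Shell n, H.ker x y * f y := rfl
  rw [h1, ← h2, C.factor n, neg_mulVec, Pi.neg_apply, ← mulVec_mulVec]
  congr 2
  have : ((C.Φ n)ᴴ *ᵥ fun y : H.Shell n => f y)
      = fun j => ∑ y : H.Part m n, star (C.colOut m n y j) * f y := by
    funext j
    rw [sum_colOut _ _ _ hmn]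
    rfl
  rw [this]

theorem injective_mulVec_of_rank {m n : Type*} [Fintype m] [Fintype n] {A : Matrix m n ℂ}
    (h : A.rank = Fintype.card n) {x : n → ℂ} (hx : A *ᵥ x = 0) : x = 0 := by
  have hk : LinearMap.ker A.mulVecLin = ⊥ := by
    have h1 := A.mulVecLin.finrank_range_add_finrank_ker
    rw [← Matrix.rank, h, Module.finrank_fintype_fun_eq_card] at h1
    exact Submodule.finrank_eq_zero.mp (by omega)
  exact (LinearMap.ker_eq_bot'.mp hk) x hx

theorem Υ_mulVec_eq_zero {n : ℕ} {x : Fin (H.rk n) → ℂ} (hx : C.Υ n *ᵥ x = 0) : x = 0 :=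
  injective_mulVec_of_rank (by rw [C.rank_Υ, Fintype.card_fin]) hx

theorem formal_emb_succ (n : ℕ) (f : EuclideanSpace ℂ (H.Part 0 n)) {x : G}
    (hx : H.shell x = n + 1) :
    H.formal (H.emb n f) x = -(C.Υ (n + 1) *ᵥ (C.exitOp n f).ofLp) ⟨x, hx⟩ := by
  have h := C.sum_ker_succ (Nat.zero_le n) hx (H.emb n f)
  simp only [emb_apply_coe] at h
  rw [formal_emb, h]
  congr 3

/-- Applied to a function supported in `G_{0,n}`, `H` differs from `H_{0,n}` only on the shell `n +
1`, where it gives `-Υ_{n+1} Φ_n* f`. As `Υ_{n+1}` has full column rank, this vanishes exactly when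
the exit amplitude does. -/
theorem emb_mem_eigenIn {n : ℕ} {s : ℝ} {f : EuclideanSpace ℂ (H.Part 0 n)} :
    H.emb n f ∈ H.eigenIn n s ↔ f ∈ HalfPlane.hidden (H.cutOp n) (C.exitOp n) s := by
  rw [mem_eigenIn, HalfPlane.mem_hidden]
  constructor
  · rintro ⟨-, h⟩
    constructor
    · ext x
      rw [← formal_emb_coe, h, Pi.smul_apply, emb_apply_coe]
      rfl
    · have : C.Υ (n + 1) *ᵥ (C.exitOp n f).ofLp = 0 := by
        funext x
        have h1 := C.formal_emb_succ n f x.2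
        rw [h, Pi.smul_apply, emb_apply_of_lt _ _ _ (by have := x.2; omega), smul_zero] at h1
        rw [Pi.zero_apply, ← neg_eq_zero]
        exact h1.symm
      ext j
      exact congrFun (C.Υ_mulVec_eq_zero this) j
  · rintro ⟨h1, h2⟩
    refine ⟨fun x hx => H.emb_apply_of_lt n f hx, ?_⟩
    funext x
    rw [Pi.smul_apply]
    rcases lt_trichotomy (H.shell x) (n + 1) with hx | hx | hx
    · have h3 := H.formal_emb_coe n f ⟨x, Nat.zero_le _, by omega⟩
      rw [h1] at h3
      rw [h3, emb_apply, dif_pos ⟨Nat.zero_le _, by omega⟩]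
      rfl
    · rw [C.formal_emb_succ n f hx, h2, emb_apply_of_lt _ _ _ (by omega), smul_zero]
      simp
    · rw [H.formal_eq_zero_of_shell (n := n) (fun y hy => H.emb_apply_of_lt n f hy) x (by omega),
        emb_apply_of_lt _ _ _ (by omega), smul_zero]

theorem map_hidden (n : ℕ) (s : ℝ) :
    (HalfPlane.hidden (H.cutOp n) (C.exitOp n) s).map (H.emb n : _ →ₗ[ℂ] ℓ²(G, ℂ))
      = H.eigenIn n s := by
  ext ψ
  constructor
  · rintro ⟨f, hf, rfl⟩
    exact (C.emb_mem_eigenIn).mpr hf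
  · intro hψ
    have h := H.emb_res hψ.1
    refine ⟨H.res n ψ, ?_, h⟩
    rw [SetLike.mem_coe, ← C.emb_mem_eigenIn, h]
    exact hψ

theorem finiteDimensional_eigenIn (C : H.Channels) (n : ℕ) (s : ℝ) : FiniteDimensional ℂ (H.eigenIn n s) := by
  rw [← C.map_hidden]
  infer_instance

theorem norm_starProjection_eigenIn (n : ℕ) (s : ℝ) [(H.eigenIn n s).HasOrthogonalProjection]
    (v : ℓ²(G, ℂ)) :
    ‖(H.eigenIn n s).starProjection v‖
      = ‖(HalfPlane.hidden (H.cutOp n) (C.exitOp n) s).starProjection (H.res n v)‖ := by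
  set U := HalfPlane.hidden (H.cutOp n) (C.exitOp n) s
  have : (H.eigenIn n s).starProjection v = H.emb n (U.starProjection (H.res n v)) := by
    refine Submodule.eq_starProjection_of_mem_of_inner_eq_zero ?_ ?_
    · exact (C.emb_mem_eigenIn).mpr (Submodule.starProjection_apply_mem _ _)
    · intro w hw
      rw [← C.map_hidden] at hw
      obtain ⟨f, hf, rfl⟩ := hw
      have h2 := Submodule.starProjection_inner_eq_zero (K := U) (H.res n v) f hf
      rw [← inner_conj_symm]
      change (starRingEnd ℂ) (inner ℂ (H.emb n f) _) = 0
      rw [inner_emb_left, map_sub, res_emb, inner_conj_symm]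
      exact h2
  rw [this, norm_emb]

end Channels

end ShellOperator

namespace ShellOperator

open scoped Classical

set_option linter.unusedSectionVars false

variable {G : Type*} (H : ShellOperator G)

/-! ### Strong resolvent convergence of the dissipative cut-offs -/

/-- The vector `δ_x`. -/
def stdVec (x : G) : ℓ²(G, ℂ) := lp.single 2 x (1 : ℂ)

theorem stdVec_apply (x y : G) : (stdVec x : ℓ²(G, ℂ)) y = if y = x then 1 else 0 := by
  rw [stdVec, lp.single_apply, Pi.single_apply]

theorem stdVec_shell (x y : G) (h : H.shell x < H.shell y) : (stdVec x : ℓ²(G, ℂ)) y = 0 := by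
  rw [stdVec_apply, if_neg]
  rintro rfl
  omega

theorem formal_stdVec (x y : G) : H.formal (stdVec x : ℓ²(G, ℂ)) y = H.ker y x := by
  change ∑ᶠ z, H.ker y z * (stdVec x : ℓ²(G, ℂ)) z = _
  rw [finsum_eq_single _ x fun z hz => by rw [stdVec_apply, if_neg hz, mul_zero], stdVec_apply]
  simp

/-- `δ_x` as an element of the domain. -/
def stdDom (x : G) : H.natural.domain := ⟨stdVec x, H.mem_domain_of_shell (H.stdVec_shell x)⟩

theorem natural_stdDom_shell (x y : G) (h : H.shell x + 1 < H.shell y) :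
    H.natural (H.stdDom x) y = 0 :=
  H.formal_eq_zero_of_shell (H.stdVec_shell x) y h

/-- `H δ_x` has finite support, so Hermitian symmetry can be used for every `χ` in `ℓ²(G)`, inside
the domain or not. -/
theorem inner_natural_stdDom (x : G) (χ : ℓ²(G, ℂ)) :
    inner ℂ (H.natural (H.stdDom x)) χ = H.formal χ x := by
  have h1 : H.emb (H.shell x + 1) (H.res (H.shell x + 1) (H.natural (H.stdDom x)))
      = H.natural (H.stdDom x) := H.emb_res (H.natural_stdDom_shell x)
  rw [← h1, inner_emb_left, H.formal_eq_sum (n := H.shell x + 1)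
    fun y hy => by rw [H.hopping x y (Or.inl (by omega)), zero_mul], PiLp.inner_apply]
  refine Finset.sum_congr rfl fun y _ => ?_
  rw [res_apply, res_apply, natural_apply]
  change inner ℂ (H.formal (stdVec x : ℓ²(G, ℂ)) y) (χ y) = _
  rw [formal_stdVec, RCLike.inner_apply, ← H.isHermitian.apply x y, mul_comm]
  rfl

/-- A vector orthogonal to this span satisfies `Hχ = -iχ` pointwise. It therefore belongs to the
maximal domain, and a self-adjoint operator has no eigenvalue `-i`. -/
theorem dense_core (hH : IsSelfAdjoint H.natural) :
    (Submodule.span ℂ (Set.range fun x => H.natural (H.stdDom x) - Complex.I • stdVec x)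
      ).topologicalClosure = ⊤ := by
  rw [Submodule.topologicalClosure_eq_top_iff, Submodule.eq_bot_iff]
  intro χ hχ
  rw [Submodule.mem_orthogonal] at hχ
  have h1 : H.formal χ = (-Complex.I) • (χ : G → ℂ) := by
    funext x
    have h := hχ _ (Submodule.subset_span ⟨x, rfl⟩)
    rw [inner_sub_left, inner_natural_stdDom, inner_smul_left, stdVec, lp.inner_single_left,
      sub_eq_zero] at h
    rw [h]
    simp
  have hdom : χ ∈ H.natural.domain := by
    change Memℓp (H.formal χ) 2
    rw [h1]
    exact χ.2.const_smul _
  refine SelfAdjoint.eq_zero_of_eigen hH (z := -Complex.I) (by simp) ⟨χ, hdom⟩ ?_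
  ext x
  exact congrFun h1 x

variable {H}

namespace Channels

variable (C : H.Channels)

/-- The dissipative cut-off `H_{0,n} - i Φ̂_n Φ̂_n*`. -/
def dissOp (n : ℕ) : EuclideanSpace ℂ (H.Part 0 n) →L[ℂ] EuclideanSpace ℂ (H.Part 0 n) :=
  HalfPlane.diss (H.cutOp n) (C.exitOp n)

/-- The dissipative term and `-i` push the imaginary part of `⟨f, (B_n - i) f⟩` in the same
direction; the bound is thus uniform in `n`. -/
theorem norm_le_dissOp (n : ℕ) (f : EuclideanSpace ℂ (H.Part 0 n)) :
    ‖f‖ ≤ ‖C.dissOp n f - Complex.I • f‖ := by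
  have h1 := HalfPlane.inner_diss_sub (F := C.exitOp n) (H.cutOp_isSymmetric n) f
  set y := C.dissOp n f - Complex.I • f with hy
  have h2 : HalfPlane.diss (H.cutOp n) (C.exitOp n) f = y + Complex.I • f := by
    rw [hy, sub_add_cancel]
    rfl
  rw [h2, inner_add_left, inner_add_right, inner_smul_left, inner_smul_right, ← inner_conj_symm y,
    inner_self_eq_norm_sq_to_K] at h1
  have h3 := congrArg Complex.im h1
  simp [-Complex.ofReal_pow, ← Complex.ofReal_pow] at h3
  have h4 := (Complex.abs_im_le_norm _).trans (norm_inner_le_norm (𝕜 := ℂ) f y)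
  have h5 := neg_abs_le (inner ℂ f y).im
  have h6 := sq_nonneg ‖C.exitOp n f‖
  have h7 : (inner ℂ y f).im = -(inner ℂ f y).im := by
    rw [← inner_conj_symm, Complex.conj_im]
  by_contra h
  push Not at h
  nlinarith [norm_nonneg y]

theorem isUnit_dissOp (n : ℕ) : IsUnit (C.dissOp n - algebraMap ℂ _ Complex.I) := by
  refine HalfPlane.isUnit_of_injective fun f hf => ?_
  have h := C.norm_le_dissOp n f
  have h2 : C.dissOp n f - Complex.I • f = 0 := by
    rw [← hf]
    simp [Algebra.algebraMap_eq_smul_one]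
  rw [h2, norm_zero] at h
  exact norm_le_zero_iff.mp h

/-- The resolvent at `i` of the dissipative cut-off. -/
def dissRes (n : ℕ) : EuclideanSpace ℂ (H.Part 0 n) →L[ℂ] EuclideanSpace ℂ (H.Part 0 n) :=
  HalfPlane.shiftInv (C.dissOp n) Complex.I

theorem dissRes_apply (n : ℕ) (f : EuclideanSpace ℂ (H.Part 0 n)) :
    C.dissRes n (C.dissOp n f - Complex.I • f) = f := by
  have h := congrArg (fun X : _ →L[ℂ] _ => X f) 
    (show C.dissRes n * (C.dissOp n - algebraMap ℂ _ Complex.I) = 1 from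
      Ring.inverse_mul_cancel _ (C.isUnit_dissOp n))
  simpa [Algebra.algebraMap_eq_smul_one] using h

theorem norm_dissRes_le (n : ℕ) (f : EuclideanSpace ℂ (H.Part 0 n)) : ‖C.dissRes n f‖ ≤ ‖f‖ := by
  have h := congrArg (fun X : _ →L[ℂ] _ => X f) 
    (show (C.dissOp n - algebraMap ℂ _ Complex.I) * C.dissRes n = 1 from
      Ring.mul_inverse_cancel _ (C.isUnit_dissOp n))
  have h1 : C.dissOp n (C.dissRes n f) - Complex.I • C.dissRes n f = f := by
    simpa [Algebra.algebraMap_eq_smul_one] using h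
  have h2 := C.norm_le_dissOp n (C.dissRes n f)
  rwa [h1] at h2

/-- The resolvent of the dissipative cut-off, as an operator in `ℓ²(G)`. -/
def cutRes (n : ℕ) : ℓ²(G, ℂ) →L[ℂ] ℓ²(G, ℂ) := (H.emb n).comp ((C.dissRes n).comp (H.res n))

theorem norm_cutRes_le (n : ℕ) (φ : ℓ²(G, ℂ)) : ‖C.cutRes n φ‖ ≤ ‖φ‖ := by
  change ‖H.emb n (C.dissRes n (H.res n φ))‖ ≤ _
  rw [norm_emb]
  exact (C.norm_dissRes_le n _).trans (H.norm_res_le n φ)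

/-- For `x` below the last shell, `H δ_x` still lives in `G_{0,n}` and `δ_x` does not touch the
exit, so neither truncation nor dissipation is felt. -/
theorem cutRes_core {n : ℕ} {x : G} (hx : H.shell x < n) :
    C.cutRes n (H.natural (H.stdDom x) - Complex.I • stdVec x) = stdVec x := by
  have hs : H.emb n (H.res n (stdVec x)) = stdVec x :=
    H.emb_res fun y hy => H.stdVec_shell x y (by omega)
  have hF : C.exitOp n (H.res n (stdVec x)) = 0 := by
    ext j
    rw [exitOp_apply]
    refine Finset.sum_eq_zero fun y _ => ?_
    rw [res_apply, stdVec_apply]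
    split_ifs with h
    · have : H.shell y ≠ n := by rw [h]; omega
      simp [colOut, this]
    · rw [mul_zero]
  have hS : H.cutOp n (H.res n (stdVec x)) = H.res n (H.natural (H.stdDom x)) := by
    ext y
    rw [← formal_emb_coe, hs, res_apply]
    rfl
  have hM : C.dissOp n (H.res n (stdVec x)) - Complex.I • H.res n (stdVec x)
      = H.res n (H.natural (H.stdDom x) - Complex.I • stdVec x) := by
    rw [dissOp, HalfPlane.diss_apply, hF, hS, map_sub, map_smul]
    simp
  change H.emb n (C.dissRes n (H.res n _)) = _
  rw [← hM, dissRes_apply, hs]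

/-- Eventual equality on a dense subspace together with the uniform contraction bound. -/
theorem tendsto_cutRes (hH : IsSelfAdjoint H.natural) {R : ℓ²(G, ℂ) →L[ℂ] ℓ²(G, ℂ)}
    (hR : IsResolventAt H.natural Complex.I R) (φ : ℓ²(G, ℂ)) :
    Tendsto (fun n => C.cutRes n φ) atTop (𝓝 (R φ)) := by
  set D := Submodule.span ℂ (Set.range fun x => H.natural (H.stdDom x) - Complex.I • stdVec x)
  have hD : ∀ φ ∈ D, ∀ᶠ n in atTop, C.cutRes n φ = R φ := by
    intro φ hφ
    induction hφ using Submodule.span_induction with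
    | mem y hy =>
      obtain ⟨x, rfl⟩ := hy
      filter_upwards [eventually_gt_atTop (H.shell x)] with n hn
      rw [C.cutRes_core hn]
      exact (hR.2 (H.stdDom x)).symm
    | zero => simp
    | add a b _ _ ha hb =>
      filter_upwards [ha, hb] with n h1 h2
      rw [map_add, map_add, h1, h2]
    | smul c a _ ha =>
      filter_upwards [ha] with n h1
      rw [map_smul, map_smul, h1]
  rw [Metric.tendsto_atTop]
  intro ε hε
  have hmem : φ ∈ D.topologicalClosure := by
    rw [H.dense_core hH]
    trivial
  have hK : 0 < ‖R‖ + 2 := by positivity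
  -- The difference of the two operators has norm at most `1 + ‖R‖`; the extra `1` in the
  -- denominator is slack.
  obtain ⟨ψ, hψ, hdist⟩ := Metric.mem_closure_iff.mp hmem (ε / (‖R‖ + 2)) (by positivity)
  obtain ⟨N, hN⟩ := eventually_atTop.mp (hD ψ hψ)
  refine ⟨N, fun n hn => ?_⟩
  rw [dist_eq_norm] at hdist ⊢
  have e : C.cutRes n φ - R φ = C.cutRes n (φ - ψ) - R (φ - ψ) := by
    rw [map_sub, map_sub, hN n hn]
    abel
  rw [e]
  refine (norm_sub_le _ _).trans_lt ?_
  have h1 := C.norm_cutRes_le n (φ - ψ)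
  have h2 := R.le_opNorm (φ - ψ)
  rw [lt_div_iff₀ hK] at hdist
  nlinarith [norm_nonneg (φ - ψ)]

theorem tendsto_dissRes_pow (hH : IsSelfAdjoint H.natural) {R : ℓ²(G, ℂ) →L[ℂ] ℓ²(G, ℂ)}
    (hR : IsResolventAt H.natural Complex.I R) {v : ℓ²(G, ℂ)}
    (hv : ∀ x, 0 < H.shell x → v x = 0) (j : ℕ) :
    Tendsto (fun n => H.emb n ((C.dissRes n ^ j) (H.res n v))) atTop (𝓝 ((R ^ j) v)) := by
  induction j with
  | zero =>
    refine tendsto_const_nhds.congr fun n => ?_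
    rw [pow_zero, pow_zero]
    exact (H.emb_res fun x hx => hv x (by omega)).symm
  | succ j ih =>
    have h1 := C.tendsto_cutRes hH hR ((R ^ j) v)
    have e : ∀ n, H.emb n ((C.dissRes n ^ (j + 1)) (H.res n v))
        = C.cutRes n (H.emb n ((C.dissRes n ^ j) (H.res n v)) - (R ^ j) v)
          + C.cutRes n ((R ^ j) v) := by
      intro n
      rw [map_sub, sub_add_cancel, pow_succ', mul_apply_eq_comp]
      change _ = H.emb n (C.dissRes n (H.res n (H.emb n _)))
      rw [res_emb]
    simp_rw [e]
    have h2 : Tendsto (fun n => C.cutRes n (H.emb n ((C.dissRes n ^ j) (H.res n v)) - (R ^ j) v))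
        atTop (𝓝 0) := by
      refine squeeze_zero_norm (fun n => C.norm_cutRes_le n _) ?_
      simpa using (tendsto_sub_nhds_zero_iff.mpr ih).norm
    have h3 := h2.add h1
    rwa [zero_add, ← mul_apply_eq_comp, ← pow_succ'] at h3

theorem tendsto_inner_dissRes (hH : IsSelfAdjoint H.natural) {R : ℓ²(G, ℂ) →L[ℂ] ℓ²(G, ℂ)}
    (hR : IsResolventAt H.natural Complex.I R) {v : ℓ²(G, ℂ)}
    (hv : ∀ x, 0 < H.shell x → v x = 0) (j : ℕ) :
    Tendsto (fun n => inner ℂ (H.res n v) ((C.dissRes n ^ j) (H.res n v))) atTop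
      (𝓝 (inner ℂ v ((R ^ j) v))) := by
  have h := (tendsto_const_nhds (x := v)).inner (𝕜 := ℂ) (C.tendsto_dissRes_pow hH hR hv j)
  refine h.congr fun n => ?_
  rw [← inner_conj_symm, inner_emb_left, inner_conj_symm]

end Channels

end ShellOperator

/-! ### Splitting off the point part of a weak limit -/

/-- The measure with point masses `w t`. -/
def pointMeasure (w : ℝ → ℝ) : Measure ℝ :=
  Measure.sum fun t : ℝ => ENNReal.ofReal (w t) • Measure.dirac t

namespace pointMeasure

variable {w : ℝ → ℝ}

theorem apply {s : Set ℝ} (hs : MeasurableSet s) :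
    pointMeasure w s = ∑' t, s.indicator (fun t => ENNReal.ofReal (w t)) t := by
  rw [pointMeasure, Measure.sum_apply _ hs]
  refine tsum_congr fun t => ?_
  rw [Measure.smul_apply, Measure.dirac_apply' _ hs, smul_eq_mul]
  by_cases h : t ∈ s <;> simp [h]

theorem le_of_singleton {μ : Measure ℝ} (h : ∀ t, ENNReal.ofReal (w t) ≤ μ {t}) :
    pointMeasure w ≤ μ := by
  rw [Measure.le_iff]
  intro s hs
  rw [apply hs, ENNReal.tsum_eq_iSup_sum]
  refine iSup_le fun F => ?_
  classical
  rw [Finset.sum_indicator_eq_sum_filter]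
  calc ∑ t ∈ F with t ∈ s, ENNReal.ofReal (w t) ≤ ∑ t ∈ F with t ∈ s, μ {t} :=
        Finset.sum_le_sum fun t _ => h t
    _ = μ ((F.filter fun t => t ∈ s : Finset ℝ) : Set ℝ) := sum_measure_singleton
    _ ≤ μ s := measure_mono fun t ht => by
        simp only [Finset.coe_filter, Set.mem_ofPred_eq] at ht
        exact ht.2

theorem isFiniteMeasure (h0 : ∀ t, 0 ≤ w t) (hw : Summable w) : IsFiniteMeasure (pointMeasure w) := by
  refine ⟨?_⟩
  rw [apply MeasurableSet.univ]
  simp only [Set.indicator_univ]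
  rw [← ENNReal.ofReal_tsum_of_nonneg h0 hw]
  exact ENNReal.ofReal_lt_top

theorem summable (h0 : ∀ t, 0 ≤ w t) [IsFiniteMeasure (pointMeasure w)] : Summable w := by
  have h := measure_ne_top (pointMeasure w) Set.univ
  rw [apply MeasurableSet.univ] at h
  simp only [Set.indicator_univ] at h
  refine (ENNReal.summable_toReal h).congr fun t => ?_
  rw [ENNReal.toReal_ofReal (h0 t)]

theorem hasSum_integral {E : Type*} [NormedAddCommGroup E] [NormedSpace ℝ E] [CompleteSpace E]
    (h0 : ∀ t, 0 ≤ w t) {f : ℝ → E} (hf : Integrable f (pointMeasure w)) :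
    HasSum (fun t => w t • f t) (∫ t, f t ∂(pointMeasure w)) := by
  have h := hasSum_integral_measure hf
  simp only [integral_smul_measure, integral_dirac, ENNReal.toReal_ofReal (h0 _)] at h
  exact h

end pointMeasure

theorem integral_lineMeasure {E : Type*} [NormedAddCommGroup E] [NormedSpace ℝ E] {g : ℝ → ℝ}
    (hg : Measurable g) (h0 : ∀ t, 0 ≤ g t) (f : ℝ → E) :
    ∫ t, f t ∂(lineMeasure g) = ∫ t, g t • f t := by
  rw [lineMeasure, integral_withDensity_eq_integral_toReal_smul (by fun_prop) (by simp)]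
  simp only [ENNReal.toReal_ofReal (h0 _)]

theorem isFiniteMeasure_lineMeasure {g : ℝ → ℝ} (hg : Integrable g) :
    IsFiniteMeasure (lineMeasure g) :=
  isFiniteMeasure_withDensity_ofReal hg.2

/-- The functions `(1 + (k (s - t))²)⁻¹` concentrating at `t`. -/
def bump (t : ℝ) (k : ℕ) : ℝ →ᵇ ℝ :=
  BoundedContinuousFunction.ofNormedAddCommGroup (fun s => (1 + (k * (s - t)) ^ 2)⁻¹)
    (Continuous.inv₀ (by fun_prop) fun s => by positivity) 1 (fun s => by
      rw [Real.norm_of_nonneg (by positivity)]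
      exact inv_le_one_of_one_le₀ (by nlinarith [sq_nonneg (k * (s - t))]))

theorem bump_apply (t : ℝ) (k : ℕ) (s : ℝ) : bump t k s = (1 + (k * (s - t)) ^ 2)⁻¹ := rfl

theorem bump_nonneg (t : ℝ) (k : ℕ) (s : ℝ) : 0 ≤ bump t k s := by
  rw [bump_apply]; positivity

theorem bump_le_one (t : ℝ) (k : ℕ) (s : ℝ) : bump t k s ≤ 1 := by
  rw [bump_apply]
  exact inv_le_one_of_one_le₀ (by nlinarith [sq_nonneg (k * (s - t))])

theorem tendsto_integral_bump (μ : Measure ℝ) [IsFiniteMeasure μ] (t : ℝ) :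
    Tendsto (fun k => ∫ s, bump t k s ∂μ) atTop (𝓝 (μ.real {t})) := by
  have h : ∫ s, ({t} : Set ℝ).indicator 1 s ∂μ = μ.real {t} :=
    integral_indicator_one (measurableSet_singleton t)
  rw [← h]
  refine tendsto_integral_of_dominated_convergence (fun _ => 1)
    (fun k => (bump t k).continuous.aestronglyMeasurable) (integrable_const _)
    (fun k => .of_forall fun s => ?_) (.of_forall fun s => ?_)
  · rw [Real.norm_of_nonneg (bump_nonneg t k s)]
    exact bump_le_one t k s
  · by_cases hs : s = t
    · subst hs
      simp [bump_apply]
    · rw [Set.indicator_of_notMem (by simpa using hs)]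
      have hpos : 0 < (s - t) ^ 2 := by
        have := sub_ne_zero.mpr hs
        positivity
      have h1 : Tendsto (fun k : ℕ => ((k : ℝ) * (s - t)) ^ 2) atTop atTop := by
        simp_rw [mul_pow]
        exact ((tendsto_pow_atTop two_ne_zero).comp tendsto_natCast_atTop_atTop).atTop_mul_const hpos
      exact tendsto_inv_atTop_zero.comp (tendsto_atTop_add_const_left _ _ h1)

/-- Testing against a bump of height one at `t` gives `μ {t} ≥ ω t`, so `pointMeasure ω ≤ μ` and the
difference is a genuine measure. The point parts converge by dominated convergence, as `w n ≤ ω`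
with `ω` summable. -/
theorem weakLim_sub_point {gs : ℕ → ℝ → ℝ} (hgi : ∀ n, Integrable (gs n)) {w : ℕ → ℝ → ℝ} {ω : ℝ → ℝ}
    (hw0 : ∀ n t, 0 ≤ w n t) (hws : ∀ n, Summable (w n)) (hwω : ∀ n t, w n t ≤ ω t)
    (hlim : ∀ t, Tendsto (fun n => w n t) atTop (𝓝 (ω t))) {μ : Measure ℝ} [IsFiniteMeasure μ]
    (h : ∀ f : ℝ →ᵇ ℝ, Tendsto (fun n => ∫ t, f t ∂(lineMeasure (gs n) + pointMeasure (w n))) atTop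
      (𝓝 (∫ t, f t ∂μ))) :
    ∃ ρ, μ = pointMeasure ω + ρ ∧ WeakLim (fun n => lineMeasure (gs n)) ρ := by
  have hfl := fun n => isFiniteMeasure_lineMeasure (hgi n)
  have hfp := fun n => pointMeasure.isFiniteMeasure (hw0 n) (hws n)
  have hω0 : ∀ t, 0 ≤ ω t := fun t => (hw0 0 t).trans (hwω 0 t)
  have hle : pointMeasure ω ≤ μ := by
    refine pointMeasure.le_of_singleton fun t => ?_
    rw [← ENNReal.ofReal_toReal (measure_ne_top μ {t})]
    refine ENNReal.ofReal_le_ofReal ?_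
    refine ge_of_tendsto' (tendsto_integral_bump μ t) fun k => ?_
    refine le_of_tendsto_of_tendsto' (hlim t) (h (bump t k)) fun n => ?_
    have h1 := pointMeasure.hasSum_integral (hw0 n) ((bump t k).integrable (pointMeasure (w n)))
    have h2 := le_hasSum h1 t fun s _ => smul_nonneg (hw0 n s) (bump_nonneg t k s)
    have h3 : w n t • bump t k t = w n t := by simp [bump_apply]
    rw [integral_add_measure ((bump t k).integrable _) ((bump t k).integrable _)]
    have h4 : 0 ≤ ∫ s, bump t k s ∂(lineMeasure (gs n)) :=
      integral_nonneg fun s => bump_nonneg t k s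
    linarith
  have hfω : IsFiniteMeasure (pointMeasure ω) := isFiniteMeasure_of_le μ hle
  have hωs := pointMeasure.summable hω0
  have hsub := Measure.sub_add_cancel_of_le hle
  have hρ : IsFiniteMeasure (μ - pointMeasure ω) := isFiniteMeasure_of_le μ Measure.sub_le
  refine ⟨μ - pointMeasure ω, by rw [add_comm, hsub], hfl, hρ, fun f => ?_⟩
  have hν : Tendsto (fun n => ∫ t, f t ∂(pointMeasure (w n))) atTop
      (𝓝 (∫ t, f t ∂(pointMeasure ω))) := by
    rw [← (pointMeasure.hasSum_integral hω0 (f.integrable (pointMeasure ω))).tsum_eq]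
    have e : ∀ n, ∫ t, f t ∂(pointMeasure (w n)) = ∑' t, w n t • f t := fun n =>
      (pointMeasure.hasSum_integral (hw0 n) (f.integrable (pointMeasure (w n)))).tsum_eq.symm
    simp_rw [e]
    refine tendsto_tsum_of_dominated_convergence (hωs.mul_right ‖f‖)
      (fun t => (hlim t).smul_const _) (.of_forall fun n t => ?_)
    rw [norm_smul, Real.norm_of_nonneg (hw0 n t)]
    exact mul_le_mul (hwω n t) (f.norm_coe_le_norm t) (norm_nonneg _) (hω0 t)
  have e1 : ∫ t, f t ∂(μ - pointMeasure ω) = ∫ t, f t ∂μ - ∫ t, f t ∂(pointMeasure ω) := by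
    conv_rhs => rw [← hsub]
    rw [integral_add_measure (f.integrable _) (f.integrable _), add_sub_cancel_right]
  rw [e1]
  refine ((h f).sub hν).congr fun n => ?_
  rw [integral_add_measure (f.integrable _) (f.integrable _), add_sub_cancel_right]

/-! ### Spectral measures of the cut-offs at the root vector, and their limit -/

namespace ShellOperator

open scoped Classical

set_option linter.unusedSectionVars false

variable {G : Type*} {H : ShellOperator G}

/-- The real points at which `H_{m,n} - t` is not invertible. -/
def specSet (H : ShellOperator G) (m n : ℕ) : Set ℝ :=
  {t | ¬ IsUnit (H.part m n - (t : ℂ) • 1)}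

theorem finite_specSet (m n : ℕ) : (H.specSet m n).Finite := by
  refine Set.Finite.subset ((Matrix.finite_spectrum (H.part m n)).preimage
    (f := fun t : ℝ => (t : ℂ)) Complex.ofReal_injective.injOn) fun t ht => ?_
  change (t : ℂ) ∈ spectrum ℂ _
  rw [spectrum.mem_iff, Algebra.algebraMap_eq_smul_one, ← neg_sub, IsUnit.neg_iff]
  exact ht

namespace Channels

variable (C : H.Channels)

/-- The real eigenvalues of `H_{0,n}`. -/
def realSpec (H : ShellOperator G) (n : ℕ) : Finset ℝ := (finite_specSet (H := H) 0 n).toFinset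

theorem mem_specSet_of_eigen {m n : ℕ} {t : ℝ} {f : H.Part m n → ℂ} (hf : f ≠ 0)
    (h : H.part m n *ᵥ f = (t : ℂ) • f) : t ∈ H.specSet m n := by
  intro hu
  refine hf ?_
  have h1 : (H.part m n - (t : ℂ) • 1) *ᵥ f = 0 := by
    rw [sub_mulVec, h, smul_mulVec, one_mulVec, sub_self]
  have h2 := congrArg (fun y => (H.part m n - (t : ℂ) • 1)⁻¹ *ᵥ y) h1
  simp only [mulVec_mulVec, mulVec_zero] at h2
  rwa [Matrix.nonsing_inv_mul _ ((Matrix.isUnit_iff_isUnit_det _).mp hu), one_mulVec] at h2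

theorem hidden_realSpec (n : ℕ) (s : ℝ)
    (h : HalfPlane.hidden (H.cutOp n) (C.exitOp n) s ≠ ⊥) : s ∈ realSpec H n := by
  obtain ⟨f, hf, hne⟩ := Submodule.exists_mem_ne_zero_of_ne_bot h
  rw [realSpec, Set.Finite.mem_toFinset]
  refine mem_specSet_of_eigen (f := f.ofLp) (fun h0 => hne ?_) ?_
  · ext x
    exact congrFun h0 x
  · have := hf.1
    rw [cutOp, eucl_apply] at this
    exact congrArg WithLp.ofLp this

theorem root_apply (x : G) :
    C.root x = if h : H.shell x = 0 then (C.Υ 0 *ᵥ 1) ⟨x, h⟩ else 0 := by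
  rw [root, lp.coeFn_sum, Finset.sum_apply]
  split_ifs with h
  · rw [Finset.sum_eq_single (⟨x, h⟩ : H.Shell 0)]
    · rw [lp.single_apply, Pi.single_eq_same]
    · intro y _ hy
      rw [lp.single_apply, Pi.single_eq_of_ne]
      exact fun h2 => hy (Subtype.ext h2.symm)
    · simp
  · refine Finset.sum_eq_zero fun y _ => ?_
    rw [lp.single_apply, Pi.single_eq_of_ne]
    rintro rfl
    exact h y.2

theorem root_shell (x : G) (hx : 0 < H.shell x) : C.root x = 0 := by
  rw [root_apply, dif_neg (by omega)]

/-- The density of the dissipative cut-off at the root vector. -/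
def cutDensity (n : ℕ) : ℝ → ℝ :=
  HalfPlane.acDensity (H.cutOp n) (C.exitOp n) (realSpec H n) (H.res n C.root)

/-- The point masses of the dissipative cut-off at the root vector. -/
def cutWeight (n : ℕ) (t : ℝ) : ℝ :=
  ‖(HalfPlane.hidden (H.cutOp n) (C.exitOp n) t).starProjection (H.res n C.root)‖ ^ 2

theorem integrable_cutDensity (n : ℕ) : Integrable (C.cutDensity n) := by
  have h := (HalfPlane.acDensity_moment (H.cutOp_isSymmetric n) (C.hidden_realSpec n)
    (H.res n C.root) 0).1
  simp only [pow_zero, one_mul] at h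
  have h2 := h.re
  simp only [RCLike.re_to_complex, Complex.ofReal_re] at h2
  exact h2

theorem cutWeight_eq_zero {n : ℕ} {t : ℝ} (h : t ∉ realSpec H n) : C.cutWeight n t = 0 := by
  have : HalfPlane.hidden (H.cutOp n) (C.exitOp n) t = ⊥ := by
    by_contra h2
    exact h (C.hidden_realSpec n t h2)
  rw [cutWeight]
  simp [this]

theorem summable_cutWeight (n : ℕ) : Summable (C.cutWeight n) :=
  summable_of_ne_finset_zero (s := realSpec H n) fun _ ht => C.cutWeight_eq_zero ht

theorem cutWeight_nonneg (n : ℕ) (t : ℝ) : 0 ≤ C.cutWeight n t := by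
  unfold cutWeight; positivity

theorem integral_cut (n j : ℕ) :
    ∫ t, ResolventMoments.cay t ^ j ∂(lineMeasure (C.cutDensity n) + pointMeasure (C.cutWeight n))
      = inner ℂ (H.res n C.root) ((C.dissRes n ^ j) (H.res n C.root)) := by
  have hf1 := isFiniteMeasure_lineMeasure (C.integrable_cutDensity n)
  have hf2 := pointMeasure.isFiniteMeasure (C.cutWeight_nonneg n) (C.summable_cutWeight n)
  have hint : ∀ (μ : Measure ℝ) [IsFiniteMeasure μ],
      Integrable (fun t => ResolventMoments.cay t ^ j) μ := fun μ _ =>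
    Integrable.of_bound (C := 1) (ResolventMoments.continuous_cay.pow j).aestronglyMeasurable
      (.of_forall fun t => by
        rw [norm_pow]
        exact pow_le_one₀ (norm_nonneg _) (ResolventMoments.circ_norm_le (ResolventMoments.cay_mem t)))
  rw [integral_add_measure (hint _) (hint _), ← HalfPlane.moment_diss (H.cutOp_isSymmetric n)
    (C.hidden_realSpec n) (C.dissRes_apply n) (H.res n C.root) j]
  congr 1
  · rw [cutDensity, integral_lineMeasure (HalfPlane.continuous_acDensity (H.cutOp_isSymmetric n)
      (C.hidden_realSpec n) _).measurable (HalfPlane.acDensity_nonneg _)]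
    refine integral_congr_ae (.of_forall fun t => ?_)
    simp only [Complex.real_smul]
    rw [mul_comm]
    rfl
  · have h := pointMeasure.hasSum_integral (C.cutWeight_nonneg n) (hint (pointMeasure (C.cutWeight n)))
    rw [← h.tsum_eq, tsum_eq_sum (s := realSpec H n) fun t ht => by
      rw [C.cutWeight_eq_zero ht, zero_smul]]
    refine Finset.sum_congr rfl fun t _ => ?_
    rw [Complex.real_smul, mul_comm, cutWeight]
    push_cast
    rfl

/-- The mass at `t` generated by the eigenfunctions with finite support. -/
def limWeight (t : ℝ) : ℝ :=
  ‖(H.compactEigenspace t).topologicalClosure.starProjection C.root‖ ^ 2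

theorem compactEigenMeasure_eq : H.compactEigenMeasure C.root = pointMeasure C.limWeight := rfl

theorem norm_starProjection_mono {E : Type*} [NormedAddCommGroup E] [InnerProductSpace ℂ E]
    {U K : Submodule ℂ E} [U.HasOrthogonalProjection] [K.HasOrthogonalProjection] (h : U ≤ K)
    (v : E) : ‖U.starProjection v‖ ≤ ‖K.starProjection v‖ := by
  have h1 : U.starProjection v = U.starProjection (K.starProjection v) := by
    rw [← sub_eq_zero, ← map_sub, Submodule.starProjection_apply_eq_zero_iff,
      Submodule.mem_orthogonal']
    exact fun u hu => Submodule.starProjection_inner_eq_zero (K := K) v u (h hu)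
  rw [h1]
  exact Submodule.norm_starProjection_apply_le _ _

theorem cutWeight_le (n : ℕ) (t : ℝ) : C.cutWeight n t ≤ C.limWeight t := by
  have := C.finiteDimensional_eigenIn n t
  rw [cutWeight, ← norm_starProjection_eigenIn, limWeight]
  refine pow_le_pow_left₀ (norm_nonneg _) (norm_starProjection_mono ?_ _) 2
  refine le_trans ?_ (Submodule.le_topologicalClosure _)
  rw [← H.iSup_eigenIn]
  exact le_iSup (fun n => H.eigenIn n t) n

/-- The spaces `eigenIn n t` increase with `n`, so their projections converge strongly to the
projection onto the closure of the union. -/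
theorem tendsto_cutWeight (t : ℝ) :
    Tendsto (fun n => C.cutWeight n t) atTop (𝓝 (C.limWeight t)) := by
  have := fun n => C.finiteDimensional_eigenIn n t
  have h := Submodule.starProjection_tendsto_closure_iSup (fun n => H.eigenIn n t)
    (H.eigenIn_mono t) C.root
  have h2 := (h.norm).pow 2
  simp only [norm_starProjection_eigenIn C] at h2
  simp only [H.iSup_eigenIn t] at h2
  exact h2

/-- The spectral measure at the root vector and the decomposition of its approximations. -/
theorem exists_spectral_decomposition (hH : IsSelfAdjoint H.natural) :
    ∃ μ ρ : Measure ℝ, (∀ μ' : Measure ℝ, IsSpectralMeasure H.natural C.root μ' ↔ μ' = μ) ∧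
      μ = H.compactEigenMeasure C.root + ρ ∧
      WeakLim (fun n => lineMeasure (C.cutDensity n)) ρ := by
  have hR := SelfAdjoint.resolventAt_spec hH (z := Complex.I) (by simp)
  set R := resolventAt H.natural Complex.I with hRdef
  -- The root vector has finite support, hence lies in the domain and equals `R φ`, as
  -- `exists_spectral_measure` demands.
  have hdom : C.root ∈ H.natural.domain := H.mem_domain_of_shell C.root_shell
  set φ := H.natural ⟨C.root, hdom⟩ - Complex.I • C.root with hφ
  have hRφ : R φ = C.root := hR.2 ⟨C.root, hdom⟩
  obtain ⟨μ, hfin, h1, h2⟩ := ResolventMoments.exists_spectral_measure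
    (SelfAdjoint.isStarNormal_resolvent hH hR) (SelfAdjoint.resolvent_sub_star hH hR).1 φ
  rw [hRφ] at h1 h2
  have hf1 := fun n => isFiniteMeasure_lineMeasure (C.integrable_cutDensity n)
  have hf2 := fun n => pointMeasure.isFiniteMeasure (C.cutWeight_nonneg n) (C.summable_cutWeight n)
  have hconv := ResolventMoments.tendsto_integral_of_moments (μ := μ)
    (μs := fun n => lineMeasure (C.cutDensity n) + pointMeasure (C.cutWeight n)) (fun j => by
      rw [h2 j]
      simp_rw [C.integral_cut]
      exact C.tendsto_inner_dissRes hH hR C.root_shell j)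
  obtain ⟨ρ, hρ1, hρ2⟩ := weakLim_sub_point C.integrable_cutDensity C.cutWeight_nonneg
    C.summable_cutWeight C.cutWeight_le C.tendsto_cutWeight hconv
  refine ⟨μ, ρ, fun μ' => ⟨fun h => ?_, ?_⟩, hρ1, hρ2⟩
  · have := h.1
    refine ResolventMoments.ext_of_integral_zeroAtInfty fun f => ?_
    rw [h.2, h1]
    rfl
  · rintro rfl
    exact ⟨hfin, fun f => h1 f⟩

end Channels

end ShellOperator

namespace ShellOperator

open scoped Classical

set_option linter.unusedSectionVars false

variable {G : Type*} {H : ShellOperator G}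

namespace Channels

variable (C : H.Channels)

/-! ### The support of the point part -/

theorem rawData_eq (m n : ℕ) (z : ℂ) : C.rawData m n z = fromBlocks
    ((C.colIn m n)ᴴ * (H.part m n - z • 1)⁻¹ * C.colIn m n)
    ((C.colIn m n)ᴴ * (H.part m n - z • 1)⁻¹ * C.colOut m n)
    ((C.colOut m n)ᴴ * (H.part m n - z • 1)⁻¹ * C.colIn m n)
    ((C.colOut m n)ᴴ * (H.part m n - z • 1)⁻¹ * C.colOut m n) := by
  rw [rawData, bdry_eq, conjTranspose_fromCols_eq_fromRows_conjTranspose, fromRows_mul,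
    fromRows_mul_fromCols]

theorem res_root (n : ℕ) : (H.res n C.root).ofLp = C.colIn 0 n *ᵥ 1 := by
  funext x
  rw [res_apply, root_apply]
  simp only [mulVec, dotProduct, colIn]
  split_ifs with h <;> simp

theorem inner_cutOp_sub (n : ℕ) (z : ℂ) (y : EuclideanSpace ℂ (H.Part 0 n)) :
    (inner ℂ (H.cutOp n y - z • y) y : ℂ).im = z.im * ‖y‖ ^ 2 := by
  have h1 : (inner ℂ (H.cutOp n y) y : ℂ).im = 0 :=
    (H.cutOp_isSymmetric n).im_inner_apply_self y
  rw [inner_sub_left, inner_smul_left, inner_self_eq_norm_sq_to_K, Complex.sub_im, h1]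
  simp [Complex.mul_im, ← Complex.ofReal_pow]

theorem isUnit_part_sub (n : ℕ) {z : ℂ} (hz : z.im ≠ 0) : IsUnit (H.part 0 n - z • 1) := by
  rw [← Matrix.mulVec_injective_iff_isUnit]
  refine (injective_iff_map_eq_zero ((H.part 0 n - z • 1).mulVecLin)).mpr fun f hf => ?_
  have h := inner_cutOp_sub (H := H) n z (WithLp.toLp 2 f)
  have h0 : H.cutOp n (WithLp.toLp 2 f) - z • WithLp.toLp 2 f = 0 := by
    rw [cutOp, eucl_apply, ← WithLp.toLp_smul, ← WithLp.toLp_sub, ← WithLp.toLp_zero 2]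
    congr 1
    simpa [sub_mulVec, smul_mulVec] using hf
  rw [h0, inner_zero_left, Complex.zero_im, eq_comm, mul_eq_zero, or_iff_right hz] at h
  simpa using h

/-- The diagonal matrix element of the resolvent of `H_{0,n}` at the root vector. -/
theorem sum_rawData (n : ℕ) (z : ℂ) :
    ∑ i, ∑ j, C.rawData 0 n z (Sum.inl i) (Sum.inl j)
      = inner ℂ (H.res n C.root) (eucl (H.part 0 n - z • 1)⁻¹ (H.res n C.root)) := by
  have h : ∑ i, ∑ j, C.rawData 0 n z (Sum.inl i) (Sum.inl j)
      = star (1 : Fin (H.rk 0) → ℂ) ⬝ᵥ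
        (((C.colIn 0 n)ᴴ * (H.part 0 n - z • 1)⁻¹ * C.colIn 0 n) *ᵥ 1) := by
    simp only [rawData_eq, fromBlocks_apply₁₁, dotProduct, mulVec, Pi.star_apply, Pi.one_apply,
      star_one, one_mul, mul_one]
  rw [h, EuclideanSpace.inner_eq_star_dotProduct, eucl_apply, C.res_root, dotProduct_comm,
    ← mulVec_mulVec, ← mulVec_mulVec, star_one, dotProduct_comm, dotProduct_mulVec 1,
    dotProduct_comm (_ *ᵥ _), star_mulVec, star_one]

/-- A hidden eigenvector overlapping with the root vector `v` makes `⟨v, (H_{0,n} - z)⁻¹ v⟩` grow at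
least like `‖e‖² / ε` at `z = t + iε`. This number is the sum of the entries of the `α` block, which
an analytic extension would keep bounded. -/
theorem mem_singSet_of_cutWeight_ne_zero {n : ℕ} {t : ℝ} (h : C.cutWeight n t ≠ 0) :
    t ∈ C.singSet 0 n := by
  rintro ⟨F, hF, hFe⟩
  set v := H.res n C.root with hv
  set e := (HalfPlane.hidden (H.cutOp n) (C.exitOp n) t).starProjection v with he
  have hemem : e ∈ HalfPlane.hidden (H.cutOp n) (C.exitOp n) t :=
    Submodule.starProjection_apply_mem _ _
  have heig : H.cutOp n e = (t : ℂ) • e := hemem.1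
  have hene : 0 < ‖e‖ := by
    rw [norm_pos_iff]
    intro h0
    apply h
    rw [cutWeight, ← hv, ← he, h0]
    simp
  have hev : inner ℂ e v = (‖e‖ ^ 2 : ℂ) := by
    have h1 := Submodule.starProjection_inner_eq_zero
      (K := HalfPlane.hidden (H.cutOp n) (C.exitOp n) t) v e hemem
    rw [← he, inner_sub_left, sub_eq_zero] at h1
    rw [← inner_conj_symm, h1, inner_conj_symm, inner_self_eq_norm_sq_to_K]
    rfl
  set f : ℂ → ℂ := fun z => ∑ i, ∑ j, F z (Sum.inl i) (Sum.inl j) with hf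
  have hcont : ContinuousAt f t :=
    tendsto_finsetSum _ fun i _ => tendsto_finsetSum _ fun j _ => (hF _ _).continuousAt
  have hseq : Tendsto (fun ε : ℝ => (t : ℂ) + ε * Complex.I) (𝓝[>] 0) (𝓝[≠] (t : ℂ)) := by
    refine tendsto_nhdsWithin_iff.mpr ⟨?_, ?_⟩
    · have : Continuous fun ε : ℝ => (t : ℂ) + ε * Complex.I := by fun_prop
      refine (this.tendsto' 0 _ (by simp)).mono_left nhdsWithin_le_nhds
    · filter_upwards [self_mem_nhdsWithin] with ε hε h0
      have h1 := congrArg Complex.im h0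
      simp at h1
      exact (ne_of_gt hε) h1
  have hlim : Tendsto (fun ε : ℝ => ε * (f (t + ε * Complex.I)).im) (𝓝[>] 0) (𝓝 (0 * (f t).im)) := by
    refine Tendsto.mul (tendsto_id.mono_left nhdsWithin_le_nhds) ?_
    refine (Complex.continuous_im.tendsto _).comp ?_
    exact (hcont.tendsto.mono_left nhdsWithin_le_nhds).comp hseq
  rw [zero_mul] at hlim
  -- With `y` the resolvent applied to `v`, the imaginary part is `ε ‖y‖²`, and pairing with `e`
  -- gives `ε ‖y‖ ≥ ‖e‖`.
  have hlow : ∀ᶠ ε : ℝ in 𝓝[>] 0, ‖e‖ ^ 2 ≤ ε * (f (t + ε * Complex.I)).im := by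
    filter_upwards [hseq.eventually hFe, self_mem_nhdsWithin] with ε h1 hε
    have hε : 0 < ε := hε
    set z : ℂ := t + ε * Complex.I with hz
    have hzim : z.im = ε := by simp [hz]
    have hu := isUnit_part_sub (H := H) n (z := z) (by rw [hzim]; exact hε.ne')
    set y := eucl (H.part 0 n - z • 1)⁻¹ v with hy
    have hyv : H.cutOp n y - z • y = v := by
      have h2 : (H.part 0 n - z • 1) *ᵥ y.ofLp = v.ofLp := by
        rw [hy, eucl_apply]
        change (H.part 0 n - z • 1) *ᵥ ((H.part 0 n - z • 1)⁻¹ *ᵥ v.ofLp) = _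
        rw [mulVec_mulVec, Matrix.mul_nonsing_inv _ ((Matrix.isUnit_iff_isUnit_det _).mp hu),
          one_mulVec]
      rw [sub_mulVec, smul_mulVec, one_mulVec] at h2
      ext x
      rw [cutOp, eucl_apply]
      exact congrFun h2 x
    have hfz : f z = inner ℂ v y := by
      rw [hf]
      simp only
      rw [h1, C.sum_rawData]
    have him : (f z).im = ε * ‖y‖ ^ 2 := by
      have := inner_cutOp_sub (H := H) n z y
      rwa [hyv, hzim, ← hfz] at this
    have hey : inner ℂ e v = (t - z) * inner ℂ e y := by
      have h3 : inner ℂ e (H.cutOp n y) = (t : ℂ) * inner ℂ e y := by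
        have h4 := (H.cutOp_isSymmetric n) e y
        simp only [ContinuousLinearMap.coe_coe] at h4
        rw [← h4, heig, inner_smul_left, Complex.conj_ofReal]
      rw [← hyv, inner_sub_right, inner_smul_right, h3]
      ring
    have hnorm : ‖e‖ ^ 2 = ε * ‖(inner ℂ e y : ℂ)‖ := by
      have h5 := congrArg norm hey
      rw [hev, norm_mul] at h5
      have h6 : ‖(t : ℂ) - z‖ = ε := by
        rw [hz, sub_add_cancel_left, norm_neg, norm_mul, Complex.norm_I, Complex.norm_real]
        simp [abs_of_pos hε]
      rw [h6] at h5
      simpa using h5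
    have hcs : ‖e‖ ≤ ε * ‖y‖ := by
      have h7 := norm_inner_le_norm (𝕜 := ℂ) e y
      have h8 : ‖e‖ * ‖e‖ ≤ ‖e‖ * (ε * ‖y‖) := by nlinarith
      exact le_of_mul_le_mul_left h8 hene
    rw [him]
    nlinarith [hene.le, norm_nonneg y]
  have hle : ‖e‖ ^ 2 ≤ 0 := ge_of_tendsto hlim hlow
  nlinarith

theorem cutWeight_mono (t : ℝ) : Monotone fun n => C.cutWeight n t := by
  intro m n hmn
  have h1 := C.finiteDimensional_eigenIn m t
  have h2 := C.finiteDimensional_eigenIn n t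
  simp only [cutWeight]
  rw [← norm_starProjection_eigenIn, ← norm_starProjection_eigenIn]
  exact pow_le_pow_left₀ (norm_nonneg _) (norm_starProjection_mono (H.eigenIn_mono t hmn) _) 2

theorem exists_cutWeight_ne_zero {t : ℝ} (h : C.limWeight t ≠ 0) : ∃ n, C.cutWeight n t ≠ 0 := by
  by_contra! h0
  refine h (tendsto_nhds_unique (C.tendsto_cutWeight t) ?_)
  simp only [h0]
  exact tendsto_const_nhds

/-- The weights at a point increase with `n`: once positive at `m` they stay positive for all `n ≥
m`, whence the union of intersections. -/
theorem compactEigenMeasure_compl_singSet :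
    H.compactEigenMeasure C.root (⋃ m, ⋂ n ≥ m, C.singSet 0 n)ᶜ = 0 := by
  rw [compactEigenMeasure_eq]
  have hT : MeasurableSet {t | C.limWeight t = 0} := by
    refine MeasurableSet.of_compl (Set.Countable.measurableSet ?_)
    refine (Set.countable_iUnion fun n => (realSpec H n).countable_toSet).mono fun t ht => ?_
    obtain ⟨n, hn⟩ := C.exists_cutWeight_ne_zero ht
    refine Set.mem_iUnion.mpr ⟨n, ?_⟩
    by_contra h2
    exact hn (C.cutWeight_eq_zero h2)
  refine measure_mono_null (t := {t | C.limWeight t = 0}) (fun t ht => ?_) ?_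
  · by_contra h
    obtain ⟨m, hm⟩ := C.exists_cutWeight_ne_zero h
    refine ht (Set.mem_iUnion.mpr ⟨m, Set.mem_iInter₂.mpr fun n hn => ?_⟩)
    refine C.mem_singSet_of_cutWeight_ne_zero fun h0 => hm (le_antisymm ?_ (C.cutWeight_nonneg m t))
    exact (C.cutWeight_mono t hn).trans_eq h0
  · rw [pointMeasure.apply hT]
    refine ENNReal.tsum_eq_zero.mpr fun t => ?_
    by_cases h : C.limWeight t = 0 <;> simp [h]

end Channels

end ShellOperator

/-! ### Boundary vectors of a Hermitian matrix -/

namespace BoundaryVector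

open scoped ComplexOrder

set_option linter.unusedSectionVars false

variable {n : Type*} [Fintype n] [DecidableEq n]

/-- The boundary vector with components `b` and `δ b`. -/
def vec (δ : Matrix n n ℂ) (b : n → ℂ) : n ⊕ n → ℂ := Sum.elim b (δ *ᵥ b)

/-- The solution `p` of `(1 + δ²) p = g`. -/
def sol (δ : Matrix n n ℂ) (g : n → ℂ) : n → ℂ := (1 + δ ^ 2)⁻¹ *ᵥ g

/-- The number `⟨g, (1 + δ²)⁻¹ g⟩` as the squared norm of a boundary vector. -/
def energy (δ : Matrix n n ℂ) (g : n → ℂ) : ℝ := eNorm (vec δ (sol δ g)) ^ 2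

variable {δ : Matrix n n ℂ}

theorem posDef_one_add_sq (hδ : δ.IsHermitian) : (1 + δ ^ 2).PosDef := by
  have h : δ ^ 2 = δᴴ * δ := by rw [hδ.eq, sq]
  rw [h]
  exact PosDef.one.add_posSemidef (posSemidef_conjTranspose_mul_self δ)

theorem mul_sol (hδ : δ.IsHermitian) (g : n → ℂ) : (1 + δ ^ 2) *ᵥ sol δ g = g := by
  have hu := (Matrix.isUnit_iff_isUnit_det _).mp (posDef_one_add_sq hδ).isUnit
  rw [sol, mulVec_mulVec, Matrix.mul_nonsing_inv _ hu, one_mulVec]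

theorem dotProduct_mulVec_of_isHermitian {A : Matrix n n ℂ} (hA : A.IsHermitian) (a b : n → ℂ) :
    star (A *ᵥ a) ⬝ᵥ b = star a ⬝ᵥ (A *ᵥ b) := by
  rw [star_mulVec, hA.eq, ← dotProduct_mulVec]

theorem inner_vec (hδ : δ.IsHermitian) (a b : n → ℂ) :
    inner ℂ (WithLp.toLp 2 (vec δ a)) (WithLp.toLp 2 (vec δ b))
      = star ((1 + δ ^ 2) *ᵥ a) ⬝ᵥ b := by
  rw [dotProduct_mulVec_of_isHermitian (posDef_one_add_sq hδ).isHermitian,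
    EuclideanSpace.inner_eq_star_dotProduct, dotProduct_comm, add_mulVec, one_mulVec,
    dotProduct_add, sq, ← mulVec_mulVec, ← dotProduct_mulVec_of_isHermitian hδ]
  simp [vec, dotProduct]

theorem inner_vec_sol (hδ : δ.IsHermitian) (g b : n → ℂ) :
    inner ℂ (WithLp.toLp 2 (vec δ (sol δ g))) (WithLp.toLp 2 (vec δ b)) = star g ⬝ᵥ b := by
  rw [inner_vec hδ, mul_sol hδ]

theorem dotProduct_sol (hδ : δ.IsHermitian) (g : n → ℂ) :
    star g ⬝ᵥ sol δ g = energy δ g := by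
  rw [← inner_vec_sol hδ, inner_self_eq_norm_sq_to_K, energy, eNorm]
  simp

theorem vec_smul (c : ℂ) (b : n → ℂ) : vec δ (c • b) = c • vec δ b := by
  funext i
  cases i <;> simp [vec, mulVec_smul]

/-- Cauchy–Schwarz on the graph of `δ`: the Gram matrix of `b ↦ (b, δ b)` is `1 + δ²`, so pairing
with the graph vector over `(1 + δ²)⁻¹ g` reproduces `⟨g, b⟩`. -/
theorem one_le_energy_mul (hδ : δ.IsHermitian) {g b : n → ℂ} (hb : star g ⬝ᵥ b = 1) :
    1 ≤ energy δ g * eNorm (vec δ b) ^ 2 := by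
  have h := norm_inner_le_norm (𝕜 := ℂ) (WithLp.toLp 2 (vec δ (sol δ g))) (WithLp.toLp 2 (vec δ b))
  rw [inner_vec_sol hδ, hb, norm_one] at h
  rw [energy, eNorm, eNorm, ← mul_pow]
  exact one_le_pow₀ h

theorem energy_pos (hδ : δ.IsHermitian) {g b : n → ℂ} (hb : star g ⬝ᵥ b = 1) : 0 < energy δ g := by
  have h := one_le_energy_mul hδ hb
  have h2 : 0 ≤ energy δ g := sq_nonneg _
  rcases h2.eq_or_lt with h3 | h3
  · rw [← h3] at h
    linarith
  · exact h3

/-- Equality in Cauchy–Schwarz is reached at the multiple of `sol δ g` normalised by the constraint.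
-/
theorem isLeast (hδ : δ.IsHermitian) {g b : n → ℂ} (hb : star g ⬝ᵥ b = 1) :
    IsLeast ((fun c => eNorm (vec δ c) ^ 2) '' {c | star g ⬝ᵥ c = 1}) (energy δ g)⁻¹ := by
  have hpos := energy_pos hδ hb
  have hne : (energy δ g : ℂ) ≠ 0 := by exact_mod_cast hpos.ne'
  refine ⟨⟨((energy δ g)⁻¹ : ℂ) • sol δ g, ?_, ?_⟩, ?_⟩
  · change star g ⬝ᵥ (_ • _) = 1
    rw [dotProduct_smul, dotProduct_sol hδ, smul_eq_mul, inv_mul_cancel₀ hne]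
  · simp only [vec_smul, eNorm]
    rw [WithLp.toLp_smul, norm_smul, mul_pow]
    change _ * energy δ g = _
    rw [norm_inv, Complex.norm_real, Real.norm_of_nonneg hpos.le]
    field_simp
  · rintro _ ⟨c, hc, rfl⟩
    exact (inv_le_iff_one_le_mul₀' hpos).mpr (one_le_energy_mul hδ hc)

theorem eNorm_sq_eq (v : n → ℂ) : ((eNorm v ^ 2 : ℝ) : ℂ) = star v ⬝ᵥ v := by
  have h := inner_self_eq_norm_sq_to_K (𝕜 := ℂ) (WithLp.toLp 2 v)
  rw [EuclideanSpace.inner_eq_star_dotProduct, dotProduct_comm] at h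
  rw [eNorm, h]
  simp

theorem energy_eq_rpow (hδ : δ.IsHermitian) (g : n → ℂ) :
    eNorm (cfc (fun s : ℝ => s ^ (-(1 / 2) : ℝ)) (1 + δ ^ 2) *ᵥ g) ^ 2 = energy δ g := by
  set A := 1 + δ ^ 2 with hA
  have hpd : A.PosDef := posDef_one_add_sq hδ
  set N := cfc (fun s : ℝ => s ^ (-(1 / 2) : ℝ)) A with hN
  have hsa : IsSelfAdjoint A := hpd.isHermitian
  have hfin : (spectrum ℝ A).Finite := by
    rw [hpd.isHermitian.spectrum_real_eq_range_eigenvalues]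
    exact Set.finite_range _
  have hNN : N * (N * A) = 1 := by
    have hc : ∀ f : ℝ → ℝ, ContinuousOn f (spectrum ℝ A) := fun f => hfin.continuousOn f
    have h1 : N * (N * A) = cfc (fun s : ℝ => s ^ (-(1 / 2) : ℝ) * (s ^ (-(1 / 2) : ℝ) * s)) A := by
      rw [cfc_mul _ _ A (hc _) (hc _), cfc_mul _ _ A (hc _) (hc _), cfc_id' ℝ A]
    rw [h1, ← cfc_one ℝ A]
    refine cfc_congr fun s hs => ?_
    rw [hpd.isHermitian.spectrum_real_eq_range_eigenvalues] at hs
    obtain ⟨i, rfl⟩ := hs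
    have hp := hpd.eigenvalues_pos i
    change _ = (1 : ℝ)
    rw [← mul_assoc, ← Real.rpow_add hp]
    norm_num
    rw [Real.rpow_neg_one, inv_mul_cancel₀ hp.ne']
  have hNh : N.IsHermitian := cfc_predicate (R := ℝ) _ A
  have : ((eNorm (N *ᵥ g) ^ 2 : ℝ) : ℂ) = energy δ g := by
    rw [eNorm_sq_eq, dotProduct_mulVec_of_isHermitian hNh, ← dotProduct_sol hδ]
    congr 1
    conv_lhs => rw [← mul_sol hδ g]
    rw [mulVec_mulVec, mulVec_mulVec, ← hA, mul_assoc, hNN, one_mulVec]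
  exact_mod_cast this

/-- With `p = (1 + δ²)⁻¹ g`, the vector `(1 + iδ) p` solves `(1 - iδ) y = g`; the cross terms in its
squared norm cancel because `δ` is Hermitian. -/
theorem energy_eq_norm (hδ : δ.IsHermitian) (g : n → ℂ) :
    eNorm (sol δ g + Complex.I • (δ *ᵥ sol δ g)) ^ 2 = energy δ g := by
  have : ((eNorm (sol δ g + Complex.I • (δ *ᵥ sol δ g)) ^ 2 : ℝ) : ℂ) = energy δ g := by
    have h1 := inner_vec hδ (sol δ g) (sol δ g)
    rw [inner_vec_sol hδ, dotProduct_sol hδ] at h1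
    rw [h1, eNorm_sq_eq, dotProduct_mulVec_of_isHermitian (posDef_one_add_sq hδ).isHermitian,
      add_mulVec, one_mulVec, sq, ← mulVec_mulVec, star_add, star_smul]
    simp only [add_dotProduct, dotProduct_add, smul_dotProduct, dotProduct_smul]
    rw [← dotProduct_mulVec_of_isHermitian hδ (sol δ g) (δ *ᵥ sol δ g),
      ← dotProduct_mulVec_of_isHermitian hδ (sol δ g) (sol δ g)]
    simp only [smul_eq_mul, RCLike.star_def, Complex.conj_I]
    linear_combination (-1 * (star (δ *ᵥ sol δ g) ⬝ᵥ δ *ᵥ sol δ g)) * Complex.I_sq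
  exact_mod_cast this

end BoundaryVector

/-! ### Gluing two systems through a common channel -/

namespace Gluing

set_option linter.unusedSectionVars false

variable {p q r s k : Type*} [Fintype p] [DecidableEq p] [Fintype q] [DecidableEq q]
  [Fintype r] [Fintype s] [Fintype k]
  {M : Matrix p p ℂ} {N : Matrix q q ℂ} {J : Matrix p r ℂ} {O : Matrix p s ℂ} {I : Matrix q s ℂ}
  {E : Matrix q k ℂ}

/-- The matrix of two systems coupled through a channel. -/
def glue (M : Matrix p p ℂ) (N : Matrix q q ℂ) (O : Matrix p s ℂ) (I : Matrix q s ℂ) :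
    Matrix (p ⊕ q) (p ⊕ q) ℂ := fromBlocks M (-(O * Iᴴ)) (-(I * Oᴴ)) N

/-- Block elimination through the amplitude `x = I* g` that the second system feeds back to the
first: `f = M⁻¹ O x`, and substituting this in the second block row leaves one equation for `x`. -/
theorem exists_solution (hM : IsUnit M) (hN : IsUnit N) (hG : IsUnit (glue M N O I)) (b : k → ℂ) :
    ∃ x : s → ℂ,
      x - (Iᴴ * N⁻¹ * I) *ᵥ ((Oᴴ * M⁻¹ * O) *ᵥ x) = (Iᴴ * N⁻¹ * E) *ᵥ b ∧
      ((fromRows J (0 : Matrix q r ℂ))ᴴ * (glue M N O I)⁻¹ * fromRows (0 : Matrix p k ℂ) E) *ᵥ b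
        = (Jᴴ * M⁻¹ * O) *ᵥ x ∧
      ((fromRows (0 : Matrix p k ℂ) E)ᴴ * (glue M N O I)⁻¹ * fromRows (0 : Matrix p k ℂ) E) *ᵥ b
        = (Eᴴ * N⁻¹ * I) *ᵥ ((Oᴴ * M⁻¹ * O) *ᵥ x) + (Eᴴ * N⁻¹ * E) *ᵥ b := by
  rw [Matrix.isUnit_iff_isUnit_det] at hM hN hG
  set ψ := (glue M N O I)⁻¹ *ᵥ (fromRows (0 : Matrix p k ℂ) E *ᵥ b) with hψ
  obtain ⟨f, g, hfg⟩ : ∃ f g, ψ = Sum.elim f g := ⟨_, _, (Sum.elim_comp_inl_inr ψ).symm⟩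
  have heq : glue M N O I *ᵥ ψ = fromRows (0 : Matrix p k ℂ) E *ᵥ b := by
    rw [hψ, mulVec_mulVec, Matrix.mul_nonsing_inv _ hG, one_mulVec]
  rw [hfg, glue, fromBlocks_mulVec, fromRows_mulVec, Sum.elim_comp_inl, Sum.elim_comp_inr,
    Sum.elim_eq_iff, zero_mulVec, neg_mulVec, neg_mulVec, ← mulVec_mulVec, ← mulVec_mulVec] at heq
  obtain ⟨h1, h2⟩ := heq
  set x := Iᴴ *ᵥ g with hx
  have hf : f = M⁻¹ *ᵥ (O *ᵥ x) := by
    rw [← add_neg_eq_zero.mp h1, mulVec_mulVec, Matrix.nonsing_inv_mul _ hM, one_mulVec]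
  have hO : (Oᴴ * M⁻¹ * O) *ᵥ x = Oᴴ *ᵥ f := by
    rw [hf, ← mulVec_mulVec, ← mulVec_mulVec]
  have hg : g = N⁻¹ *ᵥ (I *ᵥ (Oᴴ *ᵥ f)) + N⁻¹ *ᵥ (E *ᵥ b) := by
    rw [← mulVec_add, ← h2, add_neg_cancel_left, mulVec_mulVec, Matrix.nonsing_inv_mul _ hN,
      one_mulVec]
  refine ⟨x, ?_, ?_, ?_⟩
  · rw [hO, sub_eq_iff_eq_add', ← mulVec_mulVec, ← mulVec_mulVec, ← mulVec_mulVec, ← mulVec_mulVec,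
      ← mulVec_add, ← hg]
  · rw [← mulVec_mulVec, ← mulVec_mulVec, ← hψ, hfg, conjTranspose_fromRows_eq_fromCols_conjTranspose,
      fromCols_mulVec, Sum.elim_comp_inl, Sum.elim_comp_inr, conjTranspose_zero, zero_mulVec,
      add_zero, hf, ← mulVec_mulVec, ← mulVec_mulVec]
  · rw [← mulVec_mulVec, ← mulVec_mulVec, ← hψ, hfg, conjTranspose_fromRows_eq_fromCols_conjTranspose,
      fromCols_mulVec, Sum.elim_comp_inl, Sum.elim_comp_inr, conjTranspose_zero, zero_mulVec,
      zero_add, hO, ← mulVec_mulVec, ← mulVec_mulVec, ← mulVec_mulVec, ← mulVec_mulVec,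
      ← mulVec_add, ← hg]

/-- An amplitude that reproduces itself around the loop yields a null vector of the glued matrix. -/
theorem eq_zero_of_fixed (hM : IsUnit M) (hN : IsUnit N) (hG : IsUnit (glue M N O I)) {x : s → ℂ}
    (hx : x - (Iᴴ * N⁻¹ * I) *ᵥ ((Oᴴ * M⁻¹ * O) *ᵥ x) = 0) : x = 0 := by
  have hinj := Matrix.mulVec_injective_of_isUnit hG
  rw [Matrix.isUnit_iff_isUnit_det] at hM hN
  set f := M⁻¹ *ᵥ (O *ᵥ x) with hf
  have hO : (Oᴴ * M⁻¹ * O) *ᵥ x = Oᴴ *ᵥ f := by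
    rw [hf, ← mulVec_mulVec, ← mulVec_mulVec]
  rw [hO] at hx
  set g := N⁻¹ *ᵥ (I *ᵥ (Oᴴ *ᵥ f)) with hg
  have hI : x = Iᴴ *ᵥ g := by
    rw [sub_eq_zero] at hx
    rw [hx, hg, ← mulVec_mulVec, ← mulVec_mulVec]
  have h0 : Sum.elim f g = 0 := by
    refine hinj ?_
    rw [mulVec_zero, glue, fromBlocks_mulVec, Sum.elim_comp_inl, Sum.elim_comp_inr, neg_mulVec,
      neg_mulVec, ← mulVec_mulVec, ← mulVec_mulVec, ← hI, hf, mulVec_mulVec,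
      Matrix.mul_nonsing_inv _ hM, one_mulVec, ← hf, hg, mulVec_mulVec _ N,
      Matrix.mul_nonsing_inv _ hN, one_mulVec, add_neg_cancel, neg_add_cancel]
    funext i
    cases i <;> rfl
  have hg0 : g = 0 := funext fun i => congrFun h0 (Sum.inr i)
  rw [hI, hg0, mulVec_zero]

end Gluing

namespace ShellOperator

open scoped Classical

set_option linter.unusedSectionVars false

variable {G : Type*} {H : ShellOperator G}

namespace Channels

variable (C : H.Channels)

/-! ### Boundary resolvent data outside the spectrum -/

theorem isUnit_of_notMem {m n : ℕ} {t : ℝ} (ht : t ∉ H.specSet m n) :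
    IsUnit (H.part m n - (t : ℂ) • 1) := not_not.mp ht

theorem data_eq {m n : ℕ} {t : ℝ} (ht : t ∉ H.specSet m n) :
    C.data m n t = C.rawData m n t := if_pos (isUnit_of_notMem ht)

theorem α_eq {m n : ℕ} {t : ℝ} (ht : t ∉ H.specSet m n) :
    C.α m n t = (C.colIn m n)ᴴ * (H.part m n - (t : ℂ) • 1)⁻¹ * C.colIn m n := by
  rw [α, C.data_eq ht, rawData_eq, toBlocks_fromBlocks₁₁]

theorem β_eq {m n : ℕ} {t : ℝ} (ht : t ∉ H.specSet m n) :
    C.β m n t = (C.colIn m n)ᴴ * (H.part m n - (t : ℂ) • 1)⁻¹ * C.colOut m n := by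
  rw [β, C.data_eq ht, rawData_eq, toBlocks_fromBlocks₁₂]

theorem γ_eq {m n : ℕ} {t : ℝ} (ht : t ∉ H.specSet m n) :
    C.γ m n t = (C.colOut m n)ᴴ * (H.part m n - (t : ℂ) • 1)⁻¹ * C.colIn m n := by
  rw [γ, C.data_eq ht, rawData_eq, toBlocks_fromBlocks₂₁]

theorem δ_eq {m n : ℕ} {t : ℝ} (ht : t ∉ H.specSet m n) :
    C.δ m n t = (C.colOut m n)ᴴ * (H.part m n - (t : ℂ) • 1)⁻¹ * C.colOut m n := by
  rw [δ, C.data_eq ht, rawData_eq, toBlocks_fromBlocks₂₂]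

theorem conjTranspose_resolvent (m n : ℕ) (t : ℝ) :
    ((H.part m n - (t : ℂ) • 1)⁻¹)ᴴ = (H.part m n - (t : ℂ) • 1)⁻¹ := by
  rw [conjTranspose_nonsing_inv, conjTranspose_sub, (H.part_isHermitian m n).eq,
    conjTranspose_smul, conjTranspose_one]
  simp

theorem conjTranspose_β {m n : ℕ} {t : ℝ} (ht : t ∉ H.specSet m n) :
    (C.β m n t)ᴴ = C.γ m n t := by
  rw [C.β_eq ht, C.γ_eq ht, conjTranspose_mul, conjTranspose_mul, conjTranspose_resolvent,
    conjTranspose_conjTranspose, Matrix.mul_assoc]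

theorem isHermitian_δ {m n : ℕ} {t : ℝ} (ht : t ∉ H.specSet m n) :
    (C.δ m n t).IsHermitian := by
  rw [IsHermitian, C.δ_eq ht, conjTranspose_mul, conjTranspose_mul, conjTranspose_resolvent,
    conjTranspose_conjTranspose, Matrix.mul_assoc]

/-- The vector `γ_{0,n}` (a matrix with a single column). -/
def exitVec (n : ℕ) (t : ℝ) : Fin (H.rk (n + 1)) → ℂ := C.γ 0 n t *ᵥ 1

/-- The common value of the densities up to the factor `π`. -/
def exitEnergy (n : ℕ) (t : ℝ) : ℝ := BoundaryVector.energy (C.δ 0 n t) (C.exitVec n t)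

theorem density_eq {n : ℕ} {t : ℝ} (ht : t ∉ H.specSet 0 n) :
    C.density n t = 1 / Real.pi * C.exitEnergy n t := by
  rw [density, ← mulVec_mulVec, BoundaryVector.energy_eq_rpow (C.isHermitian_δ ht)]
  rfl

/-- An explicit solution of `(H_{0,n} - iΦ̂Φ̂* - t) x = v`: its exit amplitude `y` must satisfy `(1
- iδ) y = γ`, and then `x` is the undamped resolvent applied to `v + iΦ̂ y`. -/
theorem cutDensity_eq {n : ℕ} {t : ℝ} (ht : t ∉ H.specSet 0 n) :
    C.cutDensity n t = 1 / Real.pi * C.exitEnergy n t := by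
  have hδ := C.isHermitian_δ ht
  set p := BoundaryVector.sol (C.δ 0 n t) (C.exitVec n t) with hp
  set y := p + Complex.I • (C.δ 0 n t *ᵥ p) with hy
  set Q := (H.part 0 n - (t : ℂ) • 1)⁻¹ with hQ
  set x := Q *ᵥ (C.colIn 0 n *ᵥ 1 + Complex.I • (C.colOut 0 n *ᵥ y)) with hx
  have hOx : (C.colOut 0 n)ᴴ *ᵥ x = y := by
    have h1 : (C.colOut 0 n)ᴴ *ᵥ x = C.exitVec n t + Complex.I • (C.δ 0 n t *ᵥ y) := by
      rw [hx, mulVec_add, mulVec_add, mulVec_smul, mulVec_smul, exitVec, C.γ_eq ht, C.δ_eq ht]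
      simp only [mulVec_mulVec, Matrix.mul_assoc, hQ]
    have h2 := BoundaryVector.mul_sol hδ (C.exitVec n t)
    rw [← hp, add_mulVec, one_mulVec, sq, ← mulVec_mulVec] at h2
    rw [h1, hy, ← h2, mulVec_add, mulVec_smul, smul_add, smul_smul, Complex.I_mul_I]
    module
  have hux : (H.part 0 n - (t : ℂ) • 1) *ᵥ x
      = C.colIn 0 n *ᵥ 1 + Complex.I • (C.colOut 0 n *ᵥ y) := by
    rw [hx, mulVec_mulVec, Matrix.mul_nonsing_inv _
      ((Matrix.isUnit_iff_isUnit_det _).mp (isUnit_of_notMem ht)), one_mulVec]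
  have hdiss : HalfPlane.diss (H.cutOp n) (C.exitOp n) (WithLp.toLp 2 x)
      - (t : ℂ) • WithLp.toLp 2 x = H.res n C.root := by
    rw [HalfPlane.diss_apply, exitOp, eucl_adjoint, conjTranspose_conjTranspose, eucl_apply,
      eucl_apply, cutOp, eucl_apply]
    refine (WithLp.ofLp_injective 2) ?_
    rw [C.res_root]
    change H.part 0 n *ᵥ x - Complex.I • (C.colOut 0 n *ᵥ ((C.colOut 0 n)ᴴ *ᵥ x)) - (t : ℂ) • x = _
    rw [hOx]
    rw [sub_mulVec, smul_mulVec, one_mulVec] at hux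
    rw [sub_right_comm, hux, add_sub_cancel_right]
  rw [cutDensity, HalfPlane.acDensity_eq (H.cutOp_isSymmetric n) (C.hidden_realSpec n) (by
    rw [realSpec]; simpa using ht) hdiss, exitOp, eucl_apply, exitEnergy,
    ← BoundaryVector.energy_eq_norm hδ, ← hp, ← hy]
  simp only [eNorm]
  rw [hOx]

/-! ### Gluing a shell -/

/-- `G_{0,n+1}` is the disjoint union of `G_{0,n}` and the shell `n + 1`. -/
def splitEquiv (H : ShellOperator G) (n : ℕ) :
    H.Part 0 n ⊕ H.Part (n + 1) (n + 1) ≃ H.Part 0 (n + 1) where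
  toFun := Sum.elim (fun x => ⟨x, by have := x.2; omega⟩) fun x => ⟨x, by have := x.2; omega⟩
  invFun x := if h : H.shell x ≤ n then Sum.inl ⟨x, Nat.zero_le _, h⟩
    else Sum.inr ⟨x, by omega, x.2.2⟩
  left_inv := by
    rintro (x | x)
    · simp [x.2.2]
    · have : ¬ H.shell x ≤ n := by have := x.2; omega
      simp [this]
  right_inv x := by
    by_cases h : H.shell x ≤ n <;> simp [h]

theorem splitEquiv_inl (n : ℕ) (x : H.Part 0 n) : (splitEquiv H n (Sum.inl x) : G) = x := rfl

theorem splitEquiv_inr (n : ℕ) (x : H.Part (n + 1) (n + 1)) :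
    (splitEquiv H n (Sum.inr x) : G) = x := rfl

theorem ker_succ (n : ℕ) (y : H.Part (n + 1) (n + 1)) (x : H.Part 0 n) :
    H.ker y x = -(C.colIn (n + 1) (n + 1) * (C.colOut 0 n)ᴴ) y x := by
  have hy : H.shell y = n + 1 := le_antisymm y.2.2 y.2.1
  by_cases hx : H.shell x = n
  · have h := congrFun (congrFun (C.factor n) ⟨y, hy⟩) ⟨x, hx⟩
    rw [neg_apply] at h
    change H.ker y x = _ at h
    rw [h]
    simp [Matrix.mul_apply, colIn, colOut, hx, hy]
  · rw [H.hopping y x (Or.inr (by have := x.2.2; omega))]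
    simp [Matrix.mul_apply, colOut, hx]

theorem ker_succ' (n : ℕ) (x : H.Part 0 n) (y : H.Part (n + 1) (n + 1)) :
    H.ker x y = -(C.colOut 0 n * (C.colIn (n + 1) (n + 1))ᴴ) x y := by
  rw [← H.isHermitian.apply, C.ker_succ n y x, star_neg, ← conjTranspose_apply, conjTranspose_mul,
    conjTranspose_conjTranspose]

theorem part_submatrix (n : ℕ) (z : ℂ) :
    (H.part 0 (n + 1) - z • 1).submatrix (splitEquiv H n) (splitEquiv H n)
      = Gluing.glue (H.part 0 n - z • 1) (H.part (n + 1) (n + 1) - z • 1) (C.colOut 0 n)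
        (C.colIn (n + 1) (n + 1)) := by
  have h1 : (H.part 0 (n + 1) - z • 1).submatrix (splitEquiv H n) (splitEquiv H n)
      = (H.part 0 (n + 1)).submatrix (splitEquiv H n) (splitEquiv H n) - z • 1 := by
    rw [← submatrix_one_equiv (splitEquiv H n)]
    rfl
  rw [h1]
  ext (x | x) (y | y)
  · simp [Gluing.glue, part, splitEquiv_inl, one_apply]
  · simp [Gluing.glue, part, splitEquiv_inl, splitEquiv_inr, C.ker_succ' n x y]
  · simp [Gluing.glue, part, splitEquiv_inl, splitEquiv_inr, C.ker_succ n x y]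
  · simp [Gluing.glue, part, splitEquiv_inr, one_apply]

theorem colIn_submatrix (n : ℕ) :
    (C.colIn 0 (n + 1)).submatrix (splitEquiv H n) id = fromRows (C.colIn 0 n) 0 := by
  ext (x | x) j
  · rfl
  · have : H.shell x ≠ 0 := by have := x.2; omega
    simp [colIn, splitEquiv_inr, this]

theorem colOut_submatrix (n : ℕ) :
    (C.colOut 0 (n + 1)).submatrix (splitEquiv H n) id
      = fromRows 0 (C.colOut (n + 1) (n + 1)) := by
  ext (x | x) j
  · have : H.shell x ≠ n + 1 := by have := x.2; omega
    simp [colOut, splitEquiv_inl, this]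
  · rfl

theorem reindex_sandwich {p q r s : Type*} [Fintype p] [Fintype q] [DecidableEq p] [DecidableEq q]
    (e : p ≃ q) (A : Matrix q r ℂ) (M : Matrix q q ℂ) (B : Matrix q s ℂ) :
    Aᴴ * M⁻¹ * B
      = (A.submatrix e id)ᴴ * (M.submatrix e e)⁻¹ * B.submatrix e id := by
  rw [inv_submatrix_equiv, conjTranspose_submatrix, submatrix_mul_equiv, submatrix_mul_equiv,
    submatrix_id_id]

/-- A point at which the systems on `G_{0,n}`, on the shell `n + 1` and on `G_{0,n+1}` all have a
resolvent. -/
def Regular (H : ShellOperator G) (n : ℕ) (t : ℝ) : Prop :=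
  t ∉ H.specSet 0 n ∧ t ∉ H.specSet (n + 1) (n + 1) ∧ t ∉ H.specSet 0 (n + 1)

theorem Regular.isUnit_glue {n : ℕ} {t : ℝ} (ht : Regular H n t) :
    IsUnit (Gluing.glue (H.part 0 n - (t : ℂ) • 1) (H.part (n + 1) (n + 1) - (t : ℂ) • 1)
      (C.colOut 0 n) (C.colIn (n + 1) (n + 1))) := by
  rw [← part_submatrix, isUnit_submatrix_equiv]
  exact isUnit_of_notMem ht.2.2

theorem Regular.exists_solution {n : ℕ} {t : ℝ} (ht : Regular H n t)
    (b : Fin (H.rk (n + 1 + 1)) → ℂ) : ∃ x : Fin (H.rk (n + 1)) → ℂ,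
      x - C.α (n + 1) (n + 1) t *ᵥ (C.δ 0 n t *ᵥ x) = C.β (n + 1) (n + 1) t *ᵥ b ∧
      C.β 0 (n + 1) t *ᵥ b = C.β 0 n t *ᵥ x ∧
      C.δ 0 (n + 1) t *ᵥ b
        = C.γ (n + 1) (n + 1) t *ᵥ (C.δ 0 n t *ᵥ x) + C.δ (n + 1) (n + 1) t *ᵥ b := by
  obtain ⟨x, h1, h2, h3⟩ := Gluing.exists_solution (J := C.colIn 0 n)
    (E := C.colOut (n + 1) (n + 1)) (isUnit_of_notMem ht.1) (isUnit_of_notMem ht.2.1)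
    (ht.isUnit_glue C) b
  refine ⟨x, ?_, ?_, ?_⟩
  · rw [C.α_eq ht.2.1, C.β_eq ht.2.1, C.δ_eq ht.1]
    exact h1
  · rw [C.β_eq ht.2.2, C.β_eq ht.1, reindex_sandwich (splitEquiv H n), C.part_submatrix,
      C.colIn_submatrix, C.colOut_submatrix]
    exact h2
  · rw [C.δ_eq ht.2.2, C.δ_eq ht.2.1, C.γ_eq ht.2.1, C.δ_eq ht.1,
      reindex_sandwich (splitEquiv H n), C.part_submatrix, C.colOut_submatrix]
    exact h3

theorem Regular.eq_zero {n : ℕ} {t : ℝ} (ht : Regular H n t) {x : Fin (H.rk (n + 1)) → ℂ}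
    (hx : x - C.α (n + 1) (n + 1) t *ᵥ (C.δ 0 n t *ᵥ x) = 0) : x = 0 := by
  rw [C.α_eq ht.2.1, C.δ_eq ht.1] at hx
  exact Gluing.eq_zero_of_fixed (isUnit_of_notMem ht.1) (isUnit_of_notMem ht.2.1)
    (ht.isUnit_glue C) hx

end Channels

end ShellOperator

namespace ShellOperator

open scoped Classical

set_option linter.unusedSectionVars false

variable {G : Type*} {H : ShellOperator G}

theorem chain_congr {T T' : ∀ i, Matrix (Fin (H.rk (i + 1)) ⊕ Fin (H.rk (i + 1)))
    (Fin (H.rk i) ⊕ Fin (H.rk i)) ℂ} {n : ℕ} (h : ∀ i < n, T i = T' i) :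
    H.chain T n = H.chain T' n := by
  induction n with
  | zero => rfl
  | succ n ih =>
    rw [chain, chain, ih fun i hi => h i (by omega), h n (by omega)]

namespace Channels

variable (C : H.Channels)

/-! ### Dirichlet vectors and products of transfer matrices -/

instance (H : ShellOperator G) : Unique (Fin (H.rk 0)) := inferInstanceAs (Unique (Fin 1))

theorem mul_column {n : Type*} [Fintype n] {A : Matrix (Fin (H.rk 0)) n ℂ} {b : n → ℂ}
    (h : A *ᵥ b = 1) : A * (Matrix.of fun i (_ : Fin (H.rk 0)) => b i) = 1 := by
  ext i j
  rw [Subsingleton.elim j i, one_apply_eq]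
  exact congrFun h i

theorem column_mulVec_one {n : Type*} (b : n → ℂ) :
    (Matrix.of fun i (_ : Fin (H.rk 0)) => b i) *ᵥ 1 = b := by
  funext i
  simp [mulVec, dotProduct]

theorem mem_dirichlet {n : ℕ} {t : ℝ} {u : Fin (H.rk (n + 1)) ⊕ Fin (H.rk (n + 1)) → ℂ} :
    u ∈ C.dirichlet n t ↔
      ∃ b, C.β 0 n t *ᵥ b = 1 ∧ u = BoundaryVector.vec (C.δ 0 n t) b := by
  constructor
  · rintro ⟨B, hB, rfl⟩
    refine ⟨B *ᵥ 1, ?_, ?_⟩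
    · rw [mulVec_mulVec, hB, one_mulVec]
    · rw [fromRows_mulVec, ← mulVec_mulVec]
      rfl
  · rintro ⟨b, hb, rfl⟩
    refine ⟨_, mul_column hb, ?_⟩
    rw [fromRows_mulVec, ← mulVec_mulVec, column_mulVec_one]
    rfl

theorem dotProduct_exitVec {n : ℕ} {t : ℝ} (ht : t ∉ H.specSet 0 n)
    (b : Fin (H.rk (n + 1)) → ℂ) : star (C.exitVec n t) ⬝ᵥ b = 1 ↔ C.β 0 n t *ᵥ b = 1 := by
  rw [exitVec, ← C.conjTranspose_β ht, star_mulVec, conjTranspose_conjTranspose,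
    ← dotProduct_mulVec, star_one, one_dotProduct, Fintype.sum_unique, funext_iff,
    Unique.forall_iff]
  rfl

theorem dirichletValues_eq {n : ℕ} {t : ℝ} (ht : t ∉ H.specSet 0 n) :
    C.dirichletValues n t = (fun b => eNorm (BoundaryVector.vec (C.δ 0 n t) b) ^ 2) ''
      {b | star (C.exitVec n t) ⬝ᵥ b = 1} := by
  ext a
  simp only [dirichletValues, Set.mem_image, C.mem_dirichlet, Set.mem_ofPred_eq,
    C.dotProduct_exitVec ht]
  constructor
  · rintro ⟨_, ⟨b, hb, rfl⟩, rfl⟩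
    exact ⟨b, hb, rfl⟩
  · rintro ⟨b, hb, rfl⟩
    exact ⟨_, ⟨b, hb, rfl⟩, rfl⟩

theorem isLeast_dirichletValues {n : ℕ} {t : ℝ} (ht : t ∉ H.specSet 0 n)
    (hne : (C.dirichlet n t).Nonempty) :
    0 < C.exitEnergy n t ∧ IsLeast (C.dirichletValues n t) (C.exitEnergy n t)⁻¹ := by
  obtain ⟨u, hu⟩ := hne
  obtain ⟨b, hb, -⟩ := C.mem_dirichlet.mp hu
  rw [← C.dotProduct_exitVec ht] at hb
  rw [C.dirichletValues_eq ht]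
  exact ⟨BoundaryVector.energy_pos (C.isHermitian_δ ht) hb,
    BoundaryVector.isLeast (C.isHermitian_δ ht) hb⟩

theorem transferS_subset (n : ℕ) (z : ℂ) : C.transferS n z ⊆ C.transfer n z := by
  rintro _ ⟨B, hB, rfl⟩
  refine ⟨B, B * C.α n n z, hB, ?_, ?_⟩
  · rw [← Matrix.mul_assoc, hB, Matrix.one_mul]
  · rw [Matrix.mul_assoc]

theorem fromBlocks_mulVec_vec {s k : Type*} [Fintype s] [Fintype k] (B : Matrix k s ℂ)
    (b : Matrix k s ℂ) (γ : Matrix k s ℂ) (δ : Matrix k k ℂ) (ε : Matrix s s ℂ) (x : s → ℂ) :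
    fromBlocks B (-b) (δ * B) (γ - δ * b) *ᵥ BoundaryVector.vec ε x
      = Sum.elim (B *ᵥ x - b *ᵥ (ε *ᵥ x))
        (δ *ᵥ (B *ᵥ x - b *ᵥ (ε *ᵥ x)) + γ *ᵥ (ε *ᵥ x)) := by
  rw [BoundaryVector.vec, fromBlocks_mulVec, Sum.elim_comp_inl, Sum.elim_comp_inr, neg_mulVec,
    sub_mulVec, ← mulVec_mulVec, ← mulVec_mulVec, mulVec_sub, ← sub_eq_add_neg]
  congr 1
  abel

/-- If the vector at level `n` is `(x, δ_{0,n} x)`, the next transfer matrix gives a first component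
`c` with `β c = x - α δ_{0,n} x`. This is the gluing equation, so `x` is the amplitude that belongs
to `c`. -/
theorem chain_mem_dirichlet {n : ℕ} {t : ℝ} (ht : ∀ i < n, Regular H i t)
    {T : ∀ i, Matrix (Fin (H.rk (i + 1)) ⊕ Fin (H.rk (i + 1))) (Fin (H.rk i) ⊕ Fin (H.rk i)) ℂ}
    (hT : ∀ i ≤ n, T i ∈ C.transfer i t) : H.chain T (n + 1) ∈ C.dirichlet n t := by
  induction n with
  | zero =>
    obtain ⟨B, b, hB, hb, hT0⟩ := hT 0 le_rfl
    refine ⟨B, hB, ?_⟩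
    rw [chain, chain, hT0, fromBlocks_mulVec, Sum.elim_comp_inl, Sum.elim_comp_inr, mulVec_zero,
      mulVec_zero, add_zero, add_zero, fromRows_mulVec]
  | succ n ih =>
    obtain ⟨x, hx, hu⟩ := C.mem_dirichlet.mp
      (ih (fun i hi => ht i (by omega)) fun i hi => hT i (by omega))
    obtain ⟨B, b, hB, hb, hTn⟩ := hT (n + 1) le_rfl
    have hr := ht n (by omega)
    rw [chain, hu, hTn, fromBlocks_mulVec_vec]
    set c := B *ᵥ x - b *ᵥ (C.δ 0 n t *ᵥ x) with hc
    obtain ⟨x', h1, h2, h3⟩ := hr.exists_solution C c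
    -- Both amplitudes solve the gluing equation for `c`, and the homogeneous equation has only the
    -- zero solution.
    have hxx : x' = x := by
      have h4 : C.β (n + 1) (n + 1) t *ᵥ c = x - C.α (n + 1) (n + 1) t *ᵥ (C.δ 0 n t *ᵥ x) := by
        rw [hc, mulVec_sub, mulVec_mulVec, hB, one_mulVec, mulVec_mulVec _ _ b, hb]
      rw [h4] at h1
      refine sub_eq_zero.mp (hr.eq_zero C ?_)
      rw [mulVec_sub, mulVec_sub, sub_sub_sub_comm, h1, sub_self]
    rw [hxx] at h2 h3
    refine C.mem_dirichlet.mpr ⟨c, h2.trans hx, ?_⟩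
    rw [BoundaryVector.vec, h3, add_comm (_ *ᵥ _)]

/-- A rank-one correction suffices: `b - B A b` lies in the kernel of `A`, and it is added along a
coordinate where `A b` does not vanish. -/
theorem exists_rightInverse_mulVec {s k : Type*} [Fintype s] [Fintype k] [DecidableEq s]
    {A : Matrix s k ℂ} {B : Matrix k s ℂ} (hB : A * B = 1) {b : k → ℂ} (h : A *ᵥ b ≠ 0) :
    ∃ B' : Matrix k s ℂ, A * B' = 1 ∧ B' *ᵥ (A *ᵥ b) = b := by
  obtain ⟨i, hi⟩ := Function.ne_iff.mp h
  set e := A *ᵥ b with he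
  refine ⟨B + vecMulVec (b - B *ᵥ e) (Pi.single i (e i)⁻¹), ?_, ?_⟩
  · rw [Matrix.mul_add, hB, mul_vecMulVec, mulVec_sub, mulVec_mulVec, hB, one_mulVec, ← he, sub_self,
      zero_vecMulVec, add_zero]
  · rw [add_mulVec, vecMulVec_mulVec, single_dotProduct, inv_mul_cancel₀ hi, MulOpposite.op_one,
      one_smul, add_sub_cancel]

/-- The smaller class already suffices. Gluing supplies the previous amplitude `x`, and a member of
`transferS` sends `(x, δ x)` to a vector with first component `B (x - α δ x) = B (β b)`, so a right
inverse with `B (β b) = b` is needed. -/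
theorem exists_chain_of_mem_dirichlet {n : ℕ} {t : ℝ} (ht : ∀ i < n, Regular H i t)
    (hβ : ∀ i ≤ n, ∃ B : Matrix (Fin (H.rk (i + 1))) (Fin (H.rk i)) ℂ, C.β i i t * B = 1)
    {u : Fin (H.rk (n + 1)) ⊕ Fin (H.rk (n + 1)) → ℂ} (hu : u ∈ C.dirichlet n t) :
    ∃ T, (∀ i ≤ n, T i ∈ C.transferS i t) ∧ H.chain T (n + 1) = u := by
  induction n with
  | zero =>
    obtain ⟨B, hB, rfl⟩ := hu
    set T₀ := fromBlocks B (-(B * C.α 0 0 t)) (C.δ 0 0 t * B)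
      (C.γ 0 0 t - C.δ 0 0 t * B * C.α 0 0 t)
    refine ⟨Function.update 0 0 T₀, fun i hi => ?_, ?_⟩
    · obtain rfl : i = 0 := by omega
      rw [Function.update_self]
      exact ⟨B, hB, rfl⟩
    · rw [chain, chain, Function.update_self, fromBlocks_mulVec, Sum.elim_comp_inl,
        Sum.elim_comp_inr, mulVec_zero, mulVec_zero, add_zero, add_zero, fromRows_mulVec]
  | succ n ih =>
    obtain ⟨b, hb, rfl⟩ := C.mem_dirichlet.mp hu
    have hr := ht n (by omega)
    obtain ⟨x, h1, h2, h3⟩ := hr.exists_solution C b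
    rw [hb, eq_comm] at h2
    obtain ⟨T, hT, hTx⟩ := ih (fun i hi => ht i (by omega)) (fun i hi => hβ i (by omega))
      (C.mem_dirichlet.mpr ⟨x, h2, rfl⟩)
    obtain ⟨B₀, hB₀⟩ := hβ (n + 1) le_rfl
    -- `β b = 0` would force `x = 0`, contradicting `β_{0,n} x = 1`.
    obtain ⟨B, hB, hBb⟩ := exists_rightInverse_mulVec hB₀ (b := b) (by
      intro h0
      rw [h0] at h1
      rw [hr.eq_zero C h1, mulVec_zero] at h2
      exact zero_ne_one (congrFun h2 default))
    rw [← h1] at hBb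
    set T₁ := fromBlocks B (-(B * C.α (n + 1) (n + 1) t)) (C.δ (n + 1) (n + 1) t * B)
      (C.γ (n + 1) (n + 1) t - C.δ (n + 1) (n + 1) t * B * C.α (n + 1) (n + 1) t) with hT₁
    refine ⟨Function.update T (n + 1) T₁, fun i hi => ?_, ?_⟩
    · rcases eq_or_lt_of_le hi with rfl | hlt
      · rw [Function.update_self]
        exact ⟨B, hB, rfl⟩
      · rw [Function.update_of_ne hlt.ne]
        exact hT i (by omega)
    · rw [chain, Function.update_self, chain_congr (T' := T) fun i hi => Function.update_of_ne hi.ne _ _,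
        hTx, hT₁, Matrix.mul_assoc (C.δ _ _ _), fromBlocks_mulVec_vec, ← mulVec_mulVec,
        ← mulVec_sub, hBb, BoundaryVector.vec, h3, add_comm (_ *ᵥ _)]

theorem dirichlet_nonempty {n : ℕ} {t : ℝ} (ht : ∀ i < n, Regular H i t)
    (hβ : ∀ i ≤ n, ∃ B : Matrix (Fin (H.rk (i + 1))) (Fin (H.rk i)) ℂ, C.β i i t * B = 1) :
    (C.dirichlet n t).Nonempty := by
  have h : ∀ i, ∃ T, i ≤ n → T ∈ C.transferS i t := by
    intro i
    by_cases hi : i ≤ n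
    · obtain ⟨B, hB⟩ := hβ i hi
      exact ⟨_, fun _ => ⟨B, hB, rfl⟩⟩
    · exact ⟨0, fun h => absurd h hi⟩
  choose T hT using h
  exact ⟨_, C.chain_mem_dirichlet ht fun i hi => C.transferS_subset i t (hT i hi)⟩

theorem isGreatest_inv {S D : Set ℝ} {κ : ℝ} (hκ : 0 < κ) (hD : IsLeast D κ⁻¹)
    (hS : S = (fun a => a⁻¹) '' D) : IsGreatest S κ := by
  subst hS
  refine ⟨⟨κ⁻¹, hD.1, inv_inv κ⟩, ?_⟩
  rintro _ ⟨a, ha, rfl⟩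
  have h := hD.2 ha
  exact (inv_le_comm₀ (lt_of_lt_of_le (inv_pos.mpr hκ) h) hκ).mpr h

end Channels

end ShellOperator

namespace ShellOperator

open scoped Classical

set_option linter.unusedSectionVars false

variable {G : Type*} {H : ShellOperator G}

namespace Channels

variable (C : H.Channels)

/-! ### Generic points -/

theorem transferValues_eq {n : ℕ} {t : ℝ} (ht : ∀ i < n, Regular H i t)
    (hβ : ∀ i ≤ n, ∃ B : Matrix (Fin (H.rk (i + 1))) (Fin (H.rk i)) ℂ, C.β i i t * B = 1) :
    C.transferValues n t = (fun a => a⁻¹) '' C.dirichletValues n t := by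
  ext a
  constructor
  · rintro ⟨T, hT, rfl⟩
    exact ⟨_, ⟨_, C.chain_mem_dirichlet ht hT, rfl⟩, rfl⟩
  · rintro ⟨_, ⟨u, hu, rfl⟩, rfl⟩
    obtain ⟨T, hT, rfl⟩ := C.exists_chain_of_mem_dirichlet ht hβ hu
    exact ⟨T, fun i hi => C.transferS_subset i t (hT i hi), rfl⟩

theorem transferSValues_eq {n : ℕ} {t : ℝ} (ht : ∀ i < n, Regular H i t)
    (hβ : ∀ i ≤ n, ∃ B : Matrix (Fin (H.rk (i + 1))) (Fin (H.rk i)) ℂ, C.β i i t * B = 1) :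
    C.transferSValues n t = (fun a => a⁻¹) '' C.dirichletValues n t := by
  ext a
  constructor
  · rintro ⟨T, hT, rfl⟩
    exact ⟨_, ⟨_, C.chain_mem_dirichlet ht fun i hi => C.transferS_subset i t (hT i hi), rfl⟩, rfl⟩
  · rintro ⟨_, ⟨u, hu, rfl⟩, rfl⟩
    obtain ⟨T, hT, rfl⟩ := C.exists_chain_of_mem_dirichlet ht hβ hu
    exact ⟨T, hT, rfl⟩

theorem map_C_map_eval {a b : Type*} (A : Matrix a b ℂ) (z : ℂ) :
    (A.map Polynomial.C).map (Polynomial.evalRingHom z) = A := by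
  ext i j
  simp

/-- A polynomial multiple of `det (β_n γ_n)`. -/
def rankPoly (n : ℕ) : Polynomial ℂ :=
  (((C.colIn n n)ᴴ.map Polynomial.C * ((H.part n n).map Polynomial.C - (Polynomial.X : Polynomial ℂ) • 1).adjugate *
      (C.colOut n n).map Polynomial.C) *
    ((C.colOut n n)ᴴ.map Polynomial.C * ((H.part n n).map Polynomial.C - (Polynomial.X : Polynomial ℂ) • 1).adjugate *
      (C.colIn n n).map Polynomial.C)).det

theorem eval_rankPoly {n : ℕ} {t : ℝ} (ht : t ∉ H.specSet n n) :
    ∃ d : ℂ, d ≠ 0 ∧ (C.rankPoly n).eval (t : ℂ)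
      = (d • (C.β n n t * C.γ n n t)).det := by
  have hu := (Matrix.isUnit_iff_isUnit_det _).mp (isUnit_of_notMem ht)
  set d := (H.part n n - (t : ℂ) • 1).det with hd
  refine ⟨d * d, mul_ne_zero hu.ne_zero hu.ne_zero, ?_⟩
  have hadj : (H.part n n - (t : ℂ) • 1).adjugate = d • (H.part n n - (t : ℂ) • 1)⁻¹ := by
    rw [Matrix.inv_def, smul_smul, ← hd, Ring.mul_inverse_cancel _ hu, one_smul]
  have hP : ((H.part n n).map Polynomial.C - (Polynomial.X : Polynomial ℂ) • 1).map
      (Polynomial.evalRingHom (t : ℂ)) = H.part n n - (t : ℂ) • 1 := by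
    ext i j
    by_cases hij : i = j <;> simp [hij, one_apply]
  have hA : (((H.part n n).map Polynomial.C - (Polynomial.X : Polynomial ℂ) • 1).adjugate).map
      (Polynomial.evalRingHom (t : ℂ)) = d • (H.part n n - (t : ℂ) • 1)⁻¹ := by
    have := RingHom.map_adjugate (Polynomial.evalRingHom (t : ℂ))
      ((H.part n n).map Polynomial.C - (Polynomial.X : Polynomial ℂ) • 1)
    rw [RingHom.mapMatrix_apply, RingHom.mapMatrix_apply, hP, hadj] at this
    exact this
  rw [← Polynomial.coe_evalRingHom, rankPoly, RingHom.map_det, RingHom.mapMatrix_apply]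
  simp only [Matrix.map_mul]
  rw [hA, map_C_map_eval, map_C_map_eval, map_C_map_eval, map_C_map_eval, C.β_eq ht, C.γ_eq ht]
  simp only [Matrix.mul_smul, Matrix.smul_mul, smul_smul]

open scoped ComplexOrder in
-- At real regular `t` one has `γ = β*`, so full rank of `β` means `det (β γ) ≠ 0`. Up to a nonzero
-- factor this is a polynomial in `t`; being nonzero at one point it has finitely many roots. The
-- right inverse is `γ (β γ)⁻¹`.
theorem exists_rightInverse_β (hA2 : ∀ n, ∀ᵐ t : ℝ, (C.β n n (t : ℂ)).rank = H.rk n) (n : ℕ) :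
    ∀ᶠ t : ℝ in cofinite,
      ∃ B : Matrix (Fin (H.rk (n + 1))) (Fin (H.rk n)) ℂ, C.β n n t * B = 1 := by
  have hspec : ∀ᶠ t : ℝ in cofinite, t ∉ H.specSet n n := (finite_specSet n n).compl_mem_cofinite
  have hne : C.rankPoly n ≠ 0 := by
    have hae : ∀ᵐ t : ℝ, t ∉ H.specSet n n :=
      measure_eq_zero_iff_ae_notMem.mp ((finite_specSet n n).measure_zero _)
    obtain ⟨t, h1, h2⟩ := ((hA2 n).and hae).exists
    obtain ⟨d, hd, hev⟩ := C.eval_rankPoly h2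
    intro h0
    rw [h0, Polynomial.eval_zero, det_smul, eq_comm, mul_eq_zero,
      or_iff_right (pow_ne_zero _ hd), ← C.conjTranspose_β h2] at hev
    have hu : IsUnit (C.β n n t * (C.β n n t)ᴴ) := by
      rw [← Matrix.mulVec_injective_iff_isUnit]
      refine (injective_iff_map_eq_zero (C.β n n t * (C.β n n t)ᴴ).mulVecLin).mpr fun x hx => ?_
      refine injective_mulVec_of_rank ?_ hx
      rw [rank_self_mul_conjTranspose, h1, Fintype.card_fin]
    rw [Matrix.isUnit_iff_isUnit_det, hev] at hu
    exact not_isUnit_zero hu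
  have hroot : ∀ᶠ t : ℝ in cofinite, (C.rankPoly n).eval (t : ℂ) ≠ 0 := by
    have hf : {t : ℝ | (C.rankPoly n).eval (t : ℂ) = 0}.Finite := by
      refine Set.Finite.preimage (f := fun t : ℝ => (t : ℂ)) Complex.ofReal_injective.injOn
        (s := {z | (C.rankPoly n).IsRoot z}) ?_
      exact Polynomial.finite_setOfPred_isRoot hne
    exact hf.compl_mem_cofinite
  filter_upwards [hspec, hroot] with t h1 h2
  obtain ⟨d, hd, hev⟩ := C.eval_rankPoly h1
  rw [hev, det_smul, mul_ne_zero_iff] at h2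
  refine ⟨C.γ n n t * (C.β n n t * C.γ n n t)⁻¹, ?_⟩
  rw [← Matrix.mul_assoc, Matrix.mul_nonsing_inv _ (isUnit_iff_ne_zero.mpr h2.2)]

theorem eventually_regular (n : ℕ) : ∀ᶠ t : ℝ in cofinite, Regular H n t := by
  filter_upwards [(finite_specSet (H := H) 0 n).compl_mem_cofinite,
    (finite_specSet (H := H) (n + 1) (n + 1)).compl_mem_cofinite,
    (finite_specSet (H := H) 0 (n + 1)).compl_mem_cofinite] with t h1 h2 h3
  exact ⟨h1, h2, h3⟩

theorem eventually_densities (hA2 : ∀ n, ∀ᵐ t : ℝ, (C.β n n (t : ℂ)).rank = H.rk n) (n : ℕ) :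
    ∀ᶠ t : ℝ in cofinite, 0 < C.exitEnergy n t ∧
      IsLeast (C.dirichletValues n t) (C.exitEnergy n t)⁻¹ ∧
      IsGreatest (C.transferValues n t) (C.exitEnergy n t) ∧
      IsGreatest (C.transferSValues n t) (C.exitEnergy n t) ∧
      C.cutDensity n t = C.density n t ∧
      C.density n t = C.densityD n t ∧
      C.density n t = C.densityT n t ∧
      C.density n t = C.densityS n t := by
  have h1 : ∀ᶠ t : ℝ in cofinite, ∀ i < n, Regular H i t :=
    (Set.finite_Iio n).eventually_all.mpr fun i _ => eventually_regular i
  have h2 : ∀ᶠ t : ℝ in cofinite, ∀ i ≤ n,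
      ∃ B : Matrix (Fin (H.rk (i + 1))) (Fin (H.rk i)) ℂ, C.β i i t * B = 1 :=
    (Set.finite_Iic n).eventually_all.mpr fun i _ => C.exists_rightInverse_β hA2 i
  filter_upwards [h1, h2, (finite_specSet (H := H) 0 n).compl_mem_cofinite] with t ht hβ hs
  obtain ⟨hpos, hl⟩ := C.isLeast_dirichletValues hs (C.dirichlet_nonempty ht hβ)
  have hg := isGreatest_inv hpos hl (C.transferValues_eq ht hβ)
  have hgS := isGreatest_inv hpos hl (C.transferSValues_eq ht hβ)
  refine ⟨hpos, hl, hg, hgS, ?_, ?_, ?_, ?_⟩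
  · rw [C.cutDensity_eq hs, C.density_eq hs]
  · rw [C.density_eq hs, densityD, hl.csInf_eq, inv_inv]
  · rw [C.density_eq hs, densityT, hg.csSup_eq]
  · rw [C.density_eq hs, densityS, hgS.csSup_eq]

end Channels

end ShellOperator

/-! ### Passage between the densities, which agree off a finite set -/

theorem lineMeasure_congr {f g : ℝ → ℝ} (h : ∀ᶠ t : ℝ in cofinite, f t = g t) :
    lineMeasure f = lineMeasure g := by
  refine withDensity_congr_ae ?_
  have h2 : ∀ᵐ t : ℝ, f t = g t := (Set.Finite.measure_zero h _ : volume {t | f t = g t}ᶜ = 0)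
  filter_upwards [h2] with t ht
  rw [ht]

end

theorem theorem1 {G : Type*} (H : ShellOperator G) (C : H.Channels)
    (hH : IsSelfAdjoint H.natural)
    (hA1 : ∀ n, H.rk n ≤ H.rk (n + 1))
    (hA2 : ∀ n, ∀ᵐ t : ℝ, (C.β n n (t : ℂ)).rank = H.rk n) :
    ∃ μ ν ρ : Measure ℝ,
      (∀ μ' : Measure ℝ, IsSpectralMeasure H.natural C.root μ' ↔ μ' = μ) ∧
      ν = H.compactEigenMeasure C.root ∧
      ν (⋃ m, ⋂ n ≥ m, C.singSet 0 n)ᶜ = 0 ∧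
      μ = ν + ρ ∧
      WeakLim (fun n => lineMeasure (C.density n)) ρ ∧
      WeakLim (fun n => lineMeasure (C.densityD n)) ρ ∧
      WeakLim (fun n => lineMeasure (C.densityT n)) ρ ∧
      WeakLim (fun n => lineMeasure (C.densityS n)) ρ ∧
      ∀ n, ∀ᶠ t : ℝ in Filter.cofinite,
        (∃ a, 0 < a ∧ IsLeast (C.dirichletValues n t) a) ∧
        (∃ a, IsGreatest (C.transferValues n t) a) ∧
        (∃ a, IsGreatest (C.transferSValues n t) a) ∧
        C.density n t = C.densityD n t ∧
        C.density n t = C.densityT n t ∧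
        C.density n t = C.densityS n t := by
  obtain ⟨μ, ρ, hμ, hsum, hlim⟩ := C.exists_spectral_decomposition hH
  have hd := C.eventually_densities hA2
  have h0 : ∀ n, lineMeasure (C.cutDensity n) = lineMeasure (C.density n) := fun n =>
    lineMeasure_congr ((hd n).mono fun t h => h.2.2.2.2.1)
  have hD : ∀ n, lineMeasure (C.density n) = lineMeasure (C.densityD n) := fun n =>
    lineMeasure_congr ((hd n).mono fun t h => h.2.2.2.2.2.1)
  have hT : ∀ n, lineMeasure (C.density n) = lineMeasure (C.densityT n) := fun n =>
    lineMeasure_congr ((hd n).mono fun t h => h.2.2.2.2.2.2.1)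
  have hS : ∀ n, lineMeasure (C.density n) = lineMeasure (C.densityS n) := fun n =>
    lineMeasure_congr ((hd n).mono fun t h => h.2.2.2.2.2.2.2)
  simp only [h0] at hlim
  refine ⟨μ, H.compactEigenMeasure C.root, ρ, hμ, rfl, C.compactEigenMeasure_compl_singSet, hsum,
    hlim, ?_, ?_, ?_, fun n => ?_⟩
  · simpa only [hD] using hlim
  · simpa only [hT] using hlim
  · simpa only [hS] using hlim
  · filter_upwards [hd n] with t ⟨hpos, hl, hg, hgS, _, h1, h2, h3⟩
    exact ⟨⟨_, inv_pos.mpr hpos, hl⟩, ⟨_, hg⟩, ⟨_, hgS⟩, h1, h2, h3⟩
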